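/- Fix $\alpha>0$ and $\mu\in(\tfrac12,1)$. On $\mathbb{R}^2$ consider the vorticity form of the viscous Camassa--Holm equations $$\partial_t\tilde v+u\cdot\nabla\tilde v=\Delta\tilde v,\qquad u=B(H_\alpha(\tilde v)),\qquad \tilde v(0)=\tilde v_0,$$ where $H_\alpha(f)$ denotes the solution $g\in L^1(\mathbb{R}^2)$ of $g-\alpha^2\Delta g=f$ and $B(g)(x)=\frac1{2\pi}\int_{\mathbb{R}^2}\frac{(x-y)^\perp}{|x-y|^2}g(y)\,dy$, $(x_1,x_2)^\perp=(-x_2,x_1)$, is the Biot--Savart operator. A solution is a function $\tilde v\in L^\infty([0,\infty);L^1(\mathbb{R}^2))$ with $\tilde v(0)=\tilde v_0$ satisfying, for all $t>0$, $$\tilde v(t)=\Phi(t)*\tilde v_0-\int_0^t\nabla\Phi(t-s)*[u(s)\,\tilde v(s)]\,ds,\qquad \Phi(x,t)=\frac{1}{4\pi t}e^{-|x|^2/(4t)}.$$ Let $\|f\|_3^2=\int_{\mathbb{R}^2}(1+|x|^2)^3|f(x)|^2\,dx$, let $L^2(3)$ be the space of measurable $f:\mathbb{R}^2\to\mathbb{R}$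 with $\|f\|_3<\infty$, and let $\Omega(x,t)=\frac{1}{4\pi(1+t)}e^{-|x|^2/(4(1+t))}$. Then there exist $r_0>0$ and $C$, depending only on $\alpha$ and $\mu$, such that for every $\tilde v_0\in L^2(3)$ with $\|\tilde v_0\|_3\le r_0$ there is a unique solution $\tilde v$ with initial data $\tilde v_0$, and for all $1\le p\le 2$ and all $t\ge0$ it satisfies $$\Big|\tilde v(\cdot,t)-a\big(\Omega(\cdot,t)-\alpha^2\Delta\Omega(\cdot,t)\big)-\sum_{i=1,2}b_i\big(\partial_i\Omega(\cdot,t)-\alpha^2\Delta\partial_i\Omega(\cdot,t)\big)\Big|_{L^p(\mathbb{R}^2)}\le C(1+t)^{-1-\mu+\frac1p},$$ where $a=\int_{\mathbb{R}^2}\tilde v_0\,dx$ and $b_i=-\int_{\mathbb{R}^2}x_i\tilde v_0(x)\,dx$. -/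

import Mathlib

open MeasureTheory Set
open scoped ENNReal

noncomputable section

namespace VCHE

/-- The plane, with its Euclidean norm. -/
abbrev Plane : Type := EuclideanSpace ℝ (Fin 2)

/-- Rotation by a right angle, `(x₁, x₂) ↦ (-x₂, x₁)`. -/
def perp (x : Plane) : Plane := !₂[-x 1, x 0]

/-- Convolution with the Biot-Savart kernel `x^⊥ / (2π |x|²)`. -/
def biotSavart (w : Plane → ℝ) (x : Plane) : Plane :=
  (2 * Real.pi)⁻¹ • ∫ y : Plane, (w y / ‖x - y‖ ^ 2) • perp (x - y)

/-- The Helmholtz filter as a relation: `u ∈ L¹` is the solution `H_α f` of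
`u - α² Δ u = f` on the plane, in the sense of distributions. -/
def IsHelmholtzFilter (α : ℝ) (f u : Plane → ℝ) : Prop :=
  Integrable u ∧
    ∀ φ : Plane → ℝ, ContDiff ℝ (⊤ : ℕ∞) φ → HasCompactSupport φ →
      ∫ x, u x * (φ x - α ^ 2 * Laplacian.laplacian φ x) = ∫ x, f x * φ x

/-- The heat kernel of the plane. -/
def heatKernel (t : ℝ) (x : Plane) : ℝ :=
  (4 * Real.pi * t)⁻¹ * Real.exp (-‖x‖ ^ 2 / (4 * t))

/-- `v ∈ L^∞([0,∞); L¹)` is a (global, mild) solution, with initial data `v₀`, of the vorticity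
equation `∂ₜ v + u · ∇v = Δ v`, `u = B (H_α v)`:
`v(t) = e^{tΔ} v₀ - ∫₀ᵗ ∇Φ(t-s) * [u(s) v(s)] ds`. Here `w s` is the filtered vorticity `H_α (v s)`
and `B (w s)` is the velocity `u(s)`. -/
structure IsVorticitySolution (α : ℝ) (v₀ : Plane → ℝ) (v : ℝ → Plane → ℝ) : Prop where
  aestronglyMeasurable : AEStronglyMeasurable (fun q : ℝ × Plane => v q.1 q.2)
    ((volume.restrict (Ici (0 : ℝ))).prod volume)
  integrable : ∀ t, 0 ≤ t → Integrable (v t)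
  bounded : ∃ M : ℝ, ∀ t, 0 ≤ t → ∫ x, |v t x| ≤ M
  initial : v 0 =ᵐ[volume] v₀
  mild : ∃ w : ℝ → Plane → ℝ, (∀ s, 0 ≤ s → IsHelmholtzFilter α (v s) (w s)) ∧
    ∀ t, 0 < t → ∀ᵐ x : Plane,
      v t x = (∫ y : Plane, heatKernel t (x - y) * v₀ y)
        - ∫ s in Ioo 0 t, ∫ y : Plane,
            inner ℝ (gradient (heatKernel (t - s)) (x - y)) (v s y • biotSavart (w s) y)

/-- The weighted norm `‖f‖_m = (∫ (1 + |x|²)^m |f(x)|² dx)^{1/2}`, with value `∞` allowed. -/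
def weightedNorm (m : ℕ) (f : Plane → ℝ) : ℝ≥0∞ :=
  eLpNorm (fun x => Real.sqrt (1 + ‖x‖ ^ 2) ^ m * f x) 2 volume

/-- Membership in the weighted space `L²(m)`. -/
def MemWeightedL2 (m : ℕ) (f : Plane → ℝ) : Prop :=
  AEStronglyMeasurable f volume ∧ weightedNorm m f < ∞

/-- The Oseen vortex `Ω(x,t) = (4π(1+t))⁻¹ exp(-|x|²/(4(1+t)))`. -/
def oseen (t : ℝ) (x : Plane) : ℝ :=
  (4 * Real.pi * (1 + t))⁻¹ * Real.exp (-‖x‖ ^ 2 / (4 * (1 + t)))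

/-- The partial derivative `∂ᵢ f`. -/
def partialDeriv (i : Fin 2) (f : Plane → ℝ) (x : Plane) : ℝ :=
  fderiv ℝ f x (EuclideanSpace.single i 1)

/-- The un-filtering operator `f ↦ f - α² Δ f`. -/
def unfilter (α : ℝ) (f : Plane → ℝ) (x : Plane) : ℝ :=
  f x - α ^ 2 * Laplacian.laplacian f x

end VCHE

end

noncomputable section

namespace VCHE

/-! ### Pointwise estimates for the heat kernel -/

/-! The solution is compared with a pair of Oseen vortices A(t) = c₀ Φ(1+t, ·) + c₁ Φ(1+t, · + e),
|e| ≤ 1, chosen to carry the mass and the first moments of the data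
(`exists_vortexPair_of_weightedNorm_le`). Such a pair has three virtues. By the semigroup law it
solves the heat equation exactly (`heatConv_vortexPair`). A radial vortex is not advected by its own
tangential velocity: a reflection argument shows that its self-flux is annihilated by convolution
with ∇Φ(τ). By bilinearity, the self-interaction of the pair then reduces to -c₀c₁ times that of the
difference Φ(· + e) - Φ, which is smaller by (1+t)^{-1/2} in each factor (`convGrad_flux_pair`,
`fluxBound_vortexDiff`). Finally, Taylor expansion in e shows that A differs from the required
profile by Gaussians of relative size (1+t)^{-1}; the α²Δ terms are no larger
(`gaussBound_vortexPair_sub_profile`).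

The remainder q = v - A solves an integral equation whose data have neither mass nor first moments
and whose flux no longer contains the self-interaction of single vortices
(`mildMap_sub_vortexPair`). Two cancellations make it decay. The second-order Taylor remainder of
the heat kernel turns a |x|^{2μ} moment of the data into a factor t^{-μ}. The flux has zero mean
because the velocity kernel is odd, so ∇Φ may be replaced by its increments, and a |x|^μ moment of
the flux yields an extra τ^{-μ/2}. The working norm controls q in L¹ by (1+t)^{-μ} and |x|^μ q in L¹
by (1+t)^{-μ/2}; the fluxes are better by half a power (`fluxBound_remFlux`), and the Duhamel
integral gives this gain back since (1+μ)/2 < 1 (`exists_remBound_duhamel`). For small data the mild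
map is a contraction in this norm (`exists_mildMap_fixedPoint`).

The filter enters through the velocity kernel alone. H_α is convolution with the Bessel probability
measure, a superposition of Gaussians, so the velocity is convolution of the unfiltered vorticity
with an averaged Biot-Savart kernel (`biotSavart_eq_velocity`). That kernel is bounded, which makes
the flux locally Lipschitz on L¹ and gives uniqueness in the whole class of solutions without
smallness (`IsVorticitySolution.unique`). Its Gaussian averages still obey the scale-invariant bound
τ^{-1/2} of 1/|x|, which supplies the decay of interactions with the vortices.

The case p = 1 of the decay is part of the working norm. The case p = 2 is reached through L^{4/3},
since ∇Φ(τ) maps L¹ to L² only with the non-integrable norm τ^{-1}, but maps L¹ to L^{4/3} and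
L^{4/3} to L² with norm τ^{-3/4} (`exists_lintegral_sq_rem_le`). The intermediate p follow by
interpolation. -/

lemma heatKernel_nonneg {τ : ℝ} (hτ : 0 ≤ τ) (x : Plane) : 0 ≤ heatKernel τ x := by
  unfold heatKernel; positivity

/-- Half of the Gaussian exponent is kept in the wider kernel; the other half is a surplus that can
absorb polynomial factors. -/
lemma heatKernel_eq_two_mul {τ : ℝ} (hτ : 0 < τ) (x : Plane) :
    heatKernel τ x = 2 * heatKernel (2 * τ) x * Real.exp (-(‖x‖ ^ 2 / τ / 8)) := by
  unfold heatKernel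
  rw [show -‖x‖ ^ 2 / (4 * τ) = -‖x‖ ^ 2 / (4 * (2 * τ)) + -(‖x‖ ^ 2 / τ / 8) by field_simp; ring,
    Real.exp_add]
  field_simp

/-- Polynomial factors of degree at most four are absorbed by doubling the variance. -/
lemma poly_mul_heatKernel_le {τ : ℝ} (hτ : 0 < τ) (x : Plane) :
    (1 + ‖x‖ / √τ) ^ 4 * heatKernel τ x ≤ 2064 * heatKernel (2 * τ) x := by
  set ρ := ‖x‖ / √τ with hρ
  have hρ0 : 0 ≤ ρ := by positivity
  have hρ2 : ‖x‖ ^ 2 / τ = ρ ^ 2 := by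
    rw [hρ, div_pow, Real.sq_sqrt hτ.le]
  rw [heatKernel_eq_two_mul hτ, hρ2]
  have h0 := heatKernel_nonneg (by positivity : 0 ≤ 2 * τ) x
  -- The quadratic term of the exponential series gives ρ⁴ ≤ 128 e^{ρ²/8}, so 8(1 + ρ⁴) ≤ (8 +
  -- 8·128) e^{ρ²/8}. The constant 2064 is twice 1032.
  have h1 : (1 + ρ) ^ 4 ≤ 8 * (1 + ρ ^ 4) := by
    nlinarith [sq_nonneg (ρ - 1), sq_nonneg (ρ ^ 2 - 1), sq_nonneg (ρ ^ 2 - ρ), mul_nonneg hρ0 hρ0,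
      sq_nonneg (ρ ^ 2 - 2 * ρ + 1)]
  have h2 : (ρ ^ 2 / 8) ^ 2 / 2 ≤ Real.exp (ρ ^ 2 / 8) := by
    simpa using Real.pow_div_factorial_le_exp (ρ ^ 2 / 8) (by positivity) 2
  have h3 : 1 ≤ Real.exp (ρ ^ 2 / 8) := Real.one_le_exp (by positivity)
  have h4 : (1 + ρ) ^ 4 * Real.exp (-(ρ ^ 2 / 8)) ≤ 1032 := by
    rw [Real.exp_neg, ← div_eq_mul_inv, div_le_iff₀ (Real.exp_pos _)]
    nlinarith
  nlinarith

/-- The form in which the kernel estimates below are obtained: a prefactor need only be compared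
with the fourth power of 1 + |x|/√τ. -/
lemma le_heatKernel_of_le {τ : ℝ} (hτ : 0 < τ) (x : Plane) {c q : ℝ} (hc : 0 ≤ c)
    (hq : q ≤ c * (1 + ‖x‖ / √τ) ^ 4) :
    q * heatKernel τ x ≤ 2064 * c * heatKernel (2 * τ) x := by
  have h := poly_mul_heatKernel_le hτ x
  have h0 := heatKernel_nonneg hτ.le x
  nlinarith [mul_le_mul_of_nonneg_right hq h0, mul_le_mul_of_nonneg_left h hc]

lemma le_poly_four {ρ : ℝ} (hρ : 0 ≤ ρ) : 1 ≤ (1 + ρ) ^ 4 ∧ ρ ≤ (1 + ρ) ^ 4 ∧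
    ρ ^ 2 ≤ (1 + ρ) ^ 4 ∧ ρ ^ 3 ≤ (1 + ρ) ^ 4 := by
  refine ⟨?_, ?_, ?_, ?_⟩ <;> nlinarith [pow_nonneg hρ 2, pow_nonneg hρ 3, pow_nonneg hρ 4]

lemma heatKernel_le_two_mul {τ : ℝ} (hτ : 0 < τ) (x : Plane) :
    heatKernel τ x ≤ 2064 * heatKernel (2 * τ) x := by
  simpa using le_heatKernel_of_le hτ x (c := 1) (q := 1) zero_le_one
    (by simpa using (le_poly_four (by positivity : 0 ≤ ‖x‖ / √τ)).1)

lemma rpow_norm_mul_heatKernel_le {τ k : ℝ} (hτ : 0 < τ) (hk : 0 ≤ k) (hk2 : k ≤ 4) (x : Plane) :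
    ‖x‖ ^ k * heatKernel τ x ≤ 2064 * τ ^ (k / 2) * heatKernel (2 * τ) x := by
  refine le_heatKernel_of_le hτ x (by positivity) ?_
  have h1 : ‖x‖ = √τ * (‖x‖ / √τ) := by field_simp
  have h2 : √τ ^ k = τ ^ (k / 2) := by
    rw [Real.sqrt_eq_rpow, ← Real.rpow_mul hτ.le]; ring_nf
  calc ‖x‖ ^ k = τ ^ (k / 2) * (‖x‖ / √τ) ^ k := by
        conv_lhs => rw [h1, Real.mul_rpow (by positivity) (by positivity), h2]
    _ ≤ τ ^ (k / 2) * (1 + ‖x‖ / √τ) ^ (4 : ℝ) := by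
        gcongr
        calc (‖x‖ / √τ) ^ k ≤ (1 + ‖x‖ / √τ) ^ k := by gcongr; simp
          _ ≤ _ := by
            apply Real.rpow_le_rpow_of_exponent_le _ hk2
            simp; positivity
    _ = _ := by norm_cast

/-- From |x|² ≤ 2|x+e|² + 2|e|², a shift by at most √τ costs a doubling of the variance and a factor
e^{1/4} ≤ 2; the normalization contributes the other factor 2. -/
lemma heatKernel_add_le {τ : ℝ} (hτ : 0 < τ) {e : Plane} (he : ‖e‖ ^ 2 ≤ τ) (x : Plane) :
    heatKernel τ (x + e) ≤ 4 * heatKernel (2 * τ) x := by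
  unfold heatKernel
  have h1 : ‖x‖ ^ 2 ≤ 2 * ‖x + e‖ ^ 2 + 2 * ‖e‖ ^ 2 := by
    have : ‖x‖ ≤ ‖x + e‖ + ‖e‖ := by simpa using norm_sub_le (x + e) e
    nlinarith [norm_nonneg x, sq_nonneg (‖x + e‖ - ‖e‖), norm_nonneg (x + e), norm_nonneg e]
  have h2 : Real.exp (-‖x + e‖ ^ 2 / (4 * τ)) ≤ 2 * Real.exp (-‖x‖ ^ 2 / (4 * (2 * τ))) := by
    have : -‖x + e‖ ^ 2 / (4 * τ) ≤ 1 / 4 + -‖x‖ ^ 2 / (4 * (2 * τ)) := by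
      rw [div_add_div _ _ (by norm_num) (by positivity), div_le_div_iff₀ (by positivity) (by positivity)]
      nlinarith
    calc _ ≤ Real.exp (1 / 4 + -‖x‖ ^ 2 / (4 * (2 * τ))) := Real.exp_le_exp.2 this
      _ = Real.exp (1 / 4) * Real.exp (-‖x‖ ^ 2 / (4 * (2 * τ))) := Real.exp_add _ _
      _ ≤ _ := by
        gcongr
        have := Real.exp_one_lt_d9
        calc Real.exp (1 / 4) ≤ Real.exp (Real.log 2) := by
              apply Real.exp_le_exp.2
              linarith [Real.log_two_gt_d9]
          _ = 2 := Real.exp_log (by norm_num)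
  calc (4 * Real.pi * τ)⁻¹ * Real.exp (-‖x + e‖ ^ 2 / (4 * τ))
      ≤ (4 * Real.pi * τ)⁻¹ * (2 * Real.exp (-‖x‖ ^ 2 / (4 * (2 * τ)))) := by gcongr
    _ = _ := by field_simp; ring

lemma hasGradientAt_heatKernel (τ : ℝ) (x : Plane) :
    HasGradientAt (heatKernel τ) ((-(2 * τ)⁻¹ * heatKernel τ x) • x) x := by
  rw [hasGradientAt_iff_hasFDerivAt]
  have h := (((hasStrictFDerivAt_norm_sq x).hasFDerivAt.neg.mul_const ((4 * τ)⁻¹)).exp).const_mul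
    ((4 * Real.pi * τ)⁻¹)
  simp only [← div_eq_mul_inv] at h
  refine h.congr_fderiv ?_
  ext y
  simp [heatKernel]
  ring

lemma gradient_heatKernel (τ : ℝ) (x : Plane) :
    gradient (heatKernel τ) x = (-(2 * τ)⁻¹ * heatKernel τ x) • x :=
  (hasGradientAt_heatKernel τ x).gradient

lemma norm_gradient_heatKernel_le {τ : ℝ} (hτ : 0 < τ) (x : Plane) :
    ‖gradient (heatKernel τ) x‖ ≤ 2064 * (√τ)⁻¹ * heatKernel (2 * τ) x := by
  have h0 := heatKernel_nonneg hτ.le x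
  rw [gradient_heatKernel, norm_smul, norm_mul, norm_neg, norm_inv, Real.norm_of_nonneg h0,
    Real.norm_of_nonneg (by positivity)]
  have : (2 * τ)⁻¹ * heatKernel τ x * ‖x‖ = ((2 * √τ)⁻¹ * (‖x‖ / √τ)) * heatKernel τ x := by
    have : τ = √τ * √τ := (Real.mul_self_sqrt hτ.le).symm
    rw [show (2 * τ)⁻¹ = (2 * (√τ * √τ))⁻¹ by rw [← this]]
    field_simp
  rw [this]
  refine le_heatKernel_of_le hτ x (by positivity) ?_
  have h3 := (le_poly_four (by positivity : 0 ≤ ‖x‖ / √τ)).2.1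
  gcongr
  linarith [Real.sqrt_nonneg τ]

/-- A symmetric mean value inequality. Both exponentials appear on the right because increments of
the heat kernel are to be bounded by the sum of the Gaussians at its two end points. -/
lemma abs_exp_sub_exp_le (a b : ℝ) :
    |Real.exp (-b) - Real.exp (-a)| ≤ |b - a| * (Real.exp (-b) + Real.exp (-a)) := by
  have key : ∀ a b : ℝ, Real.exp (-b) - Real.exp (-a) ≤ |b - a| * (Real.exp (-b) + Real.exp (-a)) := by
    intro a b
    have h1 : Real.exp (-a) ≥ Real.exp (-b) * (1 + (b - a)) := by
      have := Real.add_one_le_exp (b - a)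
      calc Real.exp (-a) = Real.exp (-b) * Real.exp (b - a) := by rw [← Real.exp_add]; ring_nf
        _ ≥ _ := by gcongr; linarith
    nlinarith [Real.exp_pos (-a), Real.exp_pos (-b), neg_abs_le (b - a), abs_nonneg (b - a),
      mul_le_mul_of_nonneg_right (neg_le_abs (b - a)) (Real.exp_pos (-b)).le]
  rw [abs_le]
  constructor
  · have := key b a
    rw [abs_sub_comm] at this
    linarith
  · exact key a b

/-- With h = a - b the claim is e^h - 1 - h ≤ h²(e^h + 1). Since e^h - 1 ≤ h e^h, the left side is
at most h(e^h - 1), which is then estimated according to the sign of h. -/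
lemma abs_exp_taylor_le (a b : ℝ) :
    |Real.exp (-b) - Real.exp (-a) + (b - a) * Real.exp (-a)|
      ≤ (b - a) ^ 2 * (Real.exp (-b) + Real.exp (-a)) := by
  have h1 : Real.exp (-b) = Real.exp (-a) * Real.exp (a - b) := by
    rw [← Real.exp_add]; ring_nf
  have h2 : 0 ≤ Real.exp (a - b) - 1 - (a - b) := by linarith [Real.add_one_le_exp (a - b)]
  have h3 : Real.exp (a - b) - 1 - (a - b) ≤ (a - b) ^ 2 * (Real.exp (a - b) + 1) := by
    have h4 := Real.add_one_le_exp (b - a)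
    have h5 : Real.exp (a - b) * Real.exp (b - a) = 1 := by
      rw [← Real.exp_add]; simp
    have h6 := Real.exp_pos (a - b)
    -- `e^h - 1 ≤ h e^h`
    have h7 : Real.exp (a - b) - 1 ≤ (a - b) * Real.exp (a - b) := by nlinarith
    rcases le_total 0 (a - b) with h | h
    · have : Real.exp (a - b) - 1 - (a - b) ≤ (a - b) * (Real.exp (a - b) - 1) := by nlinarith
      nlinarith
    · nlinarith [Real.add_one_le_exp (a - b)]
  have h8 : Real.exp (-b) - Real.exp (-a) + (b - a) * Real.exp (-a)
      = Real.exp (-a) * (Real.exp (a - b) - 1 - (a - b)) := by rw [h1]; ring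
  rw [h8, abs_of_nonneg (mul_nonneg (Real.exp_pos _).le h2), h1]
  nlinarith [Real.exp_pos (-a)]

lemma abs_norm_sq_sub_le (x y : Plane) :
    |‖x - y‖ ^ 2 - ‖x‖ ^ 2| ≤ ‖y‖ * (‖x - y‖ + ‖x‖) := by
  have h1 : |‖x - y‖ - ‖x‖| ≤ ‖y‖ := by
    simpa using abs_norm_sub_norm_le (x - y) x
  rw [sq_sub_sq, abs_mul, mul_comm, abs_of_nonneg (by positivity : 0 ≤ ‖x - y‖ + ‖x‖)]
  gcongr

lemma heatKernel_eq_exp_neg (τ : ℝ) (x : Plane) :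
    heatKernel τ x = (4 * Real.pi * τ)⁻¹ * Real.exp (-(‖x‖ ^ 2 / (4 * τ))) := by
  rw [heatKernel, neg_div]

lemma abs_heatKernel_sub_le_aux {τ : ℝ} (hτ : 0 < τ) (x y : Plane) :
    |heatKernel τ (x - y) - heatKernel τ x|
      ≤ (‖y‖ / √τ) * ((‖x - y‖ / √τ + ‖x‖ / √τ) / 4) * (heatKernel τ (x - y) + heatKernel τ x) := by
  simp only [heatKernel_eq_exp_neg]
  rw [← mul_sub, abs_mul, abs_of_nonneg (by positivity), ← mul_add]
  rw [mul_left_comm]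
  gcongr
  refine (abs_exp_sub_exp_le _ _).trans ?_
  gcongr
  rw [← sub_div, abs_div, abs_of_nonneg (by positivity : 0 ≤ 4 * τ)]
  rw [div_le_iff₀ (by positivity)]
  refine (abs_norm_sq_sub_le x y).trans (le_of_eq ?_)
  have : 4 * τ = 4 * (√τ * √τ) := by rw [Real.mul_self_sqrt hτ.le]
  rw [this]
  field_simp

lemma norm_div_sqrt_le {τ : ℝ} {x y : Plane} (hy : ‖y‖ / √τ ≤ 1) :
    ‖x‖ / √τ ≤ ‖x - y‖ / √τ + 1 ∧ ‖x - y‖ / √τ ≤ ‖x‖ / √τ + 1 := by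
  have h1 : ‖x‖ ≤ ‖x - y‖ + ‖y‖ := by simpa using norm_add_le (x - y) y
  have h2 : ‖x - y‖ ≤ ‖x‖ + ‖y‖ := norm_sub_le x y
  have h3 := div_le_div_of_nonneg_right h1 (Real.sqrt_nonneg τ)
  have h4 := div_le_div_of_nonneg_right h2 (Real.sqrt_nonneg τ)
  rw [add_div] at h3 h4
  constructor <;> linarith

/-- First-order increments of the heat kernel. -/
lemma abs_heatKernel_sub_le {τ : ℝ} (hτ : 0 < τ) (x y : Plane) (hy : ‖y‖ / √τ ≤ 1) :
    |heatKernel τ (x - y) - heatKernel τ x|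
      ≤ 2064 * (‖y‖ / √τ) * (heatKernel (2 * τ) (x - y) + heatKernel (2 * τ) x) := by
  refine (abs_heatKernel_sub_le_aux hτ x y).trans ?_
  obtain ⟨h1, h2⟩ := norm_div_sqrt_le (x := x) hy
  set z := ‖y‖ / √τ
  have hz : 0 ≤ z := by positivity
  have p1 := (le_poly_four (by positivity : 0 ≤ ‖x - y‖ / √τ))
  have p2 := (le_poly_four (by positivity : 0 ≤ ‖x‖ / √τ))
  rw [mul_add, mul_add]
  apply add_le_add
  · exact le_heatKernel_of_le hτ _ hz (by gcongr; linarith)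
  · exact le_heatKernel_of_le hτ _ hz (by gcongr; linarith)

/-- Increments of the gradient of the heat kernel. -/
lemma norm_gradient_heatKernel_sub_le {τ : ℝ} (hτ : 0 < τ) (x y : Plane) :
    ‖gradient (heatKernel τ) (x - y) - gradient (heatKernel τ) x‖
      ≤ 4128 * (√τ)⁻¹ * min 1 (‖y‖ / √τ) *
        (heatKernel (2 * τ) (x - y) + heatKernel (2 * τ) x) := by
  have k1 := heatKernel_nonneg (by positivity : 0 ≤ 2 * τ) (x - y)
  have k2 := heatKernel_nonneg (by positivity : 0 ≤ 2 * τ) x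
  rcases le_total 1 (‖y‖ / √τ) with hy | hy
  · rw [min_eq_left hy]
    have h1 := norm_gradient_heatKernel_le hτ (x - y)
    have h2 := norm_gradient_heatKernel_le hτ x
    have h3 : 0 ≤ (√τ)⁻¹ := by positivity
    have h4 := norm_sub_le (gradient (heatKernel τ) (x - y)) (gradient (heatKernel τ) x)
    nlinarith [mul_nonneg h3 k1, mul_nonneg h3 k2]
  · rw [min_eq_right hy]
    obtain ⟨h1, h2⟩ := norm_div_sqrt_le (x := x) hy
    have haux := abs_heatKernel_sub_le_aux hτ x y
    have q1 := heatKernel_nonneg hτ.le (x - y)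
    have q2 := heatKernel_nonneg hτ.le x
    -- The gradient is a scalar multiple of Φ(x) x, so its increment splits into the increment of
    -- the vector x and the increment of Φ.
    have e1 : gradient (heatKernel τ) (x - y) - gradient (heatKernel τ) x
        = (-(2 * τ)⁻¹ * heatKernel τ (x - y)) • (-y)
          + (-(2 * τ)⁻¹ * (heatKernel τ (x - y) - heatKernel τ x)) • x := by
      rw [gradient_heatKernel, gradient_heatKernel, mul_sub, sub_smul, smul_sub, smul_neg]
      abel
    have hτs : (2 * τ)⁻¹ = (√τ)⁻¹ * (√τ)⁻¹ / 2 := by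
      rw [← mul_inv, Real.mul_self_sqrt hτ.le, mul_inv]; ring
    set z := ‖y‖ / √τ with hz
    set ρ := ‖x‖ / √τ with hρ
    set ρ' := ‖x - y‖ / √τ with hρ'
    have hz0 : 0 ≤ z := by positivity
    have hρ0 : 0 ≤ ρ := by positivity
    have hρ'0 : 0 ≤ ρ' := by positivity
    have e2 : ‖gradient (heatKernel τ) (x - y) - gradient (heatKernel τ) x‖
        ≤ (√τ)⁻¹ / 2 * (z * heatKernel τ (x - y)
          + ρ * (z * ((ρ' + ρ) / 4) * (heatKernel τ (x - y) + heatKernel τ x))) := by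
      rw [e1]
      refine (norm_add_le _ _).trans ?_
      rw [norm_smul, norm_smul, norm_mul, norm_mul, norm_neg, norm_neg, norm_inv,
        Real.norm_of_nonneg q1, Real.norm_of_nonneg (by positivity : 0 ≤ 2 * τ), hτs, mul_add,
        Real.norm_eq_abs]
      apply add_le_add
      · rw [hz]; apply le_of_eq; field_simp
      · calc _ = (√τ)⁻¹ / 2 * (ρ * |heatKernel τ (x - y) - heatKernel τ x|) := by
              rw [hρ]; field_simp
          _ ≤ _ := by gcongr
    refine e2.trans ?_
    have p1 := (le_poly_four hρ'0)
    have p2 := (le_poly_four hρ0)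
    have t1 : (z * (1 + ρ * ((ρ' + ρ) / 4))) * heatKernel τ (x - y)
        ≤ 2064 * (z * 2) * heatKernel (2 * τ) (x - y) := by
      refine le_heatKernel_of_le hτ _ (by positivity) ?_
      rw [mul_assoc]
      refine mul_le_mul_of_nonneg_left ?_ (by positivity)
      nlinarith
    have t2 : (z * (ρ * ((ρ' + ρ) / 4))) * heatKernel τ x
        ≤ 2064 * (z * 2) * heatKernel (2 * τ) x := by
      refine le_heatKernel_of_le hτ _ (by positivity) ?_
      rw [mul_assoc]
      refine mul_le_mul_of_nonneg_left ?_ (by positivity)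
      nlinarith
    calc _ = (√τ)⁻¹ / 2 * ((z * (1 + ρ * ((ρ' + ρ) / 4))) * heatKernel τ (x - y)
          + (z * (ρ * ((ρ' + ρ) / 4))) * heatKernel τ x) := by ring
      _ ≤ (√τ)⁻¹ / 2 * (2064 * (z * 2) * heatKernel (2 * τ) (x - y)
          + 2064 * (z * 2) * heatKernel (2 * τ) x) := by gcongr
      _ ≤ _ := by
        have : 0 ≤ (√τ)⁻¹ * z * (heatKernel (2 * τ) (x - y) + heatKernel (2 * τ) x) := by positivity
        linarith

/-- Second-order Taylor remainder of the heat kernel. -/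
lemma abs_heatKernel_taylor_le {τ : ℝ} (hτ : 0 < τ) (x y : Plane) :
    |heatKernel τ (x - y) - heatKernel τ x + inner ℝ y (gradient (heatKernel τ) x)|
      ≤ 8256 * (min 1 ((‖y‖ / √τ) ^ 2) * heatKernel (2 * τ) (x - y)
        + min (‖y‖ / √τ) ((‖y‖ / √τ) ^ 2) * heatKernel (2 * τ) x) := by
  have k1 := heatKernel_nonneg (by positivity : 0 ≤ 2 * τ) (x - y)
  have k2 := heatKernel_nonneg (by positivity : 0 ≤ 2 * τ) x
  have q1 := heatKernel_nonneg hτ.le (x - y)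
  have q2 := heatKernel_nonneg hτ.le x
  have hs := Real.sqrt_pos.2 hτ
  rcases le_total 1 (‖y‖ / √τ) with hy | hy
  -- For |y| ≥ √τ nothing is gained from Taylor expansion. The gradient term grows linearly in |y|,
  -- which is why the Gaussian at x carries min(z, z²) and the one at x - y only min(1, z²).
  · rw [min_eq_left (by nlinarith), min_eq_left (by nlinarith)]
    have h1 := heatKernel_le_two_mul hτ (x - y)
    have h2 := heatKernel_le_two_mul hτ x
    have h3 : |inner ℝ y (gradient (heatKernel τ) x)| ≤ 2064 * (‖y‖ / √τ) * heatKernel (2 * τ) x := by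
      calc _ ≤ ‖y‖ * ‖gradient (heatKernel τ) x‖ := abs_real_inner_le_norm _ _
        _ ≤ ‖y‖ * (2064 * (√τ)⁻¹ * heatKernel (2 * τ) x) := by
          gcongr; exact norm_gradient_heatKernel_le hτ x
        _ = _ := by field_simp
    have h4 := abs_add_le (heatKernel τ (x - y) - heatKernel τ x)
      (inner ℝ y (gradient (heatKernel τ) x))
    have h5 := abs_sub (heatKernel τ (x - y)) (heatKernel τ x)
    rw [abs_of_nonneg q1, abs_of_nonneg q2] at h5
    nlinarith [mul_le_mul_of_nonneg_right hy k2]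
  · rw [min_eq_right (by have : 0 ≤ ‖y‖ / √τ := by positivity
                         nlinarith),
      min_eq_right (by have : 0 ≤ ‖y‖ / √τ := by positivity
                       nlinarith)]
    obtain ⟨h1, h2⟩ := norm_div_sqrt_le (x := x) hy
    set z := ‖y‖ / √τ with hz
    set ρ := ‖x‖ / √τ with hρ
    set ρ' := ‖x - y‖ / √τ with hρ'
    have hz0 : 0 ≤ z := by positivity
    have hρ0 : 0 ≤ ρ := by positivity
    have hρ'0 : 0 ≤ ρ' := by positivity
    set c := (4 * Real.pi * τ)⁻¹ with hc
    have hc0 : 0 ≤ c := by positivity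
    set a := ‖x‖ ^ 2 / (4 * τ) with ha
    set b := ‖x - y‖ ^ 2 / (4 * τ) with hb
    have hba : |b - a| ≤ z * ((ρ' + ρ) / 4) := by
      rw [ha, hb, ← sub_div, abs_div, abs_of_nonneg (by positivity : 0 ≤ 4 * τ),
        div_le_iff₀ (by positivity)]
      refine (abs_norm_sq_sub_le x y).trans (le_of_eq ?_)
      have : 4 * τ = 4 * (√τ * √τ) := by rw [Real.mul_self_sqrt hτ.le]
      rw [this, hz, hρ, hρ']
      field_simp
    have hz2 : ‖y‖ ^ 2 / (4 * τ) = z ^ 2 / 4 := by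
      rw [hz, div_pow, Real.sq_sqrt hτ.le]; field_simp
    -- With Φ(x) = c e^{-a} and Φ(x-y) = c e^{-b}, b - a is |y|²/4τ minus ⟨y,x⟩/2τ. The linear term
    -- of the exponential is thus the gradient term, up to the quadratic correction z²/4 Φ(x).
    have e1 : heatKernel τ (x - y) - heatKernel τ x + inner ℝ y (gradient (heatKernel τ) x)
        = c * (Real.exp (-b) - Real.exp (-a) + (b - a) * Real.exp (-a)) - z ^ 2 / 4 * heatKernel τ x := by
      rw [gradient_heatKernel, inner_smul_right, heatKernel_eq_exp_neg, heatKernel_eq_exp_neg, ← ha,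
        ← hb, ← hc, ← hz2]
      have : b - a = ‖y‖ ^ 2 / (4 * τ) - (2 * τ)⁻¹ * inner ℝ y x := by
        rw [ha, hb, norm_sub_sq_real, real_inner_comm]
        field_simp; ring
      rw [this]
      ring
    have e2 : |heatKernel τ (x - y) - heatKernel τ x + inner ℝ y (gradient (heatKernel τ) x)|
        ≤ (z * ((ρ' + ρ) / 4)) ^ 2 * (heatKernel τ (x - y) + heatKernel τ x)
          + z ^ 2 / 4 * heatKernel τ x := by
      rw [e1]
      refine (abs_sub _ _).trans ?_
      rw [abs_of_nonneg (by positivity : 0 ≤ z ^ 2 / 4 * heatKernel τ x), abs_mul,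
        abs_of_nonneg hc0]
      refine add_le_add_left ?_ _
      have hsq : (b - a) ^ 2 ≤ (z * ((ρ' + ρ) / 4)) ^ 2 := by
        rw [← sq_abs]
        gcongr
      calc c * |Real.exp (-b) - Real.exp (-a) + (b - a) * Real.exp (-a)|
          ≤ c * ((b - a) ^ 2 * (Real.exp (-b) + Real.exp (-a))) := by
            gcongr; exact abs_exp_taylor_le a b
        _ ≤ c * ((z * ((ρ' + ρ) / 4)) ^ 2 * (Real.exp (-b) + Real.exp (-a))) := by
            gcongr
        _ = _ := by rw [heatKernel_eq_exp_neg, heatKernel_eq_exp_neg, ← ha, ← hb, ← hc]; ring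
    refine e2.trans ?_
    have p1 := (le_poly_four hρ'0)
    have p2 := (le_poly_four hρ0)
    have t1 : (z ^ 2 * ((ρ' + ρ) / 4) ^ 2) * heatKernel τ (x - y)
        ≤ 2064 * (z ^ 2 * 4) * heatKernel (2 * τ) (x - y) := by
      refine le_heatKernel_of_le hτ _ (by positivity) ?_
      rw [mul_assoc]
      refine mul_le_mul_of_nonneg_left ?_ (by positivity)
      nlinarith
    have t2 : (z ^ 2 * (((ρ' + ρ) / 4) ^ 2 + 1 / 4)) * heatKernel τ x
        ≤ 2064 * (z ^ 2 * 4) * heatKernel (2 * τ) x := by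
      refine le_heatKernel_of_le hτ _ (by positivity) ?_
      rw [mul_assoc]
      refine mul_le_mul_of_nonneg_left ?_ (by positivity)
      nlinarith
    calc _ = (z ^ 2 * ((ρ' + ρ) / 4) ^ 2) * heatKernel τ (x - y)
          + (z ^ 2 * (((ρ' + ρ) / 4) ^ 2 + 1 / 4)) * heatKernel τ x := by ring
      _ ≤ 2064 * (z ^ 2 * 4) * heatKernel (2 * τ) (x - y)
          + 2064 * (z ^ 2 * 4) * heatKernel (2 * τ) x := add_le_add t1 t2
      _ = _ := by ring

end VCHE
end


noncomputable section

namespace VCHE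

/-! ### Integrals of the heat kernel -/

lemma continuous_heatKernel (τ : ℝ) : Continuous (heatKernel τ) := by
  unfold heatKernel; fun_prop

lemma measurable_heatKernel_uncurry :
    Measurable (fun q : ℝ × Plane => heatKernel q.1 q.2) := by
  unfold heatKernel; fun_prop

lemma integral_heatKernel {τ : ℝ} (hτ : 0 < τ) : ∫ x, heatKernel τ x = 1 := by
  have h := GaussianFourier.integral_rexp_neg_mul_sq_norm (V := Plane)
    (b := (4 * τ)⁻¹) (by positivity)
  have e : ∀ x : Plane, heatKernel τ x
      = (4 * Real.pi * τ)⁻¹ * Real.exp (-(4 * τ)⁻¹ * ‖x‖ ^ 2) := by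
    intro x; unfold heatKernel; congr 2; field_simp
  simp_rw [e, integral_const_mul, h]
  simp
  field_simp

lemma integrable_heatKernel {τ : ℝ} (hτ : 0 < τ) : Integrable (heatKernel τ) :=
  integrable_of_integral_eq_one (integral_heatKernel hτ)

lemma lintegral_heatKernel {τ : ℝ} (hτ : 0 < τ) :
    ∫⁻ x, ENNReal.ofReal (heatKernel τ x) = 1 := by
  rw [← ofReal_integral_eq_lintegral_ofReal (integrable_heatKernel hτ)
    (.of_forall (heatKernel_nonneg hτ.le)), integral_heatKernel hτ, ENNReal.ofReal_one]

lemma heatKernel_neg (τ : ℝ) (x : Plane) : heatKernel τ (-x) = heatKernel τ x := by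
  simp [heatKernel]

lemma lintegral_heatKernel_sub {τ : ℝ} (hτ : 0 < τ) (y : Plane) :
    ∫⁻ x, ENNReal.ofReal (heatKernel τ (x - y)) = 1 := by
  rw [lintegral_sub_right_eq_self (fun x => ENNReal.ofReal (heatKernel τ x)) y,
    lintegral_heatKernel hτ]

lemma lintegral_heatKernel_sub' {τ : ℝ} (hτ : 0 < τ) (x : Plane) :
    ∫⁻ y, ENNReal.ofReal (heatKernel τ (x - y)) = 1 := by
  simp_rw [← heatKernel_neg τ (x - _), neg_sub]
  exact lintegral_heatKernel_sub hτ x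

lemma heatKernel_le_inv {τ : ℝ} (hτ : 0 < τ) (x : Plane) : heatKernel τ x ≤ τ⁻¹ := by
  unfold heatKernel
  have h1 : Real.exp (-‖x‖ ^ 2 / (4 * τ)) ≤ 1 := by
    apply Real.exp_le_one_iff.2
    rw [neg_div]; simp; positivity
  have h2 : (4 * Real.pi * τ)⁻¹ ≤ τ⁻¹ := by
    gcongr
    nlinarith [Real.pi_gt_three]
  calc _ ≤ τ⁻¹ * 1 := by gcongr
    _ = _ := mul_one _

/-- The heat kernels form a convolution semigroup. -/
lemma integral_heatKernel_mul {t s : ℝ} (ht : 0 < t) (hs : 0 < s) (x : Plane) :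
    ∫ y, heatKernel t (x - y) * heatKernel s y = heatKernel (t + s) x := by
  -- Completing the square: in y the product is a Gaussian with time parameter ts/(t+s) centred at
  -- s/(t+s) x.
  have key : ∀ y : Plane, heatKernel t (x - y) * heatKernel s y
      = heatKernel (t + s) x * heatKernel (t * s / (t + s)) (y - (s / (t + s)) • x) := by
    intro y
    unfold heatKernel
    have h1 : ‖y - (s / (t + s)) • x‖ ^ 2
        = ‖y‖ ^ 2 - 2 * (s / (t + s)) * inner ℝ x y + (s / (t + s)) ^ 2 * ‖x‖ ^ 2 := by
      rw [norm_sub_sq_real, inner_smul_right, norm_smul, mul_pow, Real.norm_eq_abs, sq_abs,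
        real_inner_comm]
      ring
    have h2 : ‖x - y‖ ^ 2 = ‖x‖ ^ 2 - 2 * inner ℝ x y + ‖y‖ ^ 2 := norm_sub_sq_real x y
    rw [mul_mul_mul_comm, mul_mul_mul_comm ((4 * Real.pi * (t + s))⁻¹), ← Real.exp_add,
      ← Real.exp_add, h1, h2]
    congr 1
    · field_simp
    · congr 1
      field_simp
      ring
  simp_rw [key, integral_const_mul]
  rw [integral_sub_right_eq_self (fun y => heatKernel (t * s / (t + s)) y),
    integral_heatKernel (by positivity), mul_one]

lemma integral_heatKernel_mul_shift {t s : ℝ} (ht : 0 < t) (hs : 0 < s) (x e : Plane) :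
    ∫ y, heatKernel t (x - y) * heatKernel s (y + e) = heatKernel (t + s) (x + e) := by
  rw [← integral_heatKernel_mul ht hs,
    ← integral_add_right_eq_self (fun y => heatKernel t (x + e - y) * heatKernel s y) e]
  simp

lemma rpow_norm_add_le {k : ℝ} (hk : 0 ≤ k) (hk1 : k ≤ 1) (x y : Plane) :
    ‖x‖ ^ k ≤ ‖x - y‖ ^ k + ‖y‖ ^ k := by
  have h1 : ‖x‖ ≤ ‖x - y‖ + ‖y‖ := by simpa using norm_add_le (x - y) y
  calc ‖x‖ ^ k ≤ (‖x - y‖ + ‖y‖) ^ k := by gcongr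
    _ ≤ _ := Real.rpow_add_le_add_rpow (norm_nonneg _) (norm_nonneg _) hk hk1

/-- Subadditivity of r ↦ r^k, which needs k ≤ 1, splits the weight into |x-y|^k, absorbed by the
Gaussian at the price τ^{k/2}, and the constant |y|^k. -/
lemma lintegral_rpow_mul_heatKernel_le {τ k : ℝ} (hτ : 0 < τ) (hk : 0 ≤ k) (hk1 : k ≤ 1)
    (y : Plane) :
    ∫⁻ x, ENNReal.ofReal (‖x‖ ^ k * heatKernel τ (x - y))
      ≤ ENNReal.ofReal (2064 * (τ ^ (k / 2) + ‖y‖ ^ k)) := by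
  calc _ ≤ ∫⁻ x, (ENNReal.ofReal (2064 * τ ^ (k / 2)) * ENNReal.ofReal (heatKernel (2 * τ) (x - y))
          + ENNReal.ofReal (‖y‖ ^ k) * ENNReal.ofReal (heatKernel τ (x - y))) := by
        refine lintegral_mono fun x => ?_
        have h0 := heatKernel_nonneg hτ.le (x - y)
        have h1 := heatKernel_nonneg (by positivity : 0 ≤ 2 * τ) (x - y)
        rw [← ENNReal.ofReal_mul (by positivity), ← ENNReal.ofReal_mul (by positivity),
          ← ENNReal.ofReal_add (by positivity) (by positivity)]
        apply ENNReal.ofReal_le_ofReal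
        have h2 := rpow_norm_mul_heatKernel_le hτ hk (hk1.trans (by norm_num)) (x - y)
        have h3 := mul_le_mul_of_nonneg_right (rpow_norm_add_le hk hk1 x y) h0
        linarith
    _ = ENNReal.ofReal (2064 * τ ^ (k / 2)) + ENNReal.ofReal (‖y‖ ^ k) := by
        rw [lintegral_add_left, lintegral_const_mul, lintegral_const_mul, lintegral_heatKernel_sub hτ,
          lintegral_heatKernel_sub (by positivity), mul_one, mul_one]
        all_goals
          have := (continuous_heatKernel τ).measurable
          have := (continuous_heatKernel (2 * τ)).measurable
          fun_prop
    _ ≤ _ := by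
        rw [← ENNReal.ofReal_add (by positivity) (by positivity)]
        apply ENNReal.ofReal_le_ofReal
        have : 0 ≤ ‖y‖ ^ k := by positivity
        linarith

/-- All but one power of the kernel is estimated by its supremum, the last one by its mass. -/
lemma lintegral_heatKernel_rpow_le {τ p : ℝ} (hτ : 0 < τ) (hp : 1 ≤ p) (y : Plane) :
    ∫⁻ x, ENNReal.ofReal (heatKernel τ (x - y)) ^ p ≤ ENNReal.ofReal (τ ^ (1 - p)) := by
  calc _ ≤ ∫⁻ x, ENNReal.ofReal (τ ^ (1 - p)) * ENNReal.ofReal (heatKernel τ (x - y)) := by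
        refine lintegral_mono fun x => ?_
        have h0 := heatKernel_nonneg hτ.le (x - y)
        rw [← ENNReal.ofReal_mul (by positivity), ENNReal.ofReal_rpow_of_nonneg h0 (by linarith)]
        apply ENNReal.ofReal_le_ofReal
        have h1 := heatKernel_le_inv hτ (x - y)
        calc heatKernel τ (x - y) ^ p = heatKernel τ (x - y) ^ (p - 1) * heatKernel τ (x - y) := by
              rcases h0.eq_or_lt with h | h
              · rw [← h, Real.zero_rpow (by linarith), mul_zero]
              · rw [← Real.rpow_add_one h.ne']; congr 1; ring
          _ ≤ (τ⁻¹) ^ (p - 1) * heatKernel τ (x - y) := by gcongr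
          _ = _ := by rw [Real.inv_rpow hτ.le, ← Real.rpow_neg hτ.le]; congr 2; ring
    _ = _ := by
      rw [lintegral_const_mul _ (by have := (continuous_heatKernel τ).measurable; fun_prop),
        lintegral_heatKernel_sub hτ, mul_one]

lemma integrable_coord_mul_heatKernel {τ : ℝ} (hτ : 0 < τ) (i : Fin 2) :
    Integrable (fun y : Plane => y i * heatKernel τ y) := by
  refine ((integrable_heatKernel (by positivity : 0 < 2 * τ)).const_mul
    (2064 * τ ^ (1 / 2 : ℝ))).mono' ?_ (.of_forall fun y => ?_)
  · have := continuous_heatKernel τ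
    exact Continuous.aestronglyMeasurable (by fun_prop)
  · have h := rpow_norm_mul_heatKernel_le hτ zero_le_one (by norm_num : (1:ℝ) ≤ 4) y
    rw [Real.rpow_one] at h
    rw [norm_mul, Real.norm_of_nonneg (heatKernel_nonneg hτ.le y)]
    refine le_trans ?_ h
    have h0 := heatKernel_nonneg hτ.le y
    gcongr
    exact PiLp.norm_apply_le y i

lemma integral_coord_mul_heatKernel {τ : ℝ} (i : Fin 2) :
    ∫ y : Plane, y i * heatKernel τ y = 0 := by
  have h := integral_neg_eq_self (fun y : Plane => y i * heatKernel τ y) volume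
  simp only [PiLp.neg_apply, heatKernel_neg, neg_mul, integral_neg] at h
  linarith

lemma integral_heatKernel_shift {τ : ℝ} (hτ : 0 < τ) (e : Plane) :
    ∫ y, heatKernel τ (y + e) = 1 := by
  rw [integral_add_right_eq_self (heatKernel τ) e, integral_heatKernel hτ]

lemma integrable_heatKernel_shift {τ : ℝ} (hτ : 0 < τ) (e : Plane) :
    Integrable (fun y => heatKernel τ (y + e)) :=
  (integrable_heatKernel hτ).comp_add_right e

lemma coord_mul_shift (τ : ℝ) (e : Plane) (i : Fin 2) :
    (fun y : Plane => y i * heatKernel τ (y + e))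
      = fun y => (y + e) i * heatKernel τ (y + e) - e i * heatKernel τ (y + e) := by
  ext y; simp; ring

lemma integrable_coord_mul_heatKernel_shift {τ : ℝ} (hτ : 0 < τ) (e : Plane) (i : Fin 2) :
    Integrable (fun y : Plane => y i * heatKernel τ (y + e)) := by
  rw [coord_mul_shift]
  exact ((integrable_coord_mul_heatKernel hτ i).comp_add_right e).sub
    ((integrable_heatKernel_shift hτ e).const_mul _)

lemma integral_coord_mul_heatKernel_shift {τ : ℝ} (hτ : 0 < τ) (e : Plane) (i : Fin 2) :
    ∫ y : Plane, y i * heatKernel τ (y + e) = -e i := by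
  rw [coord_mul_shift, integral_sub ((integrable_coord_mul_heatKernel hτ i).comp_add_right e)
    ((integrable_heatKernel_shift hτ e).const_mul _), integral_const_mul,
    integral_heatKernel_shift hτ,
    integral_add_right_eq_self (fun y : Plane => y i * heatKernel τ y) e,
    integral_coord_mul_heatKernel]
  ring

/-! ### Singular weights -/

/-- In polar coordinates this is the integral of y^{1-β} over (0, r), finite exactly because β < 2.
-/
lemma lintegral_ball_inv_norm_rpow {β : ℝ} (hβ : β < 2) :
    ∃ C : ℝ, 0 ≤ C ∧ ∀ r : ℝ, 0 < r →
      ∫⁻ x in Metric.ball (0 : Plane) r, (‖x‖ₑ⁻¹) ^ β ≤ ENNReal.ofReal (C * r ^ (2 - β)) := by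
  set B := (volume : Measure Plane).real (Metric.ball 0 1) with hB
  refine ⟨2 * B / (2 - β), by have : 0 < 2 - β := by linarith
                              positivity, fun r hr => ?_⟩
  have hint : IntegrableOn (fun x : Plane => ‖x‖ ^ (-β)) (Metric.ball 0 r) := by
    have := (integrableOn_fun_norm_addHaar (volume : Measure Plane) (f := fun y : ℝ => y ^ (-β))
      (r := r)).2 ?_
    · exact this
    · simp only [finrank_euclideanSpace, Fintype.card_fin]
      have := (intervalIntegral.integrableOn_Ioo_rpow_iff hr (s := 1 - β)).2 (by linarith)
      refine this.congr_fun (fun y hy => ?_) measurableSet_Ioo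
      simp only [smul_eq_mul]
      rw [show (1 - β) = 1 + -β by ring, Real.rpow_add hy.1]
      simp
  have hval : ∫ x in Metric.ball (0 : Plane) r, ‖x‖ ^ (-β) = 2 * B / (2 - β) * r ^ (2 - β) := by
    have h1 := integral_fun_norm_addHaar (volume : Measure Plane)
      (fun y : ℝ => (Iio r).indicator (fun y => y ^ (-β)) y)
    have h2 : ∫ x in Metric.ball (0 : Plane) r, ‖x‖ ^ (-β)
        = ∫ x : Plane, (Iio r).indicator (fun y => y ^ (-β)) ‖x‖ := by
      rw [← integral_indicator measurableSet_ball]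
      congr 1 with x
      simp [indicator]
    rw [h2, h1]
    have h3 : ∫ y in Ioi (0 : ℝ), y ^ (Module.finrank ℝ Plane - 1) •
        (Iio r).indicator (fun y => y ^ (-β)) y = r ^ (2 - β) / (2 - β) := by
      calc _ = ∫ y in Ioi (0 : ℝ), (Iio r).indicator (fun y => y ^ (1 - β)) y := by
            refine setIntegral_congr_fun measurableSet_Ioi fun y (hy : 0 < y) => ?_
            by_cases h : y < r
            · simp [h]
              rw [show (1 - β) = 1 + -β by ring, Real.rpow_add hy]
              simp
            · simp [h]
        _ = ∫ y in (0 : ℝ)..r, y ^ (1 - β) := by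
            rw [setIntegral_indicator measurableSet_Iio, Ioi_inter_Iio,
              intervalIntegral.integral_of_le hr.le, integral_Ioc_eq_integral_Ioo]
        _ = _ := by
            rw [integral_rpow (.inl (by linarith)), Real.zero_rpow (by linarith)]
            ring_nf
    rw [h3]
    simp
    ring
  rw [← hval, ofReal_integral_eq_lintegral_ofReal hint (.of_forall fun x => by positivity)]
  refine lintegral_mono_ae ?_
  have hne : ∀ᵐ x : Plane ∂(volume.restrict (Metric.ball 0 r)), x ≠ 0 :=
    ae_restrict_of_ae (by simp [ae_iff])
  filter_upwards [hne] with x hx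
  have hx' := norm_pos_iff.2 hx
  rw [Real.rpow_neg hx'.le, ← Real.inv_rpow hx'.le,
    ← ENNReal.ofReal_rpow_of_pos (by positivity), ENNReal.ofReal_inv_of_pos hx',
    ofReal_norm]

/-- Gaussian averages of a singular weight, uniformly in the position of the singularity. -/
lemma lintegral_inv_norm_rpow_mul_heatKernel_le {β : ℝ} (hβ0 : 0 ≤ β) (hβ : β < 2) :
    ∃ C : ℝ, 0 ≤ C ∧ ∀ τ : ℝ, 0 < τ → ∀ z : Plane,
      ∫⁻ x, (‖x - z‖ₑ⁻¹) ^ β * ENNReal.ofReal (heatKernel τ x)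
        ≤ ENNReal.ofReal (C * τ ^ (-(β / 2))) := by
  obtain ⟨C, hC, hball⟩ := lintegral_ball_inv_norm_rpow hβ
  refine ⟨1 + C, by positivity, fun τ hτ z => ?_⟩
  have hs := Real.sqrt_pos.2 hτ
  have hsp : ∀ a : ℝ, √τ ^ a = τ ^ (a / 2) := fun a => by
    rw [Real.sqrt_eq_rpow, ← Real.rpow_mul hτ.le]; ring_nf
  have hm := (continuous_heatKernel τ).measurable
  -- The space is split at distance √τ from the singularity. Outside, the weight is at most τ^{-β/2}
  -- and the Gaussian has mass one; inside, the Gaussian is at most τ^{-1} and the weight is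
  -- integrated over the ball.
  calc _ ≤ ∫⁻ x, (ENNReal.ofReal (τ ^ (-(β / 2))) * ENNReal.ofReal (heatKernel τ x)
          + ENNReal.ofReal τ⁻¹ * (Metric.ball (0 : Plane) √τ).indicator
            (fun x => (‖x‖ₑ⁻¹) ^ β) (x - z)) := by
        refine lintegral_mono fun x => ?_
        by_cases h : ‖x - z‖ < √τ
        · rw [indicator_of_mem (by simpa using h)]
          refine le_add_left ?_
          rw [mul_comm]
          gcongr
          exact heatKernel_le_inv hτ x
        · refine le_add_right ?_
          gcongr
          push Not at h
          have h' : 0 < ‖x - z‖ := hs.trans_le h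
          rw [← ofReal_norm, ← ENNReal.ofReal_inv_of_pos h',
            ENNReal.ofReal_rpow_of_pos (by positivity)]
          apply ENNReal.ofReal_le_ofReal
          rw [Real.inv_rpow h'.le, ← Real.rpow_neg h'.le, ← neg_div, ← hsp]
          exact Real.rpow_le_rpow_of_nonpos hs h (by linarith)
    _ = ENNReal.ofReal (τ ^ (-(β / 2))) + ENNReal.ofReal τ⁻¹ *
          ∫⁻ x in Metric.ball (0 : Plane) √τ, (‖x‖ₑ⁻¹) ^ β := by
        have hmi : Measurable fun x => (Metric.ball (0 : Plane) √τ).indicator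
            (fun x : Plane => (‖x‖ₑ⁻¹) ^ β) x :=
          Measurable.indicator (by fun_prop) measurableSet_ball
        rw [lintegral_add_left (by fun_prop), lintegral_const_mul _ (by fun_prop),
          lintegral_heatKernel hτ, mul_one, lintegral_const_mul _ (by fun_prop),
          lintegral_sub_right_eq_self (fun x => (Metric.ball (0 : Plane) √τ).indicator
            (fun x : Plane => (‖x‖ₑ⁻¹) ^ β) x) z, lintegral_indicator measurableSet_ball]
    _ ≤ ENNReal.ofReal (τ ^ (-(β / 2))) + ENNReal.ofReal τ⁻¹ *
          ENNReal.ofReal (C * √τ ^ (2 - β)) := by gcongr; exact hball _ hs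
    _ = _ := by
        rw [← ENNReal.ofReal_mul (by positivity), ← ENNReal.ofReal_add (by positivity) (by positivity),
          hsp, show τ⁻¹ * (C * τ ^ ((2 - β) / 2)) = C * τ ^ (-(β / 2)) by
            rw [mul_left_comm, ← Real.rpow_neg_one, ← Real.rpow_add hτ]; congr 2; ring]
        ring_nf

end VCHE
end


noncomputable section

namespace VCHE

/-! ### Partial derivatives and the Laplacian -/

lemma laplacian_eq_sum_partialDeriv {f : Plane → ℝ} (hf : ContDiff ℝ 2 f) (x : Plane) :
    Laplacian.laplacian f x = ∑ i, partialDeriv i (partialDeriv i f) x := by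
  rw [InnerProductSpace.laplacian_eq_iteratedFDeriv_orthonormalBasis f
    (EuclideanSpace.basisFun (Fin 2) ℝ)]
  refine Finset.sum_congr rfl fun i _ => ?_
  rw [iteratedFDeriv_two_apply]
  simp only [EuclideanSpace.basisFun_apply, Matrix.cons_val_zero, Matrix.cons_val_one, partialDeriv]
  have hd : DifferentiableAt ℝ (fderiv ℝ f) x :=
    ((hf.fderiv_right (m := 1) (by norm_num)).differentiable (by norm_num)) x
  have e : partialDeriv i f = fun y => fderiv ℝ f y (EuclideanSpace.single i 1) := rfl
  rw [e, fderiv_clm_apply hd (differentiableAt_const _)]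
  simp

lemma contDiff_heatKernel (τ : ℝ) {n : WithTop ℕ∞} : ContDiff ℝ n (heatKernel τ) := by
  unfold heatKernel
  have : ContDiff ℝ n (fun x : Plane => ‖x‖ ^ 2) := contDiff_norm_sq ℝ
  fun_prop

lemma differentiable_heatKernel (τ : ℝ) : Differentiable ℝ (heatKernel τ) :=
  (contDiff_heatKernel τ (n := 1)).differentiable (by norm_num)

lemma partialDeriv_heatKernel (τ : ℝ) (i : Fin 2) (x : Plane) :
    partialDeriv i (heatKernel τ) x = -(2 * τ)⁻¹ * x i * heatKernel τ x := by
  rw [partialDeriv, (hasGradientAt_heatKernel τ x).hasFDerivAt.fderiv]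
  simp [EuclideanSpace.inner_single_right]
  ring

lemma partialDeriv_mul_heatKernel (τ : ℝ) (i : Fin 2) {f : Plane → ℝ} (hf : Differentiable ℝ f)
    (x : Plane) :
    partialDeriv i (fun y => f y * heatKernel τ y) x
      = (partialDeriv i f x - (2 * τ)⁻¹ * x i * f x) * heatKernel τ x := by
  have h := partialDeriv_heatKernel τ i x
  simp only [partialDeriv] at h ⊢
  rw [fderiv_fun_mul (hf x) (differentiable_heatKernel τ x)]
  simp [h]
  ring

lemma hasFDerivAt_coord (i : Fin 2) (x : Plane) :
    HasFDerivAt (fun y : Plane => y i) (EuclideanSpace.proj i : Plane →L[ℝ] ℝ) x :=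
  (EuclideanSpace.proj i : Plane →L[ℝ] ℝ).hasFDerivAt

lemma laplacian_heatKernel (τ : ℝ) (x : Plane) :
    Laplacian.laplacian (heatKernel τ) x
      = (-(2 * τ)⁻¹ * 2 + ((2 * τ)⁻¹) ^ 2 * ‖x‖ ^ 2) * heatKernel τ x := by
  rw [laplacian_eq_sum_partialDeriv (contDiff_heatKernel τ)]
  have h : ∀ i, partialDeriv i (heatKernel τ) = fun y => (-(2 * τ)⁻¹ * y i) * heatKernel τ y :=
    fun i => funext (partialDeriv_heatKernel τ i)
  simp_rw [h]
  have h2 : ∀ i, partialDeriv i (fun y : Plane => -(2 * τ)⁻¹ * y i) x = -(2 * τ)⁻¹ := by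
    intro i
    simp only [partialDeriv]
    rw [((hasFDerivAt_coord i x).const_mul _).fderiv]
    simp
  simp_rw [fun i => partialDeriv_mul_heatKernel τ i (f := fun y => -(2 * τ)⁻¹ * y i)
    (by fun_prop) x, h2, EuclideanSpace.norm_sq_eq]
  simp
  ring

lemma laplacian_partialDeriv_heatKernel (τ : ℝ) (i : Fin 2) (x : Plane) :
    Laplacian.laplacian (partialDeriv i (heatKernel τ)) x
      = (4 * ((2 * τ)⁻¹) ^ 2 * x i - ((2 * τ)⁻¹) ^ 3 * ‖x‖ ^ 2 * x i) * heatKernel τ x := by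
  have h : partialDeriv i (heatKernel τ) = fun y => (-(2 * τ)⁻¹ * y i) * heatKernel τ y :=
    funext (partialDeriv_heatKernel τ i)
  rw [h, laplacian_eq_sum_partialDeriv
    (ContDiff.mul (by fun_prop) (contDiff_heatKernel τ))]
  set c := (2 * τ)⁻¹ with hc
  have h2 : ∀ j, partialDeriv j (fun y : Plane => -c * y i * heatKernel τ y)
      = fun y => (-c * (if i = j then 1 else 0) + c ^ 2 * (y j * y i)) * heatKernel τ y := by
    intro j
    funext y
    rw [partialDeriv_mul_heatKernel τ j (f := fun y => -c * y i) (by fun_prop) y]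
    simp only [partialDeriv]
    rw [((hasFDerivAt_coord i y).const_mul _).fderiv]
    simp [← hc]
    left; split_ifs <;> ring
  simp_rw [h2]
  have h3 : ∀ j, partialDeriv j
      (fun y : Plane => -c * (if i = j then 1 else 0) + c ^ 2 * (y j * y i)) x
      = c ^ 2 * (x i + x j * (if i = j then 1 else 0)) := by
    intro j
    simp only [partialDeriv]
    rw [((((hasFDerivAt_coord j x).fun_mul (hasFDerivAt_coord i x)).const_mul (c ^ 2)).const_add
      (-c * (if i = j then 1 else 0))).fderiv]
    simp
    split_ifs <;> ring
  simp_rw [fun j => partialDeriv_mul_heatKernel τ j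
    (f := fun y => -c * (if i = j then 1 else 0) + c ^ 2 * (y j * y i)) (by fun_prop) x, h3,
    EuclideanSpace.norm_sq_eq]
  fin_cases i <;> simp [← hc] <;> ring

/-! ### The heat equation against test functions -/

lemma hasCompactSupport_partialDeriv {f : Plane → ℝ} (hf : HasCompactSupport f) (i : Fin 2) :
    HasCompactSupport (partialDeriv i f) :=
  (hf.fderiv_apply ℝ _)

lemma contDiff_partialDeriv {f : Plane → ℝ} (hf : ContDiff ℝ (⊤ : ℕ∞) f) (i : Fin 2) :
    ContDiff ℝ (⊤ : ℕ∞) (partialDeriv i f) :=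
  (hf.fderiv_right (m := (⊤ : ℕ∞)) (by simp)).clm_apply contDiff_const

lemma laplacian_eq_sum_of_test {f : Plane → ℝ} (hf : ContDiff ℝ (⊤ : ℕ∞) f) :
    Laplacian.laplacian f = fun x => ∑ i, partialDeriv i (partialDeriv i f) x :=
  funext fun x => laplacian_eq_sum_partialDeriv (hf.of_le (show ((2 : ℕ∞) : WithTop ℕ∞) ≤ _ from WithTop.coe_le_coe.2 le_top)) x

lemma integral_mul_partialDeriv {f g : Plane → ℝ} (hf : ContDiff ℝ (⊤ : ℕ∞) f)
    (hg : ContDiff ℝ (⊤ : ℕ∞) g) (hgs : HasCompactSupport g) (i : Fin 2) :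
    ∫ x, f x * partialDeriv i g x = -∫ x, partialDeriv i f x * g x := by
  have cf := hf.continuous
  have cg := hg.continuous
  have cf' := (contDiff_partialDeriv hf i).continuous
  have cg' := (contDiff_partialDeriv hg i).continuous
  refine integral_mul_fderiv_eq_neg_fderiv_mul_of_integrable ?_ ?_ ?_
    (fun x _ => hf.differentiable (by simp) x) (fun x _ => hg.differentiable (by simp) x)
  · exact (cf'.mul cg).integrable_of_hasCompactSupport hgs.mul_left
  · exact (cf.mul cg').integrable_of_hasCompactSupport (hasCompactSupport_partialDeriv hgs i).mul_left
  · exact (cf.mul cg).integrable_of_hasCompactSupport hgs.mul_left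

lemma continuous_laplacian_of_test {f : Plane → ℝ} (hf : ContDiff ℝ (⊤ : ℕ∞) f) :
    Continuous (Laplacian.laplacian f) := by
  rw [laplacian_eq_sum_of_test hf]
  exact continuous_finsetSum _ fun i _ =>
    (contDiff_partialDeriv (contDiff_partialDeriv hf i) i).continuous

lemma hasCompactSupport_laplacian_of_test {f : Plane → ℝ} (hf : ContDiff ℝ (⊤ : ℕ∞) f)
    (hfs : HasCompactSupport f) : HasCompactSupport (Laplacian.laplacian f) := by
  rw [laplacian_eq_sum_of_test hf]
  simp only [Fin.sum_univ_two]
  exact (hasCompactSupport_partialDeriv (hasCompactSupport_partialDeriv hfs 0) 0).add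
    (hasCompactSupport_partialDeriv (hasCompactSupport_partialDeriv hfs 1) 1)

lemma integral_mul_laplacian {f g : Plane → ℝ} (hf : ContDiff ℝ (⊤ : ℕ∞) f)
    (hg : ContDiff ℝ (⊤ : ℕ∞) g) (hgs : HasCompactSupport g) :
    ∫ x, f x * Laplacian.laplacian g x = ∫ x, Laplacian.laplacian f x * g x := by
  rw [laplacian_eq_sum_of_test hf, laplacian_eq_sum_of_test hg]
  simp_rw [Finset.mul_sum, Finset.sum_mul]
  have cf := hf.continuous
  have cg := hg.continuous
  rw [integral_finsetSum, integral_finsetSum]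
  · refine Finset.sum_congr rfl fun i _ => ?_
    rw [integral_mul_partialDeriv hf (contDiff_partialDeriv hg i)
      (hasCompactSupport_partialDeriv hgs i),
      integral_mul_partialDeriv (contDiff_partialDeriv hf i) hg hgs, neg_neg]
  · intro i _
    exact ((contDiff_partialDeriv (contDiff_partialDeriv hf i) i).continuous.mul
      cg).integrable_of_hasCompactSupport hgs.mul_left
  · intro i _
    exact (cf.mul (contDiff_partialDeriv (contDiff_partialDeriv hg i) i).continuous
      ).integrable_of_hasCompactSupport
        (hasCompactSupport_partialDeriv (hasCompactSupport_partialDeriv hgs i) i).mul_left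

lemma hasDerivAt_heatKernel {τ : ℝ} (hτ : 0 < τ) (x : Plane) :
    HasDerivAt (fun s => heatKernel s x) (Laplacian.laplacian (heatKernel τ) x) τ := by
  rw [laplacian_heatKernel]
  unfold heatKernel
  have h1 : HasDerivAt (fun s : ℝ => (4 * Real.pi * s)⁻¹) _ τ :=
    (((hasDerivAt_id τ).const_mul (4 * Real.pi)).inv (by simp; positivity))
  have h2 : HasDerivAt (fun s : ℝ => Real.exp (-‖x‖ ^ 2 / (4 * s))) _ τ :=
    ((((hasDerivAt_const τ (-‖x‖ ^ 2)).div ((hasDerivAt_id τ).const_mul 4)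
      (by simp; positivity))).exp)
  refine (h1.mul h2).congr_deriv ?_
  simp
  field_simp
  ring

/-- The heat equation under the integral sign, with the Laplacian then moved onto the test function.
On (τ/2, 2τ) the kernel and its Laplacian are bounded uniformly on the compact support. -/
lemma hasDerivAt_integral_heatKernel_mul {h : Plane → ℝ} (hh : ContDiff ℝ (⊤ : ℕ∞) h)
    (hhs : HasCompactSupport h) {τ : ℝ} (hτ : 0 < τ) :
    HasDerivAt (fun s => ∫ y, heatKernel s y * h y)
      (∫ y, heatKernel τ y * Laplacian.laplacian h y) τ := by
  rw [integral_mul_laplacian (contDiff_heatKernel τ) hh hhs]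
  have ch := hh.continuous
  have key := hasDerivAt_integral_of_dominated_loc_of_deriv_le (μ := (volume : Measure Plane))
    (F := fun s y => heatKernel s y * h y) (x₀ := τ) (s := Ioo (τ / 2) (2 * τ))
    (F' := fun s y => Laplacian.laplacian (heatKernel s) y * h y)
    (bound := fun y => ((τ / 2)⁻¹ * 2 + ((τ / 2)⁻¹) ^ 2 * ‖y‖ ^ 2) * (τ / 2)⁻¹ * ‖h y‖)
    (Ioo_mem_nhds (by linarith) (by linarith)) ?_ ?_ ?_ ?_ ?_ ?_
  · exact key.2
  · exact .of_forall fun s => ((continuous_heatKernel s).mul ch).aestronglyMeasurable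
  · exact ((continuous_heatKernel τ).mul ch).integrable_of_hasCompactSupport hhs.mul_left
  · exact ((continuous_laplacian_of_test (contDiff_heatKernel τ)).mul ch).aestronglyMeasurable
  · refine .of_forall fun y s hs => ?_
    have hs0 : 0 < s := lt_trans (by positivity) hs.1
    have h1 : (2 * s)⁻¹ ≤ (τ / 2)⁻¹ := by
      gcongr
      linarith [hs.1]
    have h2 : heatKernel s y ≤ (τ / 2)⁻¹ := (heatKernel_le_inv hs0 y).trans (by gcongr; exact hs.1.le)
    have h0 := heatKernel_nonneg hs0.le y
    rw [norm_mul, laplacian_heatKernel, norm_mul, Real.norm_of_nonneg h0]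
    gcongr
    refine (norm_add_le _ _).trans ?_
    rw [norm_mul, norm_mul, norm_neg, norm_pow, norm_pow, norm_norm,
      Real.norm_of_nonneg (by positivity : 0 ≤ (2 * s)⁻¹)]
    simp only [Real.norm_ofNat]
    gcongr
  · exact Continuous.integrable_of_hasCompactSupport (by fun_prop) hhs.norm.mul_left
  · refine .of_forall fun y s hs => ?_
    have hs0 : 0 < s := lt_trans (by positivity) hs.1
    exact (hasDerivAt_heatKernel hs0 y).mul_const _

/-- Rescaling of Gaussian averages to unit variance. -/
lemma integral_heatKernel_mul_eq {τ : ℝ} (hτ : 0 < τ) (h : Plane → ℝ) :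
    ∫ y, heatKernel τ y * h y = ∫ y, heatKernel 1 y * h (√τ • y) := by
  have hs := Real.sqrt_pos.2 hτ
  have h1 := Measure.integral_comp_smul (volume : Measure Plane)
    (fun y => τ * heatKernel τ y * h y) √τ
  have h2 : ∀ y : Plane, τ * heatKernel τ (√τ • y) * h (√τ • y) = heatKernel 1 y * h (√τ • y) := by
    intro y
    unfold heatKernel
    rw [norm_smul, mul_pow, Real.norm_of_nonneg hs.le, Real.sq_sqrt hτ.le]
    field_simp
  simp_rw [h2] at h1
  rw [h1]
  simp only [finrank_euclideanSpace, Fintype.card_fin, Real.sq_sqrt hτ.le, mul_assoc,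
    integral_const_mul, smul_eq_mul]
  rw [abs_of_nonneg (by positivity)]
  field_simp

end VCHE
end


noncomputable section

namespace VCHE

/-! ### The Bessel measure, the fundamental solution of `1 - α² Δ` -/

/-- The density of the law of a heat kernel at an exponentially distributed time. -/
def besselDensity (α : ℝ) (q : ℝ × Plane) : ℝ :=
  Real.exp (-q.1) * heatKernel (α ^ 2 * q.1) q.2

/-- The measure `∫₀^∞ e^{-σ} Φ(α² σ) dσ`, whose convolution inverts `1 - α² Δ`. -/
def besselMeasure (α : ℝ) : Measure Plane :=
  Measure.map Prod.snd (((volume.restrict (Ioi (0 : ℝ))).prod volume).withDensity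
    (fun q : ℝ × Plane => ENNReal.ofReal (besselDensity α q)))

lemma measurable_besselDensity (α : ℝ) : Measurable (besselDensity α) := by
  unfold besselDensity heatKernel; fun_prop

/-- The disintegration by which every estimate for the Bessel measure becomes a Gaussian estimate
averaged over an exponential time. -/
lemma lintegral_besselMeasure (α : ℝ) {f : Plane → ℝ≥0∞} (hf : Measurable f) :
    ∫⁻ y, f y ∂(besselMeasure α) = ∫⁻ σ in Ioi (0 : ℝ), ENNReal.ofReal (Real.exp (-σ)) *
      ∫⁻ y, f y * ENNReal.ofReal (heatKernel (α ^ 2 * σ) y) := by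
  have hd := measurable_besselDensity α
  rw [besselMeasure, lintegral_map hf measurable_snd,
    lintegral_withDensity_eq_lintegral_mul _ (by fun_prop) (by fun_prop),
    lintegral_prod _ (by fun_prop)]
  refine setLIntegral_congr_fun measurableSet_Ioi fun σ (hσ : 0 < σ) => ?_
  have hm := (continuous_heatKernel (α ^ 2 * σ)).measurable
  simp only [Pi.mul_apply, besselDensity]
  rw [← lintegral_const_mul _ (by fun_prop)]
  refine lintegral_congr fun y => ?_
  rw [ENNReal.ofReal_mul (Real.exp_pos _).le]
  ring

lemma lintegral_exp_neg : ∫⁻ σ in Ioi (0 : ℝ), ENNReal.ofReal (Real.exp (-σ)) = 1 := by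
  rw [← ofReal_integral_eq_lintegral_ofReal (integrableOn_exp_neg_Ioi 0)
    (.of_forall fun x => (Real.exp_pos _).le), integral_exp_neg_Ioi_zero, ENNReal.ofReal_one]

lemma isProbabilityMeasure_besselMeasure {α : ℝ} (hα : 0 < α) :
    IsProbabilityMeasure (besselMeasure α) := by
  constructor
  rw [← lintegral_one, lintegral_besselMeasure α measurable_const]
  refine Eq.trans ?_ lintegral_exp_neg
  refine setLIntegral_congr_fun measurableSet_Ioi fun σ (hσ : 0 < σ) => ?_
  simp only [one_mul, lintegral_heatKernel (by positivity : 0 < α ^ 2 * σ), mul_one]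

/-- At time parameter α²σ the Gaussian average of 1/|x - ·| is of order 1/(α√σ), uniformly in x, and
e^{-σ}σ^{-1/2} is integrable. This is how the filter removes the singularity of the Biot-Savart
kernel. -/
lemma lintegral_inv_norm_besselMeasure_le {α : ℝ} (hα : 0 < α) :
    ∃ C : ℝ, 0 ≤ C ∧ ∀ x : Plane, ∫⁻ y, ‖x - y‖ₑ⁻¹ ∂(besselMeasure α) ≤ ENNReal.ofReal C := by
  obtain ⟨C, hC, h⟩ := lintegral_inv_norm_rpow_mul_heatKernel_le zero_le_one one_lt_two
  have hint : IntegrableOn (fun σ : ℝ => Real.exp (-σ) * σ ^ ((1 / 2 : ℝ) - 1)) (Ioi 0) :=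
    Real.GammaIntegral_convergent (by norm_num)
  refine ⟨C * α⁻¹ * ∫ σ in Ioi (0 : ℝ), Real.exp (-σ) * σ ^ ((1 / 2 : ℝ) - 1), ?_, fun x => ?_⟩
  · refine mul_nonneg (by positivity) (setIntegral_nonneg measurableSet_Ioi fun σ hσ => ?_)
    have : (0 : ℝ) < σ := hσ
    positivity
  rw [lintegral_besselMeasure α (by fun_prop)]
  calc _ ≤ ∫⁻ σ in Ioi (0 : ℝ), ENNReal.ofReal (C * α⁻¹ * (Real.exp (-σ) * σ ^ ((1 / 2 : ℝ) - 1))) := by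
        refine setLIntegral_mono' measurableSet_Ioi fun σ (hσ : 0 < σ) => ?_
        have h1 := h (α ^ 2 * σ) (by positivity) x
        simp only [ENNReal.rpow_one] at h1
        simp_rw [enorm_sub_rev _ x] at h1
        calc _ ≤ ENNReal.ofReal (Real.exp (-σ)) *
              ENNReal.ofReal (C * (α ^ 2 * σ) ^ (-(1 / 2 : ℝ))) := by gcongr
          _ = _ := by
            rw [← ENNReal.ofReal_mul (Real.exp_pos _).le]
            congr 1
            rw [Real.mul_rpow (by positivity) hσ.le, ← Real.rpow_natCast α 2, ← Real.rpow_mul hα.le,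
              show ((2 : ℕ) : ℝ) * -(1 / 2) = -1 by norm_num, Real.rpow_neg_one,
              show ((1 / 2 : ℝ) - 1) = -(1 / 2) by norm_num]
            ring
    _ = _ := by
        rw [← ofReal_integral_eq_lintegral_ofReal (hint.const_mul _), integral_const_mul]
        refine (ae_restrict_mem measurableSet_Ioi).mono fun σ hσ => ?_
        have : (0 : ℝ) < σ := hσ
        simp only [Pi.zero_apply]
        positivity

lemma measurePreserving_besselMeasure (α : ℝ) (S : Plane ≃ₗᵢ[ℝ] Plane) :
    MeasurePreserving S (besselMeasure α) (besselMeasure α) := by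
  refine ⟨S.continuous.measurable, ?_⟩
  refine Measure.ext_of_lintegral _ fun f hf => ?_
  have hS := S.continuous.measurable
  rw [lintegral_map hf hS, lintegral_besselMeasure α (f := fun y => f (S y)) (hf.comp hS),
    lintegral_besselMeasure α hf]
  congr 1 with σ
  congr 1
  have hm := (continuous_heatKernel (α ^ 2 * σ)).measurable
  have h := S.measurePreserving.lintegral_comp (f := fun y => f y * ENNReal.ofReal
    (heatKernel (α ^ 2 * σ) y)) (by fun_prop)
  rw [← h]
  refine lintegral_congr fun y => ?_
  simp [heatKernel]

lemma integral_besselMeasure {α : ℝ} (hα : 0 < α) {g : Plane → ℝ}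
    (hg : Integrable g (besselMeasure α)) :
    IntegrableOn (fun σ => Real.exp (-σ) * ∫ y, heatKernel (α ^ 2 * σ) y * g y) (Ioi 0) ∧
    ∫ y, g y ∂(besselMeasure α)
      = ∫ σ in Ioi (0 : ℝ), Real.exp (-σ) * ∫ y, heatKernel (α ^ 2 * σ) y * g y := by
  have hd := measurable_besselDensity α
  have hgm : AEStronglyMeasurable g (besselMeasure α) := hg.aestronglyMeasurable
  have hI : Integrable (fun q : ℝ × Plane => (besselDensity α q) * g q.2)
      ((volume.restrict (Ioi (0 : ℝ))).prod volume) ∧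
      ∫ y, g y ∂(besselMeasure α) = ∫ q : ℝ × Plane, besselDensity α q * g q.2
        ∂((volume.restrict (Ioi (0 : ℝ))).prod volume) := by
    have hnn : ∀ᵐ q : ℝ × Plane ∂((volume.restrict (Ioi (0 : ℝ))).prod volume),
        0 ≤ besselDensity α q := by
      have : ∀ᵐ q : ℝ × Plane ∂((volume.restrict (Ioi (0 : ℝ))).prod volume), q.1 ∈ Ioi (0:ℝ) :=
        Measure.quasiMeasurePreserving_fst.ae (ae_restrict_mem measurableSet_Ioi)
      filter_upwards [this] with q (hq : 0 < q.1)
      exact mul_nonneg (Real.exp_pos _).le (heatKernel_nonneg (by positivity) _)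
    have h1 := (integrable_map_measure hgm measurable_snd.aemeasurable).1 hg
    rw [integrable_withDensity_iff_integrable_smul' (by fun_prop)
      (.of_forall fun _ => ENNReal.ofReal_lt_top)] at h1
    constructor
    · refine h1.congr ?_
      filter_upwards [hnn] with q hq
      simp [ENNReal.toReal_ofReal hq]
    · rw [besselMeasure, integral_map measurable_snd.aemeasurable hgm,
        integral_withDensity_eq_integral_toReal_smul (by fun_prop)
          (.of_forall fun _ => ENNReal.ofReal_lt_top)]
      refine integral_congr_ae ?_
      filter_upwards [hnn] with q hq
      simp [ENNReal.toReal_ofReal hq]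
  have e : ∀ σ, ∫ y, besselDensity α (σ, y) * g y
      = Real.exp (-σ) * ∫ y, heatKernel (α ^ 2 * σ) y * g y := by
    intro σ
    rw [← integral_const_mul]
    simp only [besselDensity, mul_assoc]
  constructor
  · have := hI.1.integral_prod_left
    simp only [e] at this
    exact this
  · rw [hI.2, integral_prod _ hI.1]
    simp only [e]

lemma laplacian_comp_add_right {f : Plane → ℝ} (hf : ContDiff ℝ (⊤ : ℕ∞) f) (x y : Plane) :
    Laplacian.laplacian (fun z => f (z + x)) y = Laplacian.laplacian f (y + x) := by
  have hp : ∀ (g : Plane → ℝ) i, partialDeriv i (fun z => g (z + x))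
      = fun z => partialDeriv i g (z + x) := by
    intro g i; funext z; simp only [partialDeriv]; rw [fderiv_comp_add_right]
  rw [laplacian_eq_sum_of_test hf, laplacian_eq_sum_of_test (f := fun z => f (z + x))
    (hf.comp (contDiff_id.add contDiff_const))]
  refine Finset.sum_congr rfl fun i _ => ?_
  simp only [hp]

/-- If P(σ) is the average of h against Φ(α²σ), the heat equation gives P' as α² times the average
of Δh. The integrand e^{-σ}(P - P') is therefore the derivative of -e^{-σ}P, and its integral over
(0, ∞) is P(0) = h(0). -/
lemma integral_besselMeasure_unfilter_zero {α : ℝ} (hα : 0 < α) {h : Plane → ℝ}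
    (hh : ContDiff ℝ (⊤ : ℕ∞) h) (hhs : HasCompactSupport h) :
    ∫ y, (h y - α ^ 2 * Laplacian.laplacian h y) ∂(besselMeasure α) = h 0 := by
  have ch := hh.continuous
  have cl := continuous_laplacian_of_test hh
  have := isProbabilityMeasure_besselMeasure hα
  set g : Plane → ℝ := fun y => h y - α ^ 2 * Laplacian.laplacian h y with hg
  have cg : Continuous g := by fun_prop
  have hgs : HasCompactSupport g :=
    hhs.sub ((hasCompactSupport_laplacian_of_test hh hhs).mul_left)
  obtain ⟨M, hM⟩ := hgs.exists_bound_of_continuous cg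
  obtain ⟨N, hN⟩ := hhs.exists_bound_of_continuous ch
  have gint : Integrable g (besselMeasure α) :=
    Integrable.of_bound cg.aestronglyMeasurable M (.of_forall hM)
  obtain ⟨hI, hE⟩ := integral_besselMeasure hα gint
  rw [hE]
  -- Written at unit variance, P is continuous up to σ = 0 with P(0) = h(0). The unscaled integral
  -- would take the value 0 there, since `heatKernel 0` is the zero function.
  set P : ℝ → ℝ := fun σ => ∫ y, heatKernel 1 y * h (√(α ^ 2 * σ) • y) with hP
  have hPc : Continuous P := by
    refine continuous_of_dominated (bound := fun y => heatKernel 1 y * N) ?_ ?_ ?_ ?_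
    · intro σ
      have := continuous_heatKernel 1
      exact Continuous.aestronglyMeasurable (by fun_prop)
    · intro σ
      refine .of_forall fun y => ?_
      rw [norm_mul, Real.norm_of_nonneg (heatKernel_nonneg zero_le_one _)]
      exact mul_le_mul_of_nonneg_left (hN _) (heatKernel_nonneg zero_le_one _)
    · exact (integrable_heatKernel one_pos).mul_const _
    · exact .of_forall fun y => by fun_prop
  have hPb : ∀ σ, |P σ| ≤ N := by
    intro σ
    calc |P σ| ≤ ∫ y : Plane, heatKernel 1 y * N := by
          rw [← Real.norm_eq_abs]
          refine norm_integral_le_of_norm_le ((integrable_heatKernel one_pos).mul_const _)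
            (.of_forall fun y => ?_)
          rw [norm_mul, Real.norm_of_nonneg (heatKernel_nonneg zero_le_one _)]
          exact mul_le_mul_of_nonneg_left (hN _) (heatKernel_nonneg zero_le_one _)
      _ = N := by rw [integral_mul_const, integral_heatKernel one_pos, one_mul]
  have hder : ∀ σ ∈ Ioi (0 : ℝ), HasDerivAt (fun σ => -(Real.exp (-σ) * P σ))
      (Real.exp (-σ) * ∫ y, heatKernel (α ^ 2 * σ) y * g y) σ := by
    intro σ (hσ : 0 < σ)
    have hτ : 0 < α ^ 2 * σ := by positivity
    have h1 : HasDerivAt P ((∫ y, heatKernel (α ^ 2 * σ) y * Laplacian.laplacian h y) * α ^ 2) σ := by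
      have h2 := (hasDerivAt_integral_heatKernel_mul hh hhs hτ).comp σ
        ((hasDerivAt_id σ).const_mul (α ^ 2))
      rw [mul_one] at h2
      refine h2.congr_of_eventuallyEq ?_
      filter_upwards [Ioi_mem_nhds hσ] with s (hs : 0 < s)
      simp only [hP, Function.comp_apply]
      rw [integral_heatKernel_mul_eq (by positivity : 0 < α ^ 2 * s)]
    have h3 : HasDerivAt (fun σ : ℝ => Real.exp (-σ)) (-Real.exp (-σ)) σ := by
      simpa using (hasDerivAt_neg σ).exp
    refine (h3.fun_mul h1).fun_neg.congr_deriv ?_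
    have e1 : ∫ y, heatKernel (α ^ 2 * σ) y * g y = P σ
        - (∫ y, heatKernel (α ^ 2 * σ) y * Laplacian.laplacian h y) * α ^ 2 := by
      have e2 : P σ = ∫ y, heatKernel (α ^ 2 * σ) y * h y := (integral_heatKernel_mul_eq hτ h).symm
      have ck := continuous_heatKernel (α ^ 2 * σ)
      rw [e2, ← integral_mul_const, ← integral_sub]
      · congr 1 with y
        simp only [hg]; ring
      · exact (ck.mul ch).integrable_of_hasCompactSupport hhs.mul_left
      · exact ((ck.mul cl).integrable_of_hasCompactSupport
          (hasCompactSupport_laplacian_of_test hh hhs).mul_left).mul_const _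
    rw [e1]; ring
  have hlim : Filter.Tendsto (fun σ => -(Real.exp (-σ) * P σ)) Filter.atTop (nhds 0) := by
    have h1 : Filter.Tendsto (fun σ : ℝ => Real.exp (-σ) * N) Filter.atTop (nhds 0) := by
      simpa using (Real.tendsto_exp_neg_atTop_nhds_zero.mul_const N)
    refine squeeze_zero_norm (fun σ => ?_) h1
    rw [norm_neg, norm_mul, Real.norm_of_nonneg (Real.exp_pos _).le]
    exact mul_le_mul_of_nonneg_left (hPb σ) (Real.exp_pos _).le
  rw [integral_Ioi_of_hasDerivAt_of_tendsto
    (Continuous.continuousWithinAt (by fun_prop)) hder hI hlim]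
  simp [hP, integral_mul_const, integral_heatKernel]

/-- Convolution with the Bessel measure inverts `1 - α² Δ`. -/
lemma integral_besselMeasure_unfilter {α : ℝ} (hα : 0 < α) {ψ : Plane → ℝ}
    (hψ : ContDiff ℝ (⊤ : ℕ∞) ψ) (hψs : HasCompactSupport ψ) (x : Plane) :
    ∫ y, (ψ (y + x) - α ^ 2 * Laplacian.laplacian ψ (y + x)) ∂(besselMeasure α) = ψ x := by
  have h := integral_besselMeasure_unfilter_zero hα (h := fun y => ψ (y + x))
    (hψ.comp (contDiff_id.add contDiff_const)) (hψs.comp_homeomorph (Homeomorph.addRight x))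
  simp only [laplacian_comp_add_right hψ, zero_add] at h
  exact h

end VCHE
end


noncomputable section

namespace VCHE

/-! ### The Helmholtz filter -/

lemma integrable_shear {E : Type*} [NormedAddCommGroup E] {γ : Measure Plane} [SFinite γ]
    {h : Plane × Plane → E}
    (hh : Integrable h ((volume : Measure Plane).prod γ)) :
    Integrable (fun q : Plane × Plane => h (q.1 - q.2, q.2)) ((volume : Measure Plane).prod γ) :=
  (measurePreserving_sub_prod volume γ).integrable_comp_of_integrable hh

/-- Fubini's theorem together with the translation z = x - y for fixed y. It transfers convolution
with a measure from one factor of an integral to the other. -/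
lemma integral_integral_shear {E : Type*} [NormedAddCommGroup E] [NormedSpace ℝ E]
    {γ : Measure Plane} [SFinite γ] {h : Plane × Plane → E}
    (hh : Integrable h ((volume : Measure Plane).prod γ)) :
    ∫ x, ∫ y, h (x - y, y) ∂γ = ∫ z, ∫ y, h (z, y) ∂γ := by
  have hm := measurePreserving_sub_prod (volume : Measure Plane) γ
  rw [← integral_prod _ hh, ← integral_prod (fun q : Plane × Plane => h (q.1 - q.2, q.2))
    (integrable_shear hh)]
  conv_rhs => rw [← hm.map_eq]
  rw [integral_map hm.measurable.aemeasurable (by rw [hm.map_eq]; exact hh.aestronglyMeasurable)]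

/-- Convolution with the Bessel measure. -/
def besselFilter (α : ℝ) (v : Plane → ℝ) (x : Plane) : ℝ := ∫ y, v (x - y) ∂(besselMeasure α)

lemma exists_bound_unfilter {α : ℝ} {φ : Plane → ℝ} (hφ : ContDiff ℝ (⊤ : ℕ∞) φ)
    (hφs : HasCompactSupport φ) :
    Continuous (fun x => φ x - α ^ 2 * Laplacian.laplacian φ x) ∧
      ∃ M, ∀ x, ‖φ x - α ^ 2 * Laplacian.laplacian φ x‖ ≤ M := by
  have cl := continuous_laplacian_of_test hφ
  have cφ := hφ.continuous
  have c : Continuous (fun x => φ x - α ^ 2 * Laplacian.laplacian φ x) := by fun_prop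
  exact ⟨c, HasCompactSupport.exists_bound_of_continuous
    (hφs.sub ((hasCompactSupport_laplacian_of_test hφ hφs).mul_left)) c⟩

lemma integrable_mul_comp_add {γ : Measure Plane} [IsProbabilityMeasure γ] {v g : Plane → ℝ}
    (hv : Integrable v) (hg : Continuous g) {M : ℝ} (hM : ∀ x, ‖g x‖ ≤ M) :
    Integrable (fun q : Plane × Plane => v q.1 * g (q.2 + q.1)) ((volume : Measure Plane).prod γ) :=
  (hv.comp_fst γ).mul_bdd (c := M) (g := fun q : Plane × Plane => g (q.2 + q.1))
    (Continuous.aestronglyMeasurable (by fun_prop)) (.of_forall fun q => hM _)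

/-- The convolution is transferred to (1 - α²Δ)φ, which it turns back into φ. -/
lemma isHelmholtzFilter_besselFilter {α : ℝ} (hα : 0 < α) {v : Plane → ℝ} (hv : Integrable v) :
    IsHelmholtzFilter α v (besselFilter α v) := by
  have := isProbabilityMeasure_besselMeasure hα
  refine ⟨(integrable_shear (hv.comp_fst (besselMeasure α))).integral_prod_left, ?_⟩
  intro φ hφ hφs
  obtain ⟨cg, M, hM⟩ := exists_bound_unfilter (α := α) hφ hφs
  have key := integral_integral_shear (integrable_mul_comp_add (γ := besselMeasure α) hv cg hM)
  simp only [add_sub_cancel] at key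
  simp_rw [integral_mul_const, integral_const_mul, integral_besselMeasure_unfilter hα hφ hφs] at key
  exact key

/-- The difference of two filters annihilates (1 - α²Δ)φ for every test function φ. Each test
function ψ is a Bessel average of translates of (1 - α²Δ)ψ, so the difference annihilates ψ as well.
-/
lemma IsHelmholtzFilter.ae_eq {α : ℝ} (hα : 0 < α) {f u w : Plane → ℝ}
    (hu : IsHelmholtzFilter α f u) (hw : IsHelmholtzFilter α f w) : u =ᵐ[volume] w := by
  have := isProbabilityMeasure_besselMeasure hα
  have hd : Integrable (fun x => u x - w x) := hu.1.sub hw.1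
  have hz : ∀ φ : Plane → ℝ, ContDiff ℝ (⊤ : ℕ∞) φ → HasCompactSupport φ →
      ∫ x, (u x - w x) * (φ x - α ^ 2 * Laplacian.laplacian φ x) = 0 := by
    intro φ hφ hφs
    obtain ⟨cg, M, hM⟩ := exists_bound_unfilter (α := α) hφ hφs
    simp_rw [sub_mul (u _)]
    rw [integral_sub (hu.1.mul_bdd (c := M) cg.aestronglyMeasurable (.of_forall hM))
      (hw.1.mul_bdd (c := M) cg.aestronglyMeasurable (.of_forall hM)), hu.2 φ hφ hφs, hw.2 φ hφ hφs, sub_self]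
  have h0 : ∀ᵐ x, (fun x => u x - w x) x = 0 := by
    refine ae_eq_zero_of_integral_contDiff_smul_eq_zero hd.locallyIntegrable fun ψ hψ hψs => ?_
    obtain ⟨cg, M, hM⟩ := exists_bound_unfilter (α := α) hψ hψs
    have hi := integrable_mul_comp_add (γ := besselMeasure α) hd cg hM
    have e1 := integral_integral_swap (f := fun x y => (u x - w x) *
      (ψ (y + x) - α ^ 2 * Laplacian.laplacian ψ (y + x))) hi
    have e2 : ∀ y, ∫ x, (u x - w x) * (ψ (y + x) - α ^ 2 * Laplacian.laplacian ψ (y + x)) = 0 := by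
      intro y
      have := hz (fun x => ψ (x + y)) (hψ.comp (contDiff_id.add contDiff_const))
        (hψs.comp_homeomorph (Homeomorph.addRight y))
      simp only [laplacian_comp_add_right hψ] at this
      simpa only [add_comm y] using this
    simp_rw [e2, integral_zero, integral_const_mul,
      integral_besselMeasure_unfilter hα hψ hψs] at e1
    simpa only [smul_eq_mul, mul_comm] using e1
  filter_upwards [h0] with x hx
  exact sub_eq_zero.1 hx

/-! ### The filtered Biot-Savart kernel -/

lemma norm_perp (x : Plane) : ‖perp x‖ = ‖x‖ := by
  rw [EuclideanSpace.norm_eq, EuclideanSpace.norm_eq]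
  simp [perp, Fin.sum_univ_two, add_comm]

lemma perp_neg (x : Plane) : perp (-x) = -perp x := by
  ext i; fin_cases i <;> simp [perp]

lemma continuous_perp : Continuous perp := by
  unfold perp
  refine (PiLp.continuous_toLp 2 _).comp (continuous_pi fun i => ?_)
  fin_cases i <;> simp <;> fun_prop

/-- The Biot-Savart kernel up to the factor `(2π)⁻¹`. -/
def bsKernel (x : Plane) : Plane := (‖x‖ ^ 2)⁻¹ • perp x

lemma measurable_bsKernel : Measurable bsKernel := by
  have := continuous_perp.measurable
  unfold bsKernel; fun_prop

lemma enorm_bsKernel_le (x : Plane) : ‖bsKernel x‖ₑ ≤ ‖x‖ₑ⁻¹ := by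
  rcases eq_or_ne x 0 with rfl | hx
  · simp
  have hx' := norm_pos_iff.2 hx
  rw [← ofReal_norm, ← ofReal_norm, ← ENNReal.ofReal_inv_of_pos hx']
  apply ENNReal.ofReal_le_ofReal
  rw [bsKernel, norm_smul, norm_perp, norm_inv, norm_pow, norm_norm]
  apply le_of_eq
  field_simp

/-- The kernel of the velocity in terms of the unfiltered vorticity. -/
def velKernel (α : ℝ) (x : Plane) : Plane :=
  (2 * Real.pi)⁻¹ • ∫ y, bsKernel (x - y) ∂(besselMeasure α)

/-- A radially symmetric majorant of `velKernel`. -/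
def velMajorant (α : ℝ) (x : Plane) : ℝ≥0∞ := ∫⁻ y, ‖x - y‖ₑ⁻¹ ∂(besselMeasure α)

/-- The velocity generated by the vorticity `v`. -/
def velocity (α : ℝ) (v : Plane → ℝ) (x : Plane) : Plane := ∫ z, v z • velKernel α (x - z)

lemma enorm_velKernel_le (α : ℝ) (x : Plane) : ‖velKernel α x‖ₑ ≤ velMajorant α x := by
  rw [velKernel, enorm_smul]
  calc _ ≤ 1 * ‖∫ y, bsKernel (x - y) ∂(besselMeasure α)‖ₑ := by
        gcongr
        rw [← ofReal_norm, Real.norm_of_nonneg (by positivity)]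
        apply ENNReal.ofReal_le_one.2
        apply inv_le_one_of_one_le₀
        linarith [Real.pi_gt_three]
    _ ≤ ∫⁻ y, ‖bsKernel (x - y)‖ₑ ∂(besselMeasure α) := by
        rw [one_mul]; exact enorm_integral_le_lintegral_enorm _
    _ ≤ _ := lintegral_mono fun y => enorm_bsKernel_le _

lemma measurable_velMajorant {α : ℝ} (hα : 0 < α) : Measurable (velMajorant α) := by
  have := isProbabilityMeasure_besselMeasure hα
  exact Measurable.lintegral_prod_right' (f := fun q : Plane × Plane => ‖q.1 - q.2‖ₑ⁻¹)
    (by fun_prop)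

lemma stronglyMeasurable_velKernel {α : ℝ} (hα : 0 < α) : StronglyMeasurable (velKernel α) := by
  have := isProbabilityMeasure_besselMeasure hα
  have h : StronglyMeasurable (fun q : Plane × Plane => bsKernel (q.1 - q.2)) :=
    (measurable_bsKernel.comp (measurable_fst.sub measurable_snd)).stronglyMeasurable
  exact (h.integral_prod_right' (ν := besselMeasure α)).const_smul (2 * Real.pi)⁻¹

lemma velKernel_neg (α : ℝ) (x : Plane) : velKernel α (-x) = -velKernel α x := by
  have h := (measurePreserving_besselMeasure α (LinearIsometryEquiv.neg ℝ)).integral_comp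
    (LinearIsometryEquiv.neg ℝ : Plane ≃ₗᵢ[ℝ] Plane).toMeasurableEquiv.measurableEmbedding
    (fun y => bsKernel (-x - y))
  rw [velKernel, velKernel, ← h, ← smul_neg, ← integral_neg]
  congr 2 with y : 1
  simp only [LinearIsometryEquiv.coe_neg, bsKernel]
  rw [show -x - -y = -(x - y) by abel, perp_neg, norm_neg, smul_neg]

/-- The velocity kernel is equivariant, up to a sign, under reflections. -/
lemma velKernel_reflection (α : ℝ) (S : Plane ≃ₗᵢ[ℝ] Plane)
    (hS : ∀ y, perp (S y) = -S (perp y)) (x : Plane) :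
    velKernel α (S x) = -S (velKernel α x) := by
  have h := (measurePreserving_besselMeasure α S).integral_comp
    S.toMeasurableEquiv.measurableEmbedding (fun y => bsKernel (S x - y))
  have e : ∀ y, bsKernel (S x - S y) = -S (bsKernel (x - y)) := by
    intro y
    rw [bsKernel, bsKernel, ← map_sub, hS, S.norm_map, map_smul, smul_neg]
  rw [velKernel, velKernel, ← h, map_smul, ← smul_neg]
  congr 1
  simp_rw [e, integral_neg]
  rw [show ∫ y, S (bsKernel (x - y)) ∂(besselMeasure α)
    = S (∫ y, bsKernel (x - y) ∂(besselMeasure α)) from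
      S.toContinuousLinearEquiv.integral_comp_comm _]

lemma integrable_smul_bsKernel {α : ℝ} (hα : 0 < α) {v : Plane → ℝ} (hv : Integrable v)
    (x : Plane) :
    Integrable (fun q : Plane × Plane => v q.1 • bsKernel (x - q.1 - q.2))
      ((volume : Measure Plane).prod (besselMeasure α)) := by
  have := isProbabilityMeasure_besselMeasure hα
  obtain ⟨C, hC, hb⟩ := lintegral_inv_norm_besselMeasure_le hα
  have hk := measurable_bsKernel
  refine ⟨(hv.comp_fst _).aestronglyMeasurable.smul
    (Measurable.aestronglyMeasurable (by fun_prop)), ?_⟩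
  rw [hasFiniteIntegral_iff_enorm, lintegral_prod]
  · calc _ ≤ ∫⁻ z, ‖v z‖ₑ * ENNReal.ofReal C := by
          refine lintegral_mono fun z => ?_
          simp only [enorm_smul]
          rw [lintegral_const_mul _ (by fun_prop)]
          gcongr
          exact (lintegral_mono fun y => enorm_bsKernel_le _).trans (hb (x - z))
      _ = (∫⁻ z, ‖v z‖ₑ) * ENNReal.ofReal C := lintegral_mul_const' _ _ ENNReal.ofReal_ne_top
      _ < ∞ := ENNReal.mul_lt_top hv.2 ENNReal.ofReal_lt_top
  · exact ((hv.comp_fst _).aestronglyMeasurable.smul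
      (Measurable.aestronglyMeasurable (by fun_prop))).enorm

/-- The velocity of a filtered vorticity, as an integral against the unfiltered vorticity. -/
lemma biotSavart_eq_velocity {α : ℝ} (hα : 0 < α) {v w : Plane → ℝ} (hv : Integrable v)
    (hw : IsHelmholtzFilter α v w) (x : Plane) : biotSavart w x = velocity α v x := by
  have := isProbabilityMeasure_besselMeasure hα
  have hae := hw.ae_eq hα (isHelmholtzFilter_besselFilter hα hv)
  have e1 : ∫ y : Plane, (w y / ‖x - y‖ ^ 2) • perp (x - y)
      = ∫ y, besselFilter α v y • bsKernel (x - y) := by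
    refine integral_congr_ae ?_
    filter_upwards [hae] with y hy
    rw [hy, bsKernel, smul_smul, div_eq_mul_inv]
  have key := integral_integral_shear (integrable_smul_bsKernel hα hv x)
  simp only at key
  have e2 : ∀ a y : Plane, x - (a - y) - y = x - a := fun a y => by abel
  simp only [e2, integral_smul_const, integral_smul] at key
  rw [biotSavart, e1]
  unfold besselFilter
  rw [key, velocity, ← integral_smul]
  congr 1 with z : 1
  rw [velKernel, smul_comm]

end VCHE
end


noncomputable section

namespace VCHE

/-! ### Estimates for the velocity -/

/-- The supremum of the majorant of the velocity kernel. -/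
def velSup (α : ℝ) : ℝ≥0∞ := ⨆ x, velMajorant α x

lemma velSup_lt_top {α : ℝ} (hα : 0 < α) : velSup α < ∞ := by
  obtain ⟨C, _, hb⟩ := lintegral_inv_norm_besselMeasure_le hα
  exact (iSup_le hb).trans_lt ENNReal.ofReal_lt_top

lemma velMajorant_le (α : ℝ) (x : Plane) : velMajorant α x ≤ velSup α := le_iSup (velMajorant α) x

lemma velMajorant_neg (α : ℝ) (x : Plane) : velMajorant α (-x) = velMajorant α x := by
  have h := (measurePreserving_besselMeasure α (LinearIsometryEquiv.neg ℝ)).lintegral_comp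
    (f := fun y : Plane => ‖-x - y‖ₑ⁻¹) (by fun_prop)
  rw [velMajorant, velMajorant, ← h]
  refine lintegral_congr fun y => ?_
  simp only [LinearIsometryEquiv.coe_neg]
  rw [show -x - -y = -(x - y) by abel, enorm_neg]

lemma enorm_velocity_le (α : ℝ) (v : Plane → ℝ) (x : Plane) :
    ‖velocity α v x‖ₑ ≤ ∫⁻ z, ‖v z‖ₑ * velMajorant α (x - z) := by
  refine (enorm_integral_le_lintegral_enorm _).trans (lintegral_mono fun z => ?_)
  rw [enorm_smul]
  gcongr
  exact enorm_velKernel_le _ _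

lemma enorm_velocity_le_velSup {α : ℝ} (hα : 0 < α) (v : Plane → ℝ) (x : Plane) :
    ‖velocity α v x‖ₑ ≤ (∫⁻ z, ‖v z‖ₑ) * velSup α := by
  refine (enorm_velocity_le α v x).trans ?_
  rw [← lintegral_mul_const' _ _ (velSup_lt_top hα).ne]
  exact lintegral_mono fun z => by gcongr; exact velMajorant_le _ _

/-- Hölder's inequality against the constant one; for a probability measure it is Jensen's
inequality. -/
lemma rpow_lintegral_le_lintegral_rpow {Ω : Type*} [MeasurableSpace Ω] {ν : Measure Ω}
    {f : Ω → ℝ≥0∞} (hf : AEMeasurable f ν) {p : ℝ} (hp : 1 ≤ p) :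
    (∫⁻ a, f a ∂ν) ^ p ≤ (ν univ) ^ (p - 1) * ∫⁻ a, f a ^ p ∂ν := by
  have hp0 : 0 < p := by linarith
  have h := ENNReal.lintegral_mul_norm_pow_le (hf.pow_const p) (aemeasurable_const (b := (1 : ℝ≥0∞)))
    (p := p⁻¹) (q := 1 - p⁻¹) (by positivity) (by simp; exact inv_le_one_of_one_le₀ hp) (by ring)
  simp only [ENNReal.one_rpow, mul_one, ENNReal.rpow_rpow_inv hp0.ne', lintegral_const, one_mul] at h
  calc _ ≤ ((∫⁻ a, f a ^ p ∂ν) ^ p⁻¹ * (ν univ) ^ (1 - p⁻¹)) ^ p := by gcongr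
    _ = _ := by
      rw [ENNReal.mul_rpow_of_nonneg _ _ hp0.le, ENNReal.rpow_inv_rpow hp0.ne', ← ENNReal.rpow_mul,
        mul_comm, sub_mul, one_mul, inv_mul_cancel₀ hp0.ne']

/-- Gaussian averages of powers of the majorant. -/
lemma lintegral_velMajorant_rpow_mul_heatKernel_le {β : ℝ} (hβ1 : 1 ≤ β) (hβ : β < 2) :
    ∃ C : ℝ, 0 ≤ C ∧ ∀ α : ℝ, 0 < α → ∀ τ : ℝ, 0 < τ → ∀ z : Plane,
      ∫⁻ x, velMajorant α (x - z) ^ β * ENNReal.ofReal (heatKernel τ x)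
        ≤ ENNReal.ofReal (C * τ ^ (-(β / 2))) := by
  obtain ⟨C, hC, h⟩ := lintegral_inv_norm_rpow_mul_heatKernel_le (by linarith : 0 ≤ β) hβ
  refine ⟨C, hC, fun α hα τ hτ z => ?_⟩
  have := isProbabilityMeasure_besselMeasure hα
  have hm := (continuous_heatKernel τ).measurable
  -- Jensen's inequality brings the power inside the Bessel average. The Gaussian bound is uniform
  -- in the position z + y of the singularity, so averaging over y costs nothing and the constant
  -- does not depend on α.
  calc _ ≤ ∫⁻ x, ∫⁻ y, (‖x - (z + y)‖ₑ⁻¹) ^ β * ENNReal.ofReal (heatKernel τ x)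
          ∂(besselMeasure α) := by
        refine lintegral_mono fun x => ?_
        rw [lintegral_mul_const _ (by fun_prop)]
        gcongr
        have := rpow_lintegral_le_lintegral_rpow (ν := besselMeasure α)
          (f := fun y => ‖x - z - y‖ₑ⁻¹) (by fun_prop) hβ1
        simpa [velMajorant, sub_sub] using this
    _ = ∫⁻ y, (∫⁻ x, (‖x - (z + y)‖ₑ⁻¹) ^ β * ENNReal.ofReal (heatKernel τ x))
          ∂(besselMeasure α) := lintegral_lintegral_swap (by fun_prop)
    _ ≤ ∫⁻ _, ENNReal.ofReal (C * τ ^ (-(β / 2))) ∂(besselMeasure α) :=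
        lintegral_mono fun y => h τ hτ _
    _ = _ := by simp

lemma integrable_smul_velKernel {α : ℝ} (hα : 0 < α) {v : Plane → ℝ} (hv : Integrable v)
    (x : Plane) : Integrable (fun z => v z • velKernel α (x - z)) := by
  have hk := (stronglyMeasurable_velKernel hα)
  refine ⟨hv.aestronglyMeasurable.smul
    (hk.comp_measurable (measurable_const.sub measurable_id)).aestronglyMeasurable, ?_⟩
  rw [hasFiniteIntegral_iff_enorm]
  calc _ ≤ ∫⁻ z, ‖v z‖ₑ * velSup α := by
        refine lintegral_mono fun z => ?_
        rw [enorm_smul]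
        gcongr
        exact (enorm_velKernel_le _ _).trans (velMajorant_le _ _)
    _ = (∫⁻ z, ‖v z‖ₑ) * velSup α := lintegral_mul_const' _ _ (velSup_lt_top hα).ne
    _ < ∞ := ENNReal.mul_lt_top hv.2 (velSup_lt_top hα)

lemma velocity_sub {α : ℝ} (hα : 0 < α) {f g : Plane → ℝ} (hf : Integrable f) (hg : Integrable g)
    (x : Plane) : velocity α (fun z => f z - g z) x = velocity α f x - velocity α g x := by
  simp only [velocity, sub_smul]
  exact integral_sub (integrable_smul_velKernel hα hf x) (integrable_smul_velKernel hα hg x)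

lemma velocity_add {α : ℝ} (hα : 0 < α) {f g : Plane → ℝ} (hf : Integrable f) (hg : Integrable g)
    (x : Plane) : velocity α (fun z => f z + g z) x = velocity α f x + velocity α g x := by
  simp only [velocity, add_smul]
  exact integral_add (integrable_smul_velKernel hα hf x) (integrable_smul_velKernel hα hg x)

lemma velocity_const_mul (α : ℝ) (c : ℝ) (f : Plane → ℝ) (x : Plane) :
    velocity α (fun z => c * f z) x = c • velocity α f x := by
  simp only [velocity, mul_smul, integral_smul]

lemma velocity_congr {α : ℝ} {f g : Plane → ℝ} (h : f =ᵐ[volume] g) (x : Plane) :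
    velocity α f x = velocity α g x := by
  refine integral_congr_ae ?_
  filter_upwards [h] with z hz
  rw [hz]

lemma velocity_shift (α : ℝ) (f : Plane → ℝ) (e x : Plane) :
    velocity α (fun z => f (z + e)) x = velocity α f (x + e) := by
  rw [velocity, velocity,
    ← integral_add_right_eq_self (fun z => f z • velKernel α (x + e - z)) e]
  congr 1 with z : 1
  rw [add_sub_add_right_eq_sub]

lemma stronglyMeasurable_velocity_uncurry {α : ℝ} (hα : 0 < α) {v : ℝ → Plane → ℝ}
    (hv : Measurable (Function.uncurry v)) :
    StronglyMeasurable (fun q : ℝ × Plane => velocity α (v q.1) q.2) := by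
  have hk := (stronglyMeasurable_velKernel hα).measurable
  have h : Measurable (fun p : (ℝ × Plane) × Plane => v p.1.1 p.2 • velKernel α (p.1.2 - p.2)) := by
    have h1 : Measurable (fun p : (ℝ × Plane) × Plane => v p.1.1 p.2) :=
      hv.comp (by fun_prop : Measurable fun p : (ℝ × Plane) × Plane => (p.1.1, p.2))
    fun_prop
  exact h.stronglyMeasurable.integral_prod_right'

lemma stronglyMeasurable_velocity {α : ℝ} (hα : 0 < α) {f : Plane → ℝ} (hf : Integrable f) :
    StronglyMeasurable (velocity α f) := by
  have hk := (stronglyMeasurable_velKernel hα).measurable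
  obtain ⟨g, hg, hfg⟩ := hf.1
  have hgm := hg.measurable
  have h : Measurable (fun p : Plane × Plane => g p.2 • velKernel α (p.1 - p.2)) := by fun_prop
  have h2 : velocity α f = velocity α g := funext fun x => velocity_congr hfg x
  rw [h2]
  exact h.stronglyMeasurable.integral_prod_right'

/-! ### The vorticity flux -/

/-- The flux of the vorticity `g` transported by the velocity of the vorticity `f`. -/
def flux (α : ℝ) (f g : Plane → ℝ) (y : Plane) : Plane := g y • velocity α f y

lemma integrable_flux {α : ℝ} (hα : 0 < α) {f g : Plane → ℝ} (hf : Integrable f)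
    (hg : Integrable g) : Integrable (flux α f g) := by
  refine ⟨hg.1.smul (stronglyMeasurable_velocity hα hf).aestronglyMeasurable, ?_⟩
  rw [hasFiniteIntegral_iff_enorm]
  have hfin : (∫⁻ z, ‖f z‖ₑ) * velSup α < ∞ := ENNReal.mul_lt_top hf.2 (velSup_lt_top hα)
  calc _ ≤ ∫⁻ y, ‖g y‖ₑ * ((∫⁻ z, ‖f z‖ₑ) * velSup α) := by
        refine lintegral_mono fun y => ?_
        rw [flux, enorm_smul]
        gcongr
        exact enorm_velocity_le_velSup hα f y
    _ = (∫⁻ y, ‖g y‖ₑ) * ((∫⁻ z, ‖f z‖ₑ) * velSup α) := lintegral_mul_const' _ _ hfin.ne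
    _ < ∞ := ENNReal.mul_lt_top hg.2 hfin

lemma flux_sub_flux {α : ℝ} (hα : 0 < α) {f g : Plane → ℝ} (hf : Integrable f)
    (hg : Integrable g) (y : Plane) :
    flux α f f y - flux α g g y
      = flux α (fun z => f z - g z) f y + flux α g (fun z => f z - g z) y := by
  simp only [flux, velocity_sub hα hf hg, smul_sub, sub_smul]
  abel

/-- The self-flux has zero mean, since the velocity kernel is odd. -/
lemma integral_flux_self {α : ℝ} (hα : 0 < α) {f : Plane → ℝ} (hf : Integrable f) :
    ∫ y, flux α f f y = 0 := by
  have hk := (stronglyMeasurable_velKernel hα)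
  have hsm : AEStronglyMeasurable (fun q : Plane × Plane => f q.1 • f q.2 • velKernel α (q.1 - q.2))
      ((volume : Measure Plane).prod volume) :=
    hf.1.comp_fst.smul (hf.1.comp_snd.smul
      (hk.comp_measurable (measurable_fst.sub measurable_snd)).aestronglyMeasurable)
  have hint : Integrable (fun q : Plane × Plane => f q.1 • f q.2 • velKernel α (q.1 - q.2))
      ((volume : Measure Plane).prod volume) := by
    refine ⟨hsm, ?_⟩
    rw [hasFiniteIntegral_iff_enorm]
    have hb := hf.mul_prod hf
    calc _ ≤ ∫⁻ q : Plane × Plane, ‖f q.1 * f q.2‖ₑ * velSup α ∂((volume : Measure Plane).prod volume) := by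
          refine lintegral_mono fun q => ?_
          simp only [enorm_smul, enorm_mul, ← mul_assoc]
          gcongr
          exact (enorm_velKernel_le _ _).trans (velMajorant_le _ _)
      _ = _ := lintegral_mul_const' _ _ (velSup_lt_top hα).ne
      _ < ∞ := ENNReal.mul_lt_top hb.2 (velSup_lt_top hα)
  have e1 : ∫ y, flux α f f y = ∫ x, ∫ y, f x • f y • velKernel α (x - y) := by
    simp only [flux, velocity, integral_smul]
  have e2 := integral_integral_swap (f := fun x y => f x • f y • velKernel α (x - y)) hint
  have e3 : ∫ y, ∫ x, f x • f y • velKernel α (x - y) = -∫ x, ∫ y, f x • f y • velKernel α (x - y) := by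
    rw [← integral_neg]
    congr 1 with y : 1
    rw [← integral_neg]
    congr 1 with x : 1
    rw [← neg_sub y x, velKernel_neg, smul_comm, smul_neg, smul_neg]
  rw [e1]
  rw [e3] at e2
  have h2 : (2 : ℝ) • ∫ x, ∫ y, f x • f y • velKernel α (x - y) = 0 := by
    rw [two_smul, ← eq_neg_iff_add_eq_zero]; exact e2
  exact (smul_eq_zero.1 h2).resolve_left two_ne_zero

/-! ### Convolution with the gradient of the heat kernel -/

/-- The convolution `∇Φ(τ) * F`. -/
def convGrad (τ : ℝ) (F : Plane → Plane) (x : Plane) : ℝ :=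
  ∫ y, inner ℝ (gradient (heatKernel τ) (x - y)) (F y)

lemma continuous_gradient_heatKernel (τ : ℝ) : Continuous (gradient (heatKernel τ)) := by
  have h : gradient (heatKernel τ) = fun x => (-(2 * τ)⁻¹ * heatKernel τ x) • x :=
    funext (gradient_heatKernel τ)
  have := continuous_heatKernel τ
  rw [h]; fun_prop

lemma integrable_inner_gradient {τ : ℝ} (hτ : 0 < τ) {F : Plane → Plane} (hF : Integrable F)
    (x : Plane) : Integrable (fun y => inner ℝ (gradient (heatKernel τ) (x - y)) (F y)) := by
  have hc := continuous_gradient_heatKernel τ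
  refine (hF.norm.const_mul (2064 * (√τ)⁻¹ * (2 * τ)⁻¹)).mono' ?_ (.of_forall fun y => ?_)
  · exact (Continuous.aestronglyMeasurable (by fun_prop)).inner hF.1
  · refine (norm_inner_le_norm _ _).trans ?_
    gcongr
    refine (norm_gradient_heatKernel_le hτ _).trans ?_
    gcongr
    exact heatKernel_le_inv (by positivity) _

lemma convGrad_add {τ : ℝ} (hτ : 0 < τ) {F G : Plane → Plane} (hF : Integrable F)
    (hG : Integrable G) (x : Plane) :
    convGrad τ (fun y => F y + G y) x = convGrad τ F x + convGrad τ G x := by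
  simp only [convGrad, inner_add_right]
  exact integral_add (integrable_inner_gradient hτ hF x) (integrable_inner_gradient hτ hG x)

lemma convGrad_sub {τ : ℝ} (hτ : 0 < τ) {F G : Plane → Plane} (hF : Integrable F)
    (hG : Integrable G) (x : Plane) :
    convGrad τ (fun y => F y - G y) x = convGrad τ F x - convGrad τ G x := by
  simp only [convGrad, inner_sub_right]
  exact integral_sub (integrable_inner_gradient hτ hF x) (integrable_inner_gradient hτ hG x)

lemma convGrad_const_smul (τ c : ℝ) (F : Plane → Plane) (x : Plane) :
    convGrad τ (fun y => c • F y) x = c * convGrad τ F x := by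
  simp only [convGrad, inner_smul_right, integral_const_mul]

/-- The reflection in the line through x fixes x and reverses orientation, hence anticommutes with
the rotation by a right angle. At x = 0 any line serves. -/
lemma exists_reflection_fixing (x : Plane) :
    ∃ S : Plane ≃ₗᵢ[ℝ] Plane, S x = x ∧ ∀ y, perp (S y) = -S (perp y) := by
  have key : ∀ x : Plane, x ≠ 0 → ∀ y,
      perp ((Submodule.span ℝ {x}).reflection y) = -(Submodule.span ℝ {x}).reflection (perp y) := by
    intro x hx y
    have hx' : x 0 ^ 2 + x 1 ^ 2 ≠ 0 := by
      have : ‖x‖ ^ 2 ≠ 0 := by simpa using hx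
      simpa [EuclideanSpace.norm_sq_eq, Fin.sum_univ_two] using this
    rw [Submodule.reflection_singleton_apply, Submodule.reflection_singleton_apply]
    ext i
    fin_cases i <;>
    · simp [perp, EuclideanSpace.norm_sq_eq, Fin.sum_univ_two, PiLp.inner_apply]
      field_simp
      ring
  rcases eq_or_ne x 0 with rfl | hx
  · refine ⟨(Submodule.span ℝ {EuclideanSpace.single (0 : Fin 2) (1 : ℝ)}).reflection, by simp,
      key _ (by simp)⟩
  · exact ⟨(Submodule.span ℝ {x}).reflection,
      Submodule.reflection_mem_subspace_eq_self (Submodule.mem_span_singleton_self x), key x hx⟩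

/-- A Gaussian vortex is not advected by its own velocity. -/
lemma convGrad_flux_heatKernel (α τ T : ℝ) (x : Plane) :
    convGrad τ (flux α (heatKernel T) (heatKernel T)) x = 0 := by
  obtain ⟨S, hSx, hS⟩ := exists_reflection_fixing x
  have hk : ∀ (t : ℝ) y, heatKernel t (S y) = heatKernel t y := by
    intro t y; simp [heatKernel]
  have hv : ∀ y, velocity α (heatKernel T) (S y) = -S (velocity α (heatKernel T) y) := by
    intro y
    rw [velocity, velocity, ← S.measurePreserving.integral_comp
      S.toMeasurableEquiv.measurableEmbedding]
    have e : ∀ z, heatKernel T (S z) • velKernel α (S y - S z)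
        = -S (heatKernel T z • velKernel α (y - z)) := by
      intro z
      rw [← map_sub, velKernel_reflection α S hS, hk, smul_neg, map_smul]
    simp_rw [e, integral_neg]
    rw [show ∫ z, S (heatKernel T z • velKernel α (y - z))
      = S (∫ z, heatKernel T z • velKernel α (y - z)) from
        S.toContinuousLinearEquiv.integral_comp_comm _]
  have h := S.measurePreserving.integral_comp S.toMeasurableEquiv.measurableEmbedding
    (fun y => inner ℝ (gradient (heatKernel τ) (x - y)) (flux α (heatKernel T) (heatKernel T) y))
  -- S fixes x and preserves radial functions, while the velocity of a radial vorticity changes sign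
  -- under S. The integrand is odd under S, so its integral vanishes.
  have e : ∀ y, inner ℝ (gradient (heatKernel τ) (x - S y))
      (flux α (heatKernel T) (heatKernel T) (S y))
      = -inner ℝ (gradient (heatKernel τ) (x - y)) (flux α (heatKernel T) (heatKernel T) y) := by
    intro y
    rw [flux, flux, hk, hv, gradient_heatKernel, gradient_heatKernel,
      show x - S y = S (x - y) by rw [map_sub, hSx], hk]
    simp only [smul_neg, inner_neg_right, inner_smul_left, inner_smul_right, S.inner_map_map]
  simp_rw [e, integral_neg] at h
  exact self_eq_neg.1 h.symm

lemma convGrad_flux_heatKernel_shift (α τ T : ℝ) (e x : Plane) :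
    convGrad τ (flux α (fun y => heatKernel T (y + e)) (fun y => heatKernel T (y + e))) x = 0 := by
  rw [← convGrad_flux_heatKernel α τ T (x + e), convGrad, convGrad,
    ← integral_add_right_eq_self (fun y => inner ℝ (gradient (heatKernel τ) (x + e - y))
      (flux α (heatKernel T) (heatKernel T) y)) e]
  congr 1 with y : 1
  simp only [flux, velocity_shift, add_sub_add_right_eq_sub]

/-- For a pair of vortices the advection reduces to the one generated by their difference. -/
lemma convGrad_flux_pair {α τ T : ℝ} (hα : 0 < α) (hτ : 0 < τ) (hT : 0 < T) (c₀ c₁ : ℝ)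
    (e x : Plane) :
    convGrad τ (fun y =>
      flux α (fun y => c₀ * heatKernel T y + c₁ * heatKernel T (y + e))
        (fun y => c₀ * heatKernel T y + c₁ * heatKernel T (y + e)) y
      + (c₀ * c₁) • flux α (fun y => heatKernel T (y + e) - heatKernel T y)
        (fun y => heatKernel T (y + e) - heatKernel T y) y) x = 0 := by
  set f := heatKernel T with hf
  set g : Plane → ℝ := fun y => heatKernel T (y + e) with hg
  have if' : Integrable f := integrable_heatKernel hT
  have ig' : Integrable g := integrable_heatKernel_shift hT e
  -- Polarization: the mixed terms of the pair cancel against those of c₀c₁ times the self-flux of g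
  -- - f, and only the self-fluxes of f and of g survive. Each of them is invisible to the equation.
  have key : (fun y => flux α (fun y => c₀ * f y + c₁ * g y) (fun y => c₀ * f y + c₁ * g y) y
      + (c₀ * c₁) • flux α (fun y => g y - f y) (fun y => g y - f y) y)
      = fun y => (c₀ ^ 2 + c₀ * c₁) • flux α f f y + (c₁ ^ 2 + c₀ * c₁) • flux α g g y := by
    funext y
    simp only [flux]
    rw [velocity_add hα (if'.const_mul c₀) (ig'.const_mul c₁), velocity_sub hα ig' if',
      velocity_const_mul, velocity_const_mul]
    module
  have h1 := convGrad_flux_heatKernel α τ T x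
  have h2 := convGrad_flux_heatKernel_shift α τ T e x
  have h3 : convGrad τ (fun y => (c₀ ^ 2 + c₀ * c₁) • flux α f f y
      + (c₁ ^ 2 + c₀ * c₁) • flux α g g y) x = 0 := by
    rw [convGrad_add hτ (F := fun y => (c₀ ^ 2 + c₀ * c₁) • flux α f f y)
      (G := fun y => (c₁ ^ 2 + c₀ * c₁) • flux α g g y) ((integrable_flux hα if' if').smul (c₀ ^ 2 + c₀ * c₁))
      ((integrable_flux hα ig' ig').smul (c₁ ^ 2 + c₀ * c₁)), convGrad_const_smul,
      convGrad_const_smul, h1, h2]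
    simp
  rw [← key] at h3
  exact h3

end VCHE
end


noncomputable section

namespace VCHE

/-! ### Integral inequalities -/

section Schur

variable {X Y : Type*} [MeasurableSpace X] [MeasurableSpace Y] {μ : Measure X} {ν : Measure Y}

/-- Hölder's inequality for the splitting K f = (K^p f)^{1/p} f^{1-1/p}. -/
lemma rpow_lintegral_mul_le {K f : Y → ℝ≥0∞} (hK : AEMeasurable K ν) (hf : AEMeasurable f ν)
    {p : ℝ} (hp : 1 ≤ p) :
    (∫⁻ y, K y * f y ∂ν) ^ p ≤ (∫⁻ y, K y ^ p * f y ∂ν) * (∫⁻ y, f y ∂ν) ^ (p - 1) := by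
  have hp0 : 0 < p := by linarith
  have hp1 : 0 ≤ 1 - p⁻¹ := by simp; exact inv_le_one_of_one_le₀ hp
  have h := ENNReal.lintegral_mul_norm_pow_le ((hK.pow_const p).mul hf) hf
    (p := p⁻¹) (q := 1 - p⁻¹) (by positivity) hp1 (by ring)
  have e : ∀ y, (K y ^ p * f y) ^ p⁻¹ * f y ^ (1 - p⁻¹) = K y * f y := by
    intro y
    rw [ENNReal.mul_rpow_of_nonneg _ _ (by positivity), ENNReal.rpow_rpow_inv hp0.ne', mul_assoc,
      ← ENNReal.rpow_add_of_nonneg _ _ (by positivity) hp1]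
    simp
  simp only [Pi.mul_apply, e] at h
  calc _ ≤ ((∫⁻ y, K y ^ p * f y ∂ν) ^ p⁻¹ * (∫⁻ y, f y ∂ν) ^ (1 - p⁻¹)) ^ p := by gcongr
    _ = _ := by
      rw [ENNReal.mul_rpow_of_nonneg _ _ hp0.le, ENNReal.rpow_inv_rpow hp0.ne', ← ENNReal.rpow_mul,
        sub_mul, one_mul, inv_mul_cancel₀ hp0.ne']

lemma rpow_sub_one_mul_self (a : ℝ≥0∞) {p : ℝ} (hp : 1 ≤ p) : a ^ (p - 1) * a = a ^ p := by
  conv_lhs => rw [← ENNReal.rpow_one a, ← ENNReal.rpow_mul,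
    ← ENNReal.rpow_add_of_nonneg _ _ (by linarith) zero_le_one]
  congr 1; ring

/-- A kernel with bounded `L^p` sections maps `L¹` to `L^p`. -/
lemma lintegral_rpow_lintegral_mul_le [SFinite μ] [SFinite ν] {K : X → Y → ℝ≥0∞}
    (hK : Measurable (Function.uncurry K)) {f : Y → ℝ≥0∞} (hf : AEMeasurable f ν)
    {p : ℝ} (hp : 1 ≤ p) {B : ℝ≥0∞} (hB : ∀ᵐ y ∂ν, ∫⁻ x, K x y ^ p ∂μ ≤ B) :
    ∫⁻ x, (∫⁻ y, K x y * f y ∂ν) ^ p ∂μ ≤ B * (∫⁻ y, f y ∂ν) ^ p := by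
  have hKx : ∀ x, Measurable (K x) := fun x => hK.comp measurable_prodMk_left
  have hKy : ∀ y, Measurable (fun x => K x y) := fun y => hK.comp measurable_prodMk_right
  have hm : AEMeasurable (fun q : X × Y => K q.1 q.2 ^ p * f q.2) (μ.prod ν) :=
    (hK.pow_const p).aemeasurable.mul hf.comp_snd
  calc _ ≤ ∫⁻ x, (∫⁻ y, K x y ^ p * f y ∂ν) * (∫⁻ y, f y ∂ν) ^ (p - 1) ∂μ :=
        lintegral_mono fun x => rpow_lintegral_mul_le (hKx x).aemeasurable hf hp
    _ = (∫⁻ x, ∫⁻ y, K x y ^ p * f y ∂ν ∂μ) * (∫⁻ y, f y ∂ν) ^ (p - 1) := by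
        rw [lintegral_mul_const'' _ hm.lintegral_prod_right']
    _ = (∫⁻ y, (∫⁻ x, K x y ^ p ∂μ) * f y ∂ν) * (∫⁻ y, f y ∂ν) ^ (p - 1) := by
        rw [lintegral_lintegral_swap hm]
        congr 1
        refine lintegral_congr fun y => ?_
        rw [lintegral_mul_const _ ((hKy y).pow_const p)]
    _ ≤ (∫⁻ y, B * f y ∂ν) * (∫⁻ y, f y ∂ν) ^ (p - 1) := by
        refine mul_le_mul_left (lintegral_mono_ae ?_) _
        filter_upwards [hB] with y hy
        gcongr
    _ = _ := by
        rw [lintegral_const_mul'' _ hf, mul_assoc, mul_comm (∫⁻ y, f y ∂ν),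
          rpow_sub_one_mul_self _ hp]

end Schur

/-- Young's inequality for convolution from `L^{4/3} × L^{4/3}` to `L²`. -/
lemma lintegral_sq_conv_le {g f : Plane → ℝ≥0∞} (hg : Measurable g) (hf : AEMeasurable f) :
    ∫⁻ x, (∫⁻ y, g (x - y) * f y) ^ (2 : ℝ)
      ≤ (∫⁻ x, g x ^ (4 / 3 : ℝ)) ^ (3 / 2 : ℝ) * (∫⁻ y, f y ^ (4 / 3 : ℝ)) ^ (3 / 2 : ℝ) := by
  set G := ∫⁻ x, g x ^ (4 / 3 : ℝ) with hG
  set H := ∫⁻ y, f y ^ (4 / 3 : ℝ) with hH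
  have hgx : ∀ x : Plane, Measurable fun y : Plane => g (x - y) := fun x => by fun_prop
  have hGx : ∀ x : Plane, ∫⁻ y, g (x - y) ^ (4 / 3 : ℝ) = G := fun x =>
    lintegral_sub_left_eq_self (fun y => g y ^ (4 / 3 : ℝ)) x
  have hGy : ∀ y : Plane, ∫⁻ x, g (x - y) ^ (4 / 3 : ℝ) = G := fun y =>
    lintegral_sub_right_eq_self (fun x => g x ^ (4 / 3 : ℝ)) y
  have hm : AEMeasurable (fun q : Plane × Plane => g (q.1 - q.2) ^ (4 / 3 : ℝ) * f q.2 ^ (4 / 3 : ℝ))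
      ((volume : Measure Plane).prod volume) :=
    (Measurable.aemeasurable (by fun_prop)).mul (hf.pow_const _).comp_snd
  have pt : ∀ x, (∫⁻ y, g (x - y) * f y) ^ (2 : ℝ)
      ≤ (∫⁻ y, g (x - y) ^ (4 / 3 : ℝ) * f y ^ (4 / 3 : ℝ)) * (G ^ (1 / 2 : ℝ) * H ^ (1 / 2 : ℝ)) := by
    intro x
    -- The exponents 1/2, 1/4, 1/4 of a threefold Hölder inequality, arranged as two nested
    -- Cauchy-Schwarz inequalities.
    have e : ∀ y, g (x - y) * f y = (g (x - y) ^ (4 / 3 : ℝ) * f y ^ (4 / 3 : ℝ)) ^ (1 / 2 : ℝ)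
        * ((g (x - y) ^ (4 / 3 : ℝ)) ^ (1 / 2 : ℝ) * (f y ^ (4 / 3 : ℝ)) ^ (1 / 2 : ℝ)) ^ (1 / 2 : ℝ) := by
      intro y
      rw [ENNReal.mul_rpow_of_nonneg _ _ (by norm_num), ENNReal.mul_rpow_of_nonneg _ _ (by norm_num)]
      simp only [← ENNReal.rpow_mul]
      rw [mul_mul_mul_comm, ← ENNReal.rpow_add_of_nonneg _ _ (by norm_num) (by norm_num),
        ← ENNReal.rpow_add_of_nonneg _ _ (by norm_num) (by norm_num)]
      norm_num
    have h1 := ENNReal.lintegral_mul_norm_pow_le (μ := (volume : Measure Plane))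
      (f := fun y => g (x - y) ^ (4 / 3 : ℝ) * f y ^ (4 / 3 : ℝ))
      (g := fun y => (g (x - y) ^ (4 / 3 : ℝ)) ^ (1 / 2 : ℝ) * (f y ^ (4 / 3 : ℝ)) ^ (1 / 2 : ℝ))
      (p := 1 / 2) (q := 1 / 2) (((hgx x).pow_const _).aemeasurable.mul (hf.pow_const _))
      ((((hgx x).pow_const _).pow_const _).aemeasurable.mul ((hf.pow_const _).pow_const _))
      (by norm_num) (by norm_num) (by norm_num)
    have h2 := ENNReal.lintegral_mul_norm_pow_le (μ := (volume : Measure Plane))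
      (f := fun y => g (x - y) ^ (4 / 3 : ℝ)) (g := fun y => f y ^ (4 / 3 : ℝ))
      (p := 1 / 2) (q := 1 / 2) (((hgx x).pow_const _).aemeasurable) (hf.pow_const _)
      (by norm_num) (by norm_num) (by norm_num)
    rw [hGx] at h2
    simp_rw [← e] at h1
    calc _ ≤ ((∫⁻ y, g (x - y) ^ (4 / 3 : ℝ) * f y ^ (4 / 3 : ℝ)) ^ (1 / 2 : ℝ)
          * (G ^ (1 / 2 : ℝ) * H ^ (1 / 2 : ℝ)) ^ (1 / 2 : ℝ)) ^ (2 : ℝ) := by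
          gcongr
          refine h1.trans ?_
          gcongr
      _ = _ := by
          rw [ENNReal.mul_rpow_of_nonneg _ _ (by norm_num), ← ENNReal.rpow_mul, ← ENNReal.rpow_mul]
          norm_num
  calc _ ≤ ∫⁻ x, (∫⁻ y, g (x - y) ^ (4 / 3 : ℝ) * f y ^ (4 / 3 : ℝ))
          * (G ^ (1 / 2 : ℝ) * H ^ (1 / 2 : ℝ)) := lintegral_mono pt
    _ = (∫⁻ x, ∫⁻ y, g (x - y) ^ (4 / 3 : ℝ) * f y ^ (4 / 3 : ℝ))
          * (G ^ (1 / 2 : ℝ) * H ^ (1 / 2 : ℝ)) := by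
        rw [lintegral_mul_const'' _ hm.lintegral_prod_right']
    _ = (G * H) * (G ^ (1 / 2 : ℝ) * H ^ (1 / 2 : ℝ)) := by
        rw [lintegral_lintegral_swap hm]
        congr 1
        have hy : ∀ y, ∫⁻ x, g (x - y) ^ (4 / 3 : ℝ) * f y ^ (4 / 3 : ℝ) = G * f y ^ (4 / 3 : ℝ) :=
          fun y => by rw [lintegral_mul_const _ (by fun_prop), hGy]
        simp_rw [hy]
        rw [lintegral_const_mul'' _ (hf.pow_const _)]
    _ = _ := by
        rw [mul_mul_mul_comm]
        conv_lhs => rw [← ENNReal.rpow_one G, ← ENNReal.rpow_one H, ← ENNReal.rpow_mul,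
          ← ENNReal.rpow_mul, ← ENNReal.rpow_add_of_nonneg _ _ (by norm_num) (by norm_num),
          ← ENNReal.rpow_add_of_nonneg _ _ (by norm_num) (by norm_num)]
        norm_num

/-- Gaussian kernel majorants map `L¹` to `L^p`. -/
lemma lintegral_rpow_gaussian_le {ρ p : ℝ} (hρ : 0 < ρ) (hp : 1 ≤ p) {f : Plane → ℝ≥0∞}
    (hf : AEMeasurable f) :
    ∫⁻ x, (∫⁻ y, ENNReal.ofReal (heatKernel ρ (x - y) + heatKernel ρ x) * f y) ^ p
      ≤ (ENNReal.ofReal (2 * ρ ^ (1 / p - 1)) * ∫⁻ y, f y) ^ p := by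
  have hp0 : 0 < p := by linarith
  have hc := continuous_heatKernel ρ
  rw [ENNReal.mul_rpow_of_nonneg _ _ hp0.le]
  refine lintegral_rpow_lintegral_mul_le (K := fun x y => ENNReal.ofReal
    (heatKernel ρ (x - y) + heatKernel ρ x)) ?_ hf hp (.of_forall fun y => ?_)
  · apply Measurable.ennreal_ofReal
    apply Continuous.measurable
    fun_prop
  · calc _ ≤ ∫⁻ x, ENNReal.ofReal (2 ^ (p - 1)) * (ENNReal.ofReal (heatKernel ρ (x - y)) ^ p
            + ENNReal.ofReal (heatKernel ρ (x - 0)) ^ p) := by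
          refine lintegral_mono fun x => ?_
          have h1 := heatKernel_nonneg hρ.le (x - y)
          have h2 := heatKernel_nonneg hρ.le x
          rw [ENNReal.ofReal_add h1 h2, sub_zero]
          refine (ENNReal.rpow_add_le_mul_rpow_add_rpow _ _ hp).trans ?_
          rw [← ENNReal.ofReal_rpow_of_pos two_pos]
          simp
      _ ≤ ENNReal.ofReal (2 ^ (p - 1)) * (ENNReal.ofReal (ρ ^ (1 - p)) + ENNReal.ofReal (ρ ^ (1 - p))) := by
          rw [lintegral_const_mul _ (by fun_prop), lintegral_add_left (by fun_prop)]
          gcongr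
          · exact lintegral_heatKernel_rpow_le hρ hp y
          · exact lintegral_heatKernel_rpow_le hρ hp 0
      _ = _ := by
          rw [← ENNReal.ofReal_add (by positivity) (by positivity), ← ENNReal.ofReal_mul (by positivity),
            ENNReal.ofReal_rpow_of_nonneg (by positivity) hp0.le]
          congr 1
          rw [Real.mul_rpow (by positivity) (by positivity), ← Real.rpow_mul hρ.le,
            show (1 / p - 1) * p = 1 - p by field_simp, ← two_mul, ← mul_assoc,
            ← Real.rpow_add_one (by norm_num)]
          ring_nf

/-- Tonelli's theorem and the |x|^k moments of Gaussians centred at y and at 0. The two centres have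
separate coefficients because the Taylor remainder of the heat kernel weighs them differently. -/
lemma lintegral_weight_gaussian_le {ρ k : ℝ} (hρ : 0 < ρ) (hk : 0 < k) (hk1 : k ≤ 1)
    {a b : Plane → ℝ} (ha : Measurable a) (hb : Measurable b) (ha0 : ∀ y, 0 ≤ a y)
    (hb0 : ∀ y, 0 ≤ b y) {f : Plane → ℝ≥0∞} (hf : AEMeasurable f) :
    ∫⁻ x, ENNReal.ofReal (‖x‖ ^ k) *
        ∫⁻ y, ENNReal.ofReal (a y * heatKernel ρ (x - y) + b y * heatKernel ρ x) * f y
      ≤ ∫⁻ y, ENNReal.ofReal (2064 * (a y * (ρ ^ (k / 2) + ‖y‖ ^ k) + b y * ρ ^ (k / 2))) * f y := by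
  have hc := (continuous_heatKernel ρ).measurable
  have hm : AEMeasurable (fun q : Plane × Plane => ENNReal.ofReal (‖q.1‖ ^ k) * (ENNReal.ofReal
      (a q.2 * heatKernel ρ (q.1 - q.2) + b q.2 * heatKernel ρ q.1) * f q.2))
      ((volume : Measure Plane).prod volume) :=
    (Measurable.aemeasurable (by fun_prop)).mul
      ((Measurable.aemeasurable (by fun_prop)).mul hf.comp_snd)
  calc _ = ∫⁻ x, ∫⁻ y, ENNReal.ofReal (‖x‖ ^ k) *
        (ENNReal.ofReal (a y * heatKernel ρ (x - y) + b y * heatKernel ρ x) * f y) := by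
        refine lintegral_congr fun x => ?_
        rw [lintegral_const_mul' _ _ ENNReal.ofReal_ne_top]
    _ = ∫⁻ y, ∫⁻ x, ENNReal.ofReal (‖x‖ ^ k) *
        (ENNReal.ofReal (a y * heatKernel ρ (x - y) + b y * heatKernel ρ x) * f y) :=
        lintegral_lintegral_swap hm
    _ ≤ _ := by
        refine lintegral_mono fun y => ?_
        have ham := ha0 y
        have hbm := hb0 y
        calc _ = ∫⁻ x, (ENNReal.ofReal (a y) * ENNReal.ofReal (‖x‖ ^ k * heatKernel ρ (x - y))
              + ENNReal.ofReal (b y) * ENNReal.ofReal (‖x‖ ^ k * heatKernel ρ (x - 0))) * f y := by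
              refine lintegral_congr fun x => ?_
              have h1 := heatKernel_nonneg hρ.le (x - y)
              have h2 := heatKernel_nonneg hρ.le x
              rw [← mul_assoc, ← ENNReal.ofReal_mul (by positivity), ← ENNReal.ofReal_mul ham,
                ← ENNReal.ofReal_mul hbm, ← ENNReal.ofReal_add (by positivity)
                  (by rw [sub_zero]; positivity), sub_zero]
              ring_nf
          _ = ((ENNReal.ofReal (a y) * ∫⁻ x, ENNReal.ofReal (‖x‖ ^ k * heatKernel ρ (x - y)))
              + ENNReal.ofReal (b y) * ∫⁻ x, ENNReal.ofReal (‖x‖ ^ k * heatKernel ρ (x - 0))) * f y := by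
              rw [lintegral_mul_const _ (by fun_prop), lintegral_add_left (by fun_prop),
                lintegral_const_mul _ (by fun_prop), lintegral_const_mul _ (by fun_prop)]
          _ ≤ (ENNReal.ofReal (a y) * ENNReal.ofReal (2064 * (ρ ^ (k / 2) + ‖y‖ ^ k))
              + ENNReal.ofReal (b y) * ENNReal.ofReal (2064 * ρ ^ (k / 2))) * f y := by
              gcongr
              · exact lintegral_rpow_mul_heatKernel_le hρ hk.le hk1 y
              · simpa [Real.zero_rpow hk.ne'] using lintegral_rpow_mul_heatKernel_le hρ hk.le hk1 0
          _ = _ := by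
              rw [← ENNReal.ofReal_mul ham, ← ENNReal.ofReal_mul hbm,
                ← ENNReal.ofReal_add (by positivity) (by positivity)]
              ring_nf

end VCHE
end


noncomputable section

namespace VCHE

/-! ### Bounds for the convolution with the gradient of the heat kernel -/

lemma inv_sqrt_eq_rpow {τ : ℝ} (hτ : 0 < τ) : (√τ)⁻¹ = τ ^ (-(1 / 2) : ℝ) := by
  rw [Real.sqrt_eq_rpow, Real.rpow_neg hτ.le]

lemma div_sqrt_rpow {τ : ℝ} (hτ : 0 < τ) {r : ℝ} (hr : 0 ≤ r) (k : ℝ) :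
    (r / √τ) ^ k = τ ^ (-(k / 2)) * r ^ k := by
  rw [Real.div_rpow hr (Real.sqrt_nonneg _), Real.sqrt_eq_rpow, ← Real.rpow_mul hτ.le,
    Real.rpow_neg hτ.le, div_eq_inv_mul]
  congr 3; ring

lemma min_one_le_rpow {z k : ℝ} (hz : 0 ≤ z) (hk0 : 0 ≤ k) (hk : k ≤ 1) : min 1 z ≤ z ^ k := by
  rcases le_total 1 z with h | h
  · rw [min_eq_left h]; exact Real.one_le_rpow h hk0
  · rw [min_eq_right h]
    rcases hz.eq_or_lt with rfl | hz
    · positivity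
    · simpa using Real.rpow_le_rpow_of_exponent_ge hz h hk

lemma enorm_inner_le (a b : Plane) : ‖(inner ℝ a b : ℝ)‖ₑ ≤ ‖a‖ₑ * ‖b‖ₑ := by
  rw [← ofReal_norm, ← ofReal_norm, ← ofReal_norm, ← ENNReal.ofReal_mul (norm_nonneg _)]
  exact ENNReal.ofReal_le_ofReal (norm_inner_le_norm a b)

lemma enorm_convGrad_le {τ : ℝ} (hτ : 0 < τ) (F : Plane → Plane) (x : Plane) :
    ‖convGrad τ F x‖ₑ ≤ ∫⁻ y, ENNReal.ofReal (2064 * (√τ)⁻¹ * heatKernel (2 * τ) (x - y)) * ‖F y‖ₑ := by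
  refine (enorm_integral_le_lintegral_enorm _).trans (lintegral_mono fun y => ?_)
  refine (enorm_inner_le _ _).trans ?_
  gcongr
  rw [← ofReal_norm]
  exact ENNReal.ofReal_le_ofReal (norm_gradient_heatKernel_le hτ _)

/-- As F has zero mean, the constant vector ∇Φ(x) can be subtracted from the kernel, which leaves
increments of the gradient. -/
lemma enorm_convGrad_le_of_mean_zero {τ : ℝ} (hτ : 0 < τ) {F : Plane → Plane} (hF : Integrable F)
    (hF0 : ∫ y, F y = 0) (x : Plane) :
    ‖convGrad τ F x‖ₑ ≤ ∫⁻ y, ENNReal.ofReal (4128 * (√τ)⁻¹ * min 1 (‖y‖ / √τ) *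
        (heatKernel (2 * τ) (x - y) + heatKernel (2 * τ) x)) * ‖F y‖ₑ := by
  have e : convGrad τ F x
      = ∫ y, inner ℝ (gradient (heatKernel τ) (x - y) - gradient (heatKernel τ) x) (F y) := by
    simp only [inner_sub_left]
    rw [integral_sub (integrable_inner_gradient hτ hF x) (hF.const_inner _),
      integral_inner hF, hF0, inner_zero_right, sub_zero, convGrad]
  rw [e]
  refine (enorm_integral_le_lintegral_enorm _).trans (lintegral_mono fun y => ?_)
  refine (enorm_inner_le _ _).trans ?_
  gcongr
  rw [← ofReal_norm]
  exact ENNReal.ofReal_le_ofReal (norm_gradient_heatKernel_sub_le hτ x y)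

lemma two_mul_rpow_le {τ e : ℝ} (hτ : 0 < τ) (he : e ≤ 0) : (2 * τ) ^ e ≤ τ ^ e :=
  Real.rpow_le_rpow_of_nonpos hτ (by linarith) he

lemma one_div_sub_one_nonpos {p : ℝ} (hp : 1 ≤ p) : 1 / p - 1 ≤ 0 := by
  have : 1 / p ≤ 1 := by rw [div_le_one (by linarith)]; exact hp
  linarith

/-- `L¹`-weighted to `L^p` bound for fluxes with zero mean. -/
lemma lintegral_convGrad_rpow_le_of_mean_zero {τ k p : ℝ} (hτ : 0 < τ) (hk : 0 ≤ k) (hk1 : k ≤ 1)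
    (hp : 1 ≤ p) {F : Plane → Plane} (hF : Integrable F) (hF0 : ∫ y, F y = 0) :
    ∫⁻ x, ‖convGrad τ F x‖ₑ ^ p ≤ (ENNReal.ofReal (8256 * τ ^ (-(1 / 2) - k / 2 + (1 / p - 1))) *
      ∫⁻ y, ENNReal.ofReal (‖y‖ ^ k) * ‖F y‖ₑ) ^ p := by
  have hp0 : 0 < p := by linarith
  have hFm := hF.1.enorm
  set c := 4128 * τ ^ (-(1 / 2) - k / 2) with hc
  have hc0 : 0 ≤ c := by positivity
  calc _ ≤ ∫⁻ x, (∫⁻ y, ENNReal.ofReal (heatKernel (2 * τ) (x - y) + heatKernel (2 * τ) x) *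
          (ENNReal.ofReal (c * ‖y‖ ^ k) * ‖F y‖ₑ)) ^ p := by
        refine lintegral_mono fun x => ?_
        gcongr
        refine (enorm_convGrad_le_of_mean_zero hτ hF hF0 x).trans (lintegral_mono fun y => ?_)
        have h1 := heatKernel_nonneg (by positivity : 0 ≤ 2 * τ) (x - y)
        have h2 := heatKernel_nonneg (by positivity : 0 ≤ 2 * τ) x
        rw [← mul_assoc, ← ENNReal.ofReal_mul (by positivity), mul_comm (_ + _)]
        gcongr ENNReal.ofReal (?_ * _) * _
        -- Interpolation between a bounded and a linear increment: min(1, z) ≤ z^k with z = |y|/√τ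
        -- trades a weight |y|^k for a factor τ^{-k/2}.
        have h3 := min_one_le_rpow (by positivity : 0 ≤ ‖y‖ / √τ) hk hk1
        rw [div_sqrt_rpow hτ (norm_nonneg y)] at h3
        calc 4128 * (√τ)⁻¹ * min 1 (‖y‖ / √τ) ≤ 4128 * (√τ)⁻¹ * (τ ^ (-(k / 2)) * ‖y‖ ^ k) := by gcongr
          _ = _ := by
            rw [hc, inv_sqrt_eq_rpow hτ, sub_eq_add_neg, Real.rpow_add hτ]; ring
    _ ≤ (ENNReal.ofReal (2 * (2 * τ) ^ (1 / p - 1)) *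
          ∫⁻ y, ENNReal.ofReal (c * ‖y‖ ^ k) * ‖F y‖ₑ) ^ p :=
        lintegral_rpow_gaussian_le (by positivity) hp (by fun_prop)
    _ ≤ _ := by
        refine ENNReal.rpow_le_rpow ?_ hp0.le
        have e : ∀ y : Plane, ENNReal.ofReal (c * ‖y‖ ^ k) * ‖F y‖ₑ
            = ENNReal.ofReal c * (ENNReal.ofReal (‖y‖ ^ k) * ‖F y‖ₑ) := by
          intro y; rw [ENNReal.ofReal_mul hc0, mul_assoc]
        simp_rw [e]
        rw [lintegral_const_mul' _ _ ENNReal.ofReal_ne_top, ← mul_assoc,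
          ← ENNReal.ofReal_mul (by positivity)]
        gcongr ENNReal.ofReal ?_ * _
        calc 2 * (2 * τ) ^ (1 / p - 1) * c ≤ 2 * τ ^ (1 / p - 1) * c := by
              gcongr 2 * ?_ * _; exact two_mul_rpow_le hτ (one_div_sub_one_nonpos hp)
          _ = _ := by rw [hc, Real.rpow_add hτ]; ring

/-- No cancellation is used here. The resulting power of τ is weaker for large τ but milder at τ =
0, and is the one needed near the final time in the L^{4/3} estimate. -/
lemma lintegral_convGrad_rpow_le {τ p : ℝ} (hτ : 0 < τ) (hp : 1 ≤ p) {F : Plane → Plane}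
    (hF : AEStronglyMeasurable F volume) :
    ∫⁻ x, ‖convGrad τ F x‖ₑ ^ p ≤ (ENNReal.ofReal (4128 * τ ^ (-(1 / 2) + (1 / p - 1))) *
      ∫⁻ y, ‖F y‖ₑ) ^ p := by
  have hp0 : 0 < p := by linarith
  have hFm := hF.enorm
  set c := 2064 * τ ^ (-(1 / 2) : ℝ) with hc
  have hc0 : 0 ≤ c := by positivity
  calc _ ≤ ∫⁻ x, (∫⁻ y, ENNReal.ofReal (heatKernel (2 * τ) (x - y) + heatKernel (2 * τ) x) *
          (ENNReal.ofReal c * ‖F y‖ₑ)) ^ p := by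
        refine lintegral_mono fun x => ?_
        gcongr
        refine (enorm_convGrad_le hτ F x).trans (lintegral_mono fun y => ?_)
        have h1 := heatKernel_nonneg (by positivity : 0 ≤ 2 * τ) (x - y)
        have h2 := heatKernel_nonneg (by positivity : 0 ≤ 2 * τ) x
        rw [← mul_assoc, ← ENNReal.ofReal_mul (by positivity), mul_comm (_ + _), hc,
          inv_sqrt_eq_rpow hτ]
        gcongr
        linarith
    _ ≤ (ENNReal.ofReal (2 * (2 * τ) ^ (1 / p - 1)) * ∫⁻ y, ENNReal.ofReal c * ‖F y‖ₑ) ^ p :=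
        lintegral_rpow_gaussian_le (by positivity) hp (by fun_prop)
    _ ≤ _ := by
        refine ENNReal.rpow_le_rpow ?_ hp0.le
        rw [lintegral_const_mul' _ _ ENNReal.ofReal_ne_top, ← mul_assoc,
          ← ENNReal.ofReal_mul (by positivity)]
        gcongr ENNReal.ofReal ?_ * _
        calc 2 * (2 * τ) ^ (1 / p - 1) * c ≤ 2 * τ ^ (1 / p - 1) * c := by
              gcongr 2 * ?_ * _; exact two_mul_rpow_le hτ (one_div_sub_one_nonpos hp)
          _ = _ := by rw [hc, Real.rpow_add hτ]; ring

lemma lintegral_convGrad_le {τ : ℝ} (hτ : 0 < τ) {F : Plane → Plane}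
    (hF : AEStronglyMeasurable F volume) :
    ∫⁻ x, ‖convGrad τ F x‖ₑ ≤ ENNReal.ofReal (4128 * τ ^ (-(1 / 2) : ℝ)) * ∫⁻ y, ‖F y‖ₑ := by
  simpa using lintegral_convGrad_rpow_le hτ le_rfl hF

lemma min_one_mul_le {z k : ℝ} (hz : 0 ≤ z) (hk0 : 0 ≤ k) (hk : k ≤ 1) :
    min 1 z * (4 + z ^ k) ≤ 5 * z ^ k := by
  have h := min_one_le_rpow hz hk0 hk
  have h2 : min 1 z ≤ 1 := min_le_left _ _
  have h3 : 0 ≤ z ^ k := by positivity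
  nlinarith

/-- Weighted bound for fluxes with zero mean. -/
lemma lintegral_weight_convGrad_le {τ k : ℝ} (hτ : 0 < τ) (hk : 0 < k) (hk1 : k ≤ 1)
    {F : Plane → Plane} (hF : Integrable F) (hF0 : ∫ y, F y = 0) :
    ∫⁻ x, ENNReal.ofReal (‖x‖ ^ k) * ‖convGrad τ F x‖ₑ
      ≤ ENNReal.ofReal (5 * 2064 * 4128 * τ ^ (-(1 / 2) : ℝ)) *
        ∫⁻ y, ENNReal.ofReal (‖y‖ ^ k) * ‖F y‖ₑ := by
  have hFm := hF.1.enorm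
  have h2τ : 0 < 2 * τ := by positivity
  set a : Plane → ℝ := fun y => 4128 * (√τ)⁻¹ * min 1 (‖y‖ / √τ) with ha
  have ham : Measurable a := by fun_prop
  have ha0 : ∀ y, 0 ≤ a y := fun y => by positivity
  calc _ ≤ ∫⁻ x, ENNReal.ofReal (‖x‖ ^ k) *
        ∫⁻ y, ENNReal.ofReal (a y * heatKernel (2 * τ) (x - y) + a y * heatKernel (2 * τ) x) * ‖F y‖ₑ := by
        gcongr with x
        simpa only [← mul_add] using enorm_convGrad_le_of_mean_zero hτ hF hF0 x
    _ ≤ ∫⁻ y, ENNReal.ofReal (2064 * (a y * ((2 * τ) ^ (k / 2) + ‖y‖ ^ k) + a y * (2 * τ) ^ (k / 2)))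
          * ‖F y‖ₑ := lintegral_weight_gaussian_le h2τ hk hk1 ham ham ha0 ha0 hFm
    _ ≤ ∫⁻ y, ENNReal.ofReal (5 * 2064 * 4128 * τ ^ (-(1 / 2) : ℝ)) *
          (ENNReal.ofReal (‖y‖ ^ k) * ‖F y‖ₑ) := by
        refine lintegral_mono fun y => ?_
        rw [← mul_assoc, ← ENNReal.ofReal_mul (by positivity)]
        gcongr ENNReal.ofReal ?_ * _
        have h1 : (2 * τ) ^ (k / 2) ≤ 2 * τ ^ (k / 2) := by
          rw [Real.mul_rpow (by norm_num) hτ.le]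
          gcongr
          calc (2 : ℝ) ^ (k / 2) ≤ 2 ^ (1 : ℝ) :=
                Real.rpow_le_rpow_of_exponent_le (by norm_num) (by linarith)
            _ = 2 := by norm_num
        have h2 := min_one_mul_le (by positivity : 0 ≤ ‖y‖ / √τ) hk.le hk1
        have h3 : ‖y‖ ^ k = τ ^ (k / 2) * (‖y‖ / √τ) ^ k := by
          rw [div_sqrt_rpow hτ (norm_nonneg y), ← mul_assoc, ← Real.rpow_add hτ]
          simp
        have h0 := ha0 y
        calc 2064 * (a y * ((2 * τ) ^ (k / 2) + ‖y‖ ^ k) + a y * (2 * τ) ^ (k / 2))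
            ≤ 2064 * (a y * (2 * τ ^ (k / 2) + ‖y‖ ^ k) + a y * (2 * τ ^ (k / 2))) := by gcongr
          _ = 2064 * 4128 * (√τ)⁻¹ * τ ^ (k / 2) *
              (min 1 (‖y‖ / √τ) * (4 + (‖y‖ / √τ) ^ k)) := by
              rw [h3]; simp only [ha]; ring
          _ ≤ 2064 * 4128 * (√τ)⁻¹ * τ ^ (k / 2) * (5 * (‖y‖ / √τ) ^ k) := by gcongr
          _ = _ := by rw [h3, inv_sqrt_eq_rpow hτ]; ring
    _ = _ := lintegral_const_mul' _ _ ENNReal.ofReal_ne_top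

/-- `L^{4/3}` to `L²` bound. -/
lemma lintegral_convGrad_sq_le {τ : ℝ} (hτ : 0 < τ) {F : Plane → Plane}
    (hF : AEStronglyMeasurable F volume) :
    ∫⁻ x, ‖convGrad τ F x‖ₑ ^ (2 : ℝ) ≤ ENNReal.ofReal (2064 * τ ^ (-(3 / 4) : ℝ)) ^ (2 : ℝ) *
      (∫⁻ y, ‖F y‖ₑ ^ (4 / 3 : ℝ)) ^ (3 / 2 : ℝ) := by
  have hFm := hF.enorm
  have hc := (continuous_heatKernel (2 * τ)).measurable
  have hs : 0 ≤ 2064 * (√τ)⁻¹ := by positivity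
  calc _ ≤ ∫⁻ x, (∫⁻ y, ENNReal.ofReal (2064 * (√τ)⁻¹ * heatKernel (2 * τ) (x - y)) * ‖F y‖ₑ) ^ (2 : ℝ) := by
        gcongr with x; exact enorm_convGrad_le hτ F x
    _ ≤ (∫⁻ x, ENNReal.ofReal (2064 * (√τ)⁻¹ * heatKernel (2 * τ) x) ^ (4 / 3 : ℝ)) ^ (3 / 2 : ℝ)
          * (∫⁻ y, ‖F y‖ₑ ^ (4 / 3 : ℝ)) ^ (3 / 2 : ℝ) :=
        lintegral_sq_conv_le (g := fun x => ENNReal.ofReal (2064 * (√τ)⁻¹ * heatKernel (2 * τ) x))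
          (by fun_prop) hFm
    _ ≤ _ := by
        gcongr
        calc _ = (ENNReal.ofReal ((2064 * (√τ)⁻¹) ^ (4 / 3 : ℝ)) *
              ∫⁻ x, ENNReal.ofReal (heatKernel (2 * τ) (x - 0)) ^ (4 / 3 : ℝ)) ^ (3 / 2 : ℝ) := by
              rw [← lintegral_const_mul' _ _ ENNReal.ofReal_ne_top]
              congr 1
              refine lintegral_congr fun x => ?_
              rw [ENNReal.ofReal_mul hs, ENNReal.mul_rpow_of_nonneg _ _ (by norm_num),
                ENNReal.ofReal_rpow_of_nonneg hs (by norm_num), sub_zero]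
          _ ≤ (ENNReal.ofReal ((2064 * (√τ)⁻¹) ^ (4 / 3 : ℝ)) *
              ENNReal.ofReal (τ ^ (-(1 / 3) : ℝ))) ^ (3 / 2 : ℝ) := by
              gcongr
              refine (lintegral_heatKernel_rpow_le (by positivity) (by norm_num) 0).trans ?_
              apply ENNReal.ofReal_le_ofReal
              refine (two_mul_rpow_le hτ (by norm_num)).trans (le_of_eq ?_)
              norm_num
          _ = _ := by
              rw [← ENNReal.ofReal_mul (by positivity), ENNReal.ofReal_rpow_of_nonneg (by positivity)
                (by norm_num), ENNReal.ofReal_rpow_of_nonneg (by positivity) (by norm_num)]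
              congr 1
              rw [inv_sqrt_eq_rpow hτ, Real.mul_rpow (by positivity) (by positivity),
                Real.mul_rpow (by positivity) (by positivity),
                Real.mul_rpow (by positivity) (by positivity),
                Real.mul_rpow (by positivity) (by positivity)]
              simp only [← Real.rpow_mul hτ.le, ← Real.rpow_mul (by norm_num : (0:ℝ) ≤ 2064)]
              rw [mul_assoc, ← Real.rpow_add hτ]
              norm_num

/-! ### The heat flow -/

/-- The heat flow `Φ(t) * f`. -/
def heatConv (t : ℝ) (f : Plane → ℝ) (x : Plane) : ℝ := ∫ y, heatKernel t (x - y) * f y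

lemma enorm_heatConv_le {t : ℝ} (ht : 0 < t) (f : Plane → ℝ) (x : Plane) :
    ‖heatConv t f x‖ₑ ≤ ∫⁻ y, ‖f y‖ₑ * ENNReal.ofReal (heatKernel t (x - y)) := by
  refine (enorm_integral_le_lintegral_enorm _).trans (lintegral_mono fun y => ?_)
  rw [enorm_mul, mul_comm]
  gcongr
  rw [← ofReal_norm, Real.norm_of_nonneg (heatKernel_nonneg ht.le _)]

lemma integrable_heatKernel_mul {t : ℝ} (ht : 0 < t) {f : Plane → ℝ} (hf : Integrable f)
    (x : Plane) : Integrable (fun y => heatKernel t (x - y) * f y) := by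
  have hc := continuous_heatKernel t
  refine hf.bdd_mul (c := t⁻¹) (Continuous.aestronglyMeasurable (by fun_prop)) (.of_forall fun y => ?_)
  rw [Real.norm_of_nonneg (heatKernel_nonneg ht.le _)]
  exact heatKernel_le_inv ht _

/-- The heat flow is a contraction on `L^p`. -/
lemma lintegral_heatConv_rpow_le {t p : ℝ} (ht : 0 < t) (hp : 1 ≤ p) {f : Plane → ℝ}
    (hf : AEStronglyMeasurable f volume) :
    ∫⁻ x, ‖heatConv t f x‖ₑ ^ p ≤ ∫⁻ y, ‖f y‖ₑ ^ p := by
  have hp0 : 0 < p := by linarith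
  have hc := (continuous_heatKernel t).measurable
  have hm : AEMeasurable (fun q : Plane × Plane => ‖f q.2‖ₑ ^ p *
      ENNReal.ofReal (heatKernel t (q.1 - q.2))) ((volume : Measure Plane).prod volume) :=
    (hf.enorm.pow_const p).comp_snd.mul (Measurable.aemeasurable (by fun_prop))
  calc _ ≤ ∫⁻ x, ∫⁻ y, ‖f y‖ₑ ^ p * ENNReal.ofReal (heatKernel t (x - y)) := by
        refine lintegral_mono fun x => ?_
        refine (ENNReal.rpow_le_rpow (enorm_heatConv_le ht f x) hp0.le).trans ?_
        have h := rpow_lintegral_mul_le (ν := (volume : Measure Plane)) hf.enorm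
          (f := fun y => ENNReal.ofReal (heatKernel t (x - y)))
          (Measurable.aemeasurable (by fun_prop)) hp
        simpa [lintegral_heatKernel_sub' ht] using h
    _ = ∫⁻ y, ∫⁻ x, ‖f y‖ₑ ^ p * ENNReal.ofReal (heatKernel t (x - y)) := lintegral_lintegral_swap hm
    _ = _ := by
        refine lintegral_congr fun y => ?_
        rw [lintegral_const_mul _ (by fun_prop), lintegral_heatKernel_sub ht, mul_one]

/-- Without mass and first moments, the first-order Taylor polynomial of the kernel at x integrates
to zero against f and may be subtracted. -/
lemma enorm_heatConv_le_of_moments {t : ℝ} (ht : 0 < t) {f : Plane → ℝ} (hf : Integrable f)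
    (hf1 : ∀ i, Integrable (fun y : Plane => y i * f y)) (hf0 : ∫ y, f y = 0)
    (hf10 : ∀ i, ∫ y : Plane, y i * f y = 0) (x : Plane) :
    ‖heatConv t f x‖ₑ ≤ ∫⁻ y, ENNReal.ofReal (8256 * (min 1 ((‖y‖ / √t) ^ 2) * heatKernel (2 * t) (x - y)
        + min (‖y‖ / √t) ((‖y‖ / √t) ^ 2) * heatKernel (2 * t) x)) * ‖f y‖ₑ := by
  set g := gradient (heatKernel t) x with hg
  have e1 : ∀ y : Plane, inner ℝ y g * f y = ∑ i, g i * (y i * f y) := by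
    intro y
    simp only [PiLp.inner_apply, Fin.sum_univ_two]
    simp
    ring
  have i1 : Integrable (fun y => inner ℝ y g * f y) := by
    simp_rw [e1]
    exact integrable_finsetSum _ fun i _ => (hf1 i).const_mul _
  have z1 : ∫ y, inner ℝ y g * f y = 0 := by
    simp_rw [e1]
    rw [integral_finsetSum _ fun i _ => (hf1 i).const_mul _]
    simp [integral_const_mul, hf10]
  have e : heatConv t f x
      = ∫ y, (heatKernel t (x - y) - heatKernel t x + inner ℝ y g) * f y := by
    have e2 : ∀ y, (heatKernel t (x - y) - heatKernel t x + inner ℝ y g) * f y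
        = (heatKernel t (x - y) * f y - heatKernel t x * f y) + inner ℝ y g * f y := fun y => by ring
    simp_rw [e2]
    have i2 := integrable_heatKernel_mul ht hf x
    rw [integral_add (f := fun y => heatKernel t (x - y) * f y - heatKernel t x * f y)
      (i2.sub (hf.const_mul _)) i1, integral_sub i2 (hf.const_mul _),
      integral_const_mul, hf0, z1, heatConv]
    ring
  rw [e]
  refine (enorm_integral_le_lintegral_enorm _).trans (lintegral_mono fun y => ?_)
  rw [enorm_mul]
  gcongr
  rw [← ofReal_norm]
  exact ENNReal.ofReal_le_ofReal (abs_heatKernel_taylor_le ht x y)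

/-- These exchange the Taylor factors for the weight |y|^{2μ}. The middle inequality needs 2μ ≥ 1
for large z; all of them need 2μ ≤ 2 for small z. -/
lemma min_le_rpow_two_mul {z μ : ℝ} (hz : 0 ≤ z) (hμ : 1 / 2 ≤ μ) (hμ1 : μ ≤ 1) :
    min 1 (z ^ 2) ≤ z ^ (2 * μ) ∧ min z (z ^ 2) ≤ z ^ (2 * μ) ∧
      min 1 (z ^ 2) * z ^ μ ≤ z ^ (2 * μ) := by
  rcases le_total 1 z with h | h
  · rw [min_eq_left (by nlinarith), min_eq_left (by nlinarith)]
    refine ⟨Real.one_le_rpow h (by linarith), ?_, ?_⟩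
    · simpa using Real.rpow_le_rpow_of_exponent_le h (by linarith : (1 : ℝ) ≤ 2 * μ)
    · rw [one_mul]; exact Real.rpow_le_rpow_of_exponent_le h (by linarith)
  · rw [min_eq_right (by nlinarith), min_eq_right (by nlinarith)]
    have h1 : z ^ 2 ≤ z ^ (2 * μ) := by
      rcases hz.eq_or_lt with rfl | hz
      · rw [Real.zero_rpow (by linarith)]; norm_num
      · rw [← Real.rpow_natCast]
        exact Real.rpow_le_rpow_of_exponent_ge hz h (by push_cast; linarith)
    refine ⟨h1, h1, ?_⟩
    have h2 : z ^ μ ≤ 1 := Real.rpow_le_one hz h (by linarith)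
    nlinarith [sq_nonneg z]

lemma lintegral_heatConv_rpow_le_of_moments {t μ p : ℝ} (ht : 0 < t) (hμ : 1 / 2 ≤ μ) (hμ1 : μ ≤ 1)
    (hp : 1 ≤ p) {f : Plane → ℝ} (hf : Integrable f)
    (hf1 : ∀ i, Integrable (fun y : Plane => y i * f y)) (hf0 : ∫ y, f y = 0)
    (hf10 : ∀ i, ∫ y : Plane, y i * f y = 0) :
    ∫⁻ x, ‖heatConv t f x‖ₑ ^ p ≤ (ENNReal.ofReal (16512 * t ^ (-μ + (1 / p - 1))) *
      ∫⁻ y, ENNReal.ofReal (‖y‖ ^ (2 * μ)) * ‖f y‖ₑ) ^ p := by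
  have hp0 : 0 < p := by linarith
  have hfm := hf.1.enorm
  set c := 8256 * t ^ (-μ) with hc
  have hc0 : 0 ≤ c := by positivity
  calc _ ≤ ∫⁻ x, (∫⁻ y, ENNReal.ofReal (heatKernel (2 * t) (x - y) + heatKernel (2 * t) x) *
          (ENNReal.ofReal (c * ‖y‖ ^ (2 * μ)) * ‖f y‖ₑ)) ^ p := by
        refine lintegral_mono fun x => ?_
        gcongr
        refine (enorm_heatConv_le_of_moments ht hf hf1 hf0 hf10 x).trans (lintegral_mono fun y => ?_)
        have h1 := heatKernel_nonneg (by positivity : 0 ≤ 2 * t) (x - y)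
        have h2 := heatKernel_nonneg (by positivity : 0 ≤ 2 * t) x
        rw [← mul_assoc, ← ENNReal.ofReal_mul (by positivity)]
        gcongr ENNReal.ofReal ?_ * _
        obtain ⟨m1, m2, _⟩ := min_le_rpow_two_mul (by positivity : 0 ≤ ‖y‖ / √t) hμ hμ1
        have h3 : c * ‖y‖ ^ (2 * μ) = 8256 * (‖y‖ / √t) ^ (2 * μ) := by
          rw [div_sqrt_rpow ht (norm_nonneg y), hc, mul_div_cancel_left₀ _ two_ne_zero]; ring
        rw [h3]
        nlinarith [mul_le_mul_of_nonneg_right m1 h1, mul_le_mul_of_nonneg_right m2 h2]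
    _ ≤ (ENNReal.ofReal (2 * (2 * t) ^ (1 / p - 1)) *
          ∫⁻ y, ENNReal.ofReal (c * ‖y‖ ^ (2 * μ)) * ‖f y‖ₑ) ^ p :=
        lintegral_rpow_gaussian_le (by positivity) hp (by fun_prop)
    _ ≤ _ := by
        refine ENNReal.rpow_le_rpow ?_ hp0.le
        have e : ∀ y : Plane, ENNReal.ofReal (c * ‖y‖ ^ (2 * μ)) * ‖f y‖ₑ
            = ENNReal.ofReal c * (ENNReal.ofReal (‖y‖ ^ (2 * μ)) * ‖f y‖ₑ) := by
          intro y; rw [ENNReal.ofReal_mul hc0, mul_assoc]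
        simp_rw [e]
        rw [lintegral_const_mul' _ _ ENNReal.ofReal_ne_top, ← mul_assoc,
          ← ENNReal.ofReal_mul (by positivity)]
        gcongr ENNReal.ofReal ?_ * _
        calc 2 * (2 * t) ^ (1 / p - 1) * c ≤ 2 * t ^ (1 / p - 1) * c := by
              gcongr 2 * ?_ * _; exact two_mul_rpow_le ht (one_div_sub_one_nonpos hp)
          _ = _ := by rw [hc, Real.rpow_add ht]; ring

lemma lintegral_weight_heatConv_le_of_moments {t μ : ℝ} (ht : 0 < t) (hμ : 1 / 2 ≤ μ) (hμ1 : μ ≤ 1)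
    {f : Plane → ℝ} (hf : Integrable f)
    (hf1 : ∀ i, Integrable (fun y : Plane => y i * f y)) (hf0 : ∫ y, f y = 0)
    (hf10 : ∀ i, ∫ y : Plane, y i * f y = 0) :
    ∫⁻ x, ENNReal.ofReal (‖x‖ ^ μ) * ‖heatConv t f x‖ₑ
      ≤ ENNReal.ofReal (5 * 2064 * 8256 * t ^ (-(μ / 2))) *
        ∫⁻ y, ENNReal.ofReal (‖y‖ ^ (2 * μ)) * ‖f y‖ₑ := by
  have hfm := hf.1.enorm
  set a : Plane → ℝ := fun y => 8256 * min 1 ((‖y‖ / √t) ^ 2) with ha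
  set b : Plane → ℝ := fun y => 8256 * min (‖y‖ / √t) ((‖y‖ / √t) ^ 2) with hb
  have ham : Measurable a := by fun_prop
  have hbm : Measurable b := by fun_prop
  have ha0 : ∀ y, 0 ≤ a y := fun y => by positivity
  have hb0 : ∀ y, 0 ≤ b y := fun y => by positivity
  calc _ ≤ ∫⁻ x, ENNReal.ofReal (‖x‖ ^ μ) *
        ∫⁻ y, ENNReal.ofReal (a y * heatKernel (2 * t) (x - y) + b y * heatKernel (2 * t) x) * ‖f y‖ₑ := by
        gcongr with x
        simpa only [ha, hb, mul_add, mul_assoc] using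
          enorm_heatConv_le_of_moments ht hf hf1 hf0 hf10 x
    _ ≤ ∫⁻ y, ENNReal.ofReal (2064 * (a y * ((2 * t) ^ (μ / 2) + ‖y‖ ^ μ) + b y * (2 * t) ^ (μ / 2)))
          * ‖f y‖ₑ :=
        lintegral_weight_gaussian_le (by positivity) (by linarith) hμ1 ham hbm ha0 hb0 hfm
    _ ≤ ∫⁻ y, ENNReal.ofReal (5 * 2064 * 8256 * t ^ (-(μ / 2))) *
          (ENNReal.ofReal (‖y‖ ^ (2 * μ)) * ‖f y‖ₑ) := by
        refine lintegral_mono fun y => ?_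
        rw [← mul_assoc, ← ENNReal.ofReal_mul (by positivity)]
        gcongr ENNReal.ofReal ?_ * _
        have h1 : (2 * t) ^ (μ / 2) ≤ 2 * t ^ (μ / 2) := by
          rw [Real.mul_rpow (by norm_num) ht.le]
          gcongr
          calc (2 : ℝ) ^ (μ / 2) ≤ 2 ^ (1 : ℝ) :=
                Real.rpow_le_rpow_of_exponent_le (by norm_num) (by linarith)
            _ = 2 := by norm_num
        obtain ⟨m1, m2, m3⟩ := min_le_rpow_two_mul (by positivity : 0 ≤ ‖y‖ / √t) hμ hμ1
        have h3 : ‖y‖ ^ μ = t ^ (μ / 2) * (‖y‖ / √t) ^ μ := by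
          rw [div_sqrt_rpow ht (norm_nonneg y), ← mul_assoc, ← Real.rpow_add ht]
          simp
        have h4 : t ^ (-(μ / 2)) * ‖y‖ ^ (2 * μ) = t ^ (μ / 2) * (‖y‖ / √t) ^ (2 * μ) := by
          rw [div_sqrt_rpow ht (norm_nonneg y), ← mul_assoc, ← Real.rpow_add ht]
          congr 2; ring
        have h0 := ha0 y
        have h0' := hb0 y
        calc 2064 * (a y * ((2 * t) ^ (μ / 2) + ‖y‖ ^ μ) + b y * (2 * t) ^ (μ / 2))
            ≤ 2064 * (a y * (2 * t ^ (μ / 2) + ‖y‖ ^ μ) + b y * (2 * t ^ (μ / 2))) := by gcongr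
          _ = 2064 * 8256 * t ^ (μ / 2) *
              (2 * min 1 ((‖y‖ / √t) ^ 2) + min 1 ((‖y‖ / √t) ^ 2) * (‖y‖ / √t) ^ μ
                + 2 * min (‖y‖ / √t) ((‖y‖ / √t) ^ 2)) := by
              rw [h3]; simp only [ha, hb]; ring
          _ ≤ 2064 * 8256 * t ^ (μ / 2) * (5 * (‖y‖ / √t) ^ (2 * μ)) := by gcongr; linarith
          _ = _ := by rw [mul_assoc (5 * 2064 * 8256), h4]; ring
    _ = _ := lintegral_const_mul' _ _ ENNReal.ofReal_ne_top

lemma lintegral_weight_heatConv_le {t μ : ℝ} (ht : 0 < t) (hμ : 0 < μ) (hμ1 : μ ≤ 1)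
    {f : Plane → ℝ} (hf : AEStronglyMeasurable f volume) :
    ∫⁻ x, ENNReal.ofReal (‖x‖ ^ μ) * ‖heatConv t f x‖ₑ
      ≤ ∫⁻ y, ENNReal.ofReal (2064 * (t ^ (μ / 2) + ‖y‖ ^ μ)) * ‖f y‖ₑ := by
  calc _ ≤ ∫⁻ x, ENNReal.ofReal (‖x‖ ^ μ) *
        ∫⁻ y, ENNReal.ofReal (1 * heatKernel t (x - y) + 0 * heatKernel t x) * ‖f y‖ₑ := by
        gcongr with x
        refine (enorm_heatConv_le ht f x).trans (le_of_eq ?_)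
        refine lintegral_congr fun y => ?_
        rw [mul_comm]; simp
    _ ≤ _ := by
        refine (lintegral_weight_gaussian_le ht hμ hμ1 (a := fun _ => 1) (b := fun _ => 0)
          measurable_const measurable_const (fun _ => zero_le_one) (fun _ => le_rfl)
          hf.enorm).trans (le_of_eq ?_)
        simp

end VCHE
end


noncomputable section

namespace VCHE

/-! ### Time integrals -/

lemma lintegral_rpow_Ioo_le {b t : ℝ} (hb : b < 1) (ht : 0 < t) :
    ∫⁻ s in Ioo 0 t, ENNReal.ofReal (s ^ (-b)) ≤ ENNReal.ofReal (t ^ (1 - b) / (1 - b)) := by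
  have hint : IntegrableOn (fun s : ℝ => s ^ (-b)) (Ioo 0 t) :=
    (intervalIntegral.integrableOn_Ioo_rpow_iff ht).2 (by linarith)
  rw [← ofReal_integral_eq_lintegral_ofReal hint]
  · apply le_of_eq
    congr 1
    rw [← integral_Ioc_eq_integral_Ioo, ← intervalIntegral.integral_of_le ht.le,
      integral_rpow (.inl (by linarith)), Real.zero_rpow (by linarith)]
    ring_nf
  · refine (ae_restrict_mem measurableSet_Ioo).mono fun s hs => ?_
    have := hs.1
    simp only [Pi.zero_apply]
    positivity

lemma lintegral_sub_rpow_Ioo_le {a t : ℝ} (ha : a < 1) (ht : 0 < t) :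
    ∫⁻ s in Ioo 0 t, ENNReal.ofReal ((t - s) ^ (-a)) ≤ ENNReal.ofReal (t ^ (1 - a) / (1 - a)) := by
  refine le_trans (le_of_eq ?_) (lintegral_rpow_Ioo_le ha ht)
  rw [← lintegral_indicator measurableSet_Ioo, ← lintegral_indicator measurableSet_Ioo,
    ← lintegral_sub_left_eq_self _ t]
  refine lintegral_congr fun s => ?_
  by_cases h : s ∈ Ioo 0 t
  · rw [indicator_of_mem h, indicator_of_mem (show t - s ∈ Ioo 0 t from ⟨by linarith [h.2], by linarith [h.1]⟩)]
    simp
  · rw [indicator_of_notMem h, indicator_of_notMem]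
    intro h'
    exact h ⟨by linarith [h'.2], by linarith [h'.1]⟩

/-- Time integral of a function controlled by two products of powers, of which the first is
integrable at the final time and the second at the initial time. -/
lemma lintegral_time_le {a a' b e : ℝ} (ha : a < 1) (hb0 : 0 ≤ b) (hb : b < 1) (ha' : 0 ≤ a')
    (he : 0 ≤ e) (hsum : a + e = a' + b) :
    ∃ C : ℝ, 0 ≤ C ∧ ∀ t : ℝ, 0 < t → ∀ M : ℝ, 0 ≤ M → ∀ φ : ℝ → ℝ≥0∞,
      (∀ s ∈ Ioo 0 t, φ s ≤ ENNReal.ofReal (M * ((t - s) ^ (-a) * (1 + s) ^ (-e)))) →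
      (∀ s ∈ Ioo 0 t, φ s ≤ ENNReal.ofReal (M * ((t - s) ^ (-a') * (1 + s) ^ (-b)))) →
      ∫⁻ s in Ioo 0 t, φ s ≤ ENNReal.ofReal (M * C * (1 + t) ^ (1 - a - e)) := by
  have ha1 : 0 < 1 - a := by linarith
  have hb1 : 0 < 1 - b := by linarith
  refine ⟨2 ^ e / (1 - a) + 4 ^ a' / (1 - b), by positivity, fun t ht M hM φ h1 h2 => ?_⟩
  -- For t ≤ 1 all powers of 1 + t are comparable to one, and the first bound, integrable at s = t,
  -- suffices alone.
  rcases le_total t 1 with ht1 | ht1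
  · calc ∫⁻ s in Ioo 0 t, φ s ≤ ∫⁻ s in Ioo 0 t, ENNReal.ofReal M * ENNReal.ofReal ((t - s) ^ (-a)) := by
          refine setLIntegral_mono' measurableSet_Ioo fun s hs => (h1 s hs).trans ?_
          have hs0 := hs.1
          have hts : 0 < t - s := by linarith [hs.2]
          rw [← ENNReal.ofReal_mul hM]
          apply ENNReal.ofReal_le_ofReal
          have : (1 + s) ^ (-e) ≤ 1 := Real.rpow_le_one_of_one_le_of_nonpos (by linarith) (by linarith)
          gcongr
          exact mul_le_of_le_one_right (by positivity) this
      _ = ENNReal.ofReal M * ∫⁻ s in Ioo 0 t, ENNReal.ofReal ((t - s) ^ (-a)) :=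
          lintegral_const_mul' _ _ ENNReal.ofReal_ne_top
      _ ≤ ENNReal.ofReal M * ENNReal.ofReal (t ^ (1 - a) / (1 - a)) := by
          gcongr; exact lintegral_sub_rpow_Ioo_le ha ht
      _ ≤ _ := by
          rw [← ENNReal.ofReal_mul hM]
          apply ENNReal.ofReal_le_ofReal
          rw [mul_assoc]
          gcongr
          have h3 : t ^ (1 - a) ≤ 1 := Real.rpow_le_one ht.le ht1 ha1.le
          have h4 : 1 ≤ 2 ^ e * (1 + t) ^ (1 - a - e) := by
            calc (1 : ℝ) = 2 ^ e * 2 ^ (-e) := by rw [← Real.rpow_add two_pos]; simp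
              _ ≤ 2 ^ e * (1 + t) ^ (-e) := by
                have : (2 : ℝ) ^ (-e) ≤ (1 + t) ^ (-e) :=
                  Real.rpow_le_rpow_of_nonpos (by linarith) (by linarith) (by linarith)
                gcongr 2 ^ e * ?_
              _ ≤ _ := by
                gcongr
                · linarith
                · linarith
          have h5 : 0 ≤ 4 ^ a' / (1 - b) * (1 + t) ^ (1 - a - e) := by positivity
          calc t ^ (1 - a) / (1 - a) ≤ 1 / (1 - a) := by gcongr
            _ ≤ 2 ^ e * (1 + t) ^ (1 - a - e) / (1 - a) := by gcongr
            _ ≤ _ := by rw [add_mul, div_mul_eq_mul_div]; linarith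
  · have hT : 0 < 1 + t := by linarith
    have hcst : (t / 2) ^ (-a') ≤ 4 ^ a' * (1 + t) ^ (-a') := by
      calc (t / 2) ^ (-a') ≤ ((1 + t) / 4) ^ (-a') :=
            Real.rpow_le_rpow_of_nonpos (by positivity) (by linarith) (by linarith)
        _ = _ := by
          rw [Real.div_rpow hT.le (by norm_num), Real.rpow_neg (by norm_num : (0:ℝ) ≤ 4)]
          field_simp
    have hcst2 : ((1 + t) / 2) ^ (-e) = 2 ^ e * (1 + t) ^ (-e) := by
      rw [Real.div_rpow hT.le (by norm_num), Real.rpow_neg (by norm_num : (0:ℝ) ≤ 2)]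
      field_simp
    set c1 := M * (4 ^ a' * (1 + t) ^ (-a')) with hc1
    set c2 := M * (2 ^ e * (1 + t) ^ (-e)) with hc2
    have hc10 : 0 ≤ c1 := by positivity
    have hc20 : 0 ≤ c2 := by positivity
    calc ∫⁻ s in Ioo 0 t, φ s ≤ ∫⁻ s in Ioo 0 t, (ENNReal.ofReal c1 * ENNReal.ofReal (s ^ (-b))
          + ENNReal.ofReal c2 * ENNReal.ofReal ((t - s) ^ (-a))) := by
          refine setLIntegral_mono' measurableSet_Ioo fun s hs => ?_
          have hs0 := hs.1
          have hts : 0 < t - s := by linarith [hs.2]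
          rw [← ENNReal.ofReal_mul hc10, ← ENNReal.ofReal_mul hc20]
          -- On the first half of the interval t - s is comparable to 1 + t, and the second bound is
          -- integrated in s; on the second half 1 + s is comparable to 1 + t, and the first bound
          -- is integrated in t - s. The relation a + e = a' + b makes the two resulting powers
          -- agree.
          rcases le_total s (t / 2) with hst | hst
          · refine le_trans ((h2 s hs).trans ?_) le_self_add
            apply ENNReal.ofReal_le_ofReal
            rw [hc1, mul_assoc]
            have g1 : (t - s) ^ (-a') ≤ 4 ^ a' * (1 + t) ^ (-a') :=
              (Real.rpow_le_rpow_of_nonpos (by positivity) (by linarith) (by linarith)).trans hcst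
            have g2 : (1 + s) ^ (-b) ≤ s ^ (-b) :=
              Real.rpow_le_rpow_of_nonpos hs0 (by linarith) (by linarith)
            exact mul_le_mul_of_nonneg_left (mul_le_mul g1 g2 (by positivity) (by positivity)) hM
          · refine le_trans ((h1 s hs).trans ?_) le_add_self
            apply ENNReal.ofReal_le_ofReal
            rw [hc2, mul_assoc, mul_comm ((t - s) ^ (-a)), ← hcst2]
            gcongr M * (?_ * _)
            exact Real.rpow_le_rpow_of_nonpos (by positivity) (by linarith) (by linarith)
      _ = ENNReal.ofReal c1 * (∫⁻ s in Ioo 0 t, ENNReal.ofReal (s ^ (-b)))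
          + ENNReal.ofReal c2 * ∫⁻ s in Ioo 0 t, ENNReal.ofReal ((t - s) ^ (-a)) := by
          rw [lintegral_add_left (by fun_prop), lintegral_const_mul' _ _ ENNReal.ofReal_ne_top,
            lintegral_const_mul' _ _ ENNReal.ofReal_ne_top]
      _ ≤ ENNReal.ofReal c1 * ENNReal.ofReal (t ^ (1 - b) / (1 - b))
          + ENNReal.ofReal c2 * ENNReal.ofReal (t ^ (1 - a) / (1 - a)) := by
          gcongr
          · exact lintegral_rpow_Ioo_le hb ht
          · exact lintegral_sub_rpow_Ioo_le ha ht
      _ ≤ _ := by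
          rw [← ENNReal.ofReal_mul hc10, ← ENNReal.ofReal_mul hc20,
            ← ENNReal.ofReal_add (by positivity) (by positivity)]
          apply ENNReal.ofReal_le_ofReal
          have e1 : (1 + t) ^ (1 - a - e) = (1 + t) ^ (-a') * (1 + t) ^ (1 - b) := by
            rw [← Real.rpow_add hT]; congr 1; linarith
          have e2 : (1 + t) ^ (1 - a - e) = (1 + t) ^ (-e) * (1 + t) ^ (1 - a) := by
            rw [← Real.rpow_add hT]; congr 1; ring
          have b1 : t ^ (1 - b) ≤ (1 + t) ^ (1 - b) := by gcongr; linarith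
          have b2 : t ^ (1 - a) ≤ (1 + t) ^ (1 - a) := by gcongr; linarith
          calc c1 * (t ^ (1 - b) / (1 - b)) + c2 * (t ^ (1 - a) / (1 - a))
              ≤ c1 * ((1 + t) ^ (1 - b) / (1 - b)) + c2 * ((1 + t) ^ (1 - a) / (1 - a)) := by gcongr
            _ = M * (2 ^ e / (1 - a) * ((1 + t) ^ (-e) * (1 + t) ^ (1 - a))
                + 4 ^ a' / (1 - b) * ((1 + t) ^ (-a') * (1 + t) ^ (1 - b))) := by
                rw [hc1, hc2]; ring
            _ = _ := by rw [← e1, ← e2]; ring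

/-! ### The Duhamel term -/

/-- The Duhamel integral `∫₀ᵗ ∇Φ(t-s) * F(s) ds`. -/
def duhamel (F : ℝ → Plane → Plane) (t : ℝ) (x : Plane) : ℝ :=
  ∫ s in Ioo 0 t, convGrad (t - s) (F s) x

lemma stronglyMeasurable_convGrad {β : Type*} [MeasurableSpace β] {F : ℝ → Plane → Plane}
    (hF : Measurable (Function.uncurry F)) {f g : β → ℝ} {h : β → Plane} (hf : Measurable f)
    (hg : Measurable g) (hh : Measurable h) :
    StronglyMeasurable (fun p : β => convGrad (f p) (F (g p)) (h p)) := by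
  have hk := measurable_heatKernel_uncurry
  have h : Measurable (fun p : β × Plane =>
      (inner ℝ (gradient (heatKernel (f p.1)) (h p.1 - p.2)) (F (g p.1) p.2) : ℝ)) := by
    simp_rw [gradient_heatKernel]
    have h1 : Measurable (fun p : β × Plane => F (g p.1) p.2) :=
      hF.comp (by fun_prop : Measurable fun p : β × Plane => (g p.1, p.2))
    have h2 : Measurable (fun p : β × Plane => heatKernel (f p.1) (h p.1 - p.2)) :=
      hk.comp (by fun_prop : Measurable fun p : β × Plane => (f p.1, h p.1 - p.2))
    fun_prop
  exact h.stronglyMeasurable.integral_prod_right'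

lemma measurable_convGrad_slice {F : ℝ → Plane → Plane} (hF : Measurable (Function.uncurry F))
    (t : ℝ) : Measurable (fun q : Plane × ℝ => convGrad (t - q.2) (F q.2) q.1) :=
  (stronglyMeasurable_convGrad hF (measurable_const.sub measurable_snd) measurable_snd
    measurable_fst).measurable

lemma measurable_duhamel {F : ℝ → Plane → Plane} (hF : Measurable (Function.uncurry F)) :
    Measurable (fun q : ℝ × Plane => duhamel F q.1 q.2) := by
  have h : StronglyMeasurable (fun p : (ℝ × Plane) × ℝ =>
      {p : (ℝ × Plane) × ℝ | p.2 ∈ Ioo 0 p.1.1}.indicator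
        (fun p => convGrad (p.1.1 - p.2) (F p.2) p.1.2) p) := by
    refine (stronglyMeasurable_convGrad hF (measurable_fst.fst.sub measurable_snd) measurable_snd
      measurable_fst.snd).indicator ?_
    exact (measurableSet_lt measurable_const measurable_snd).inter
      (measurableSet_lt measurable_snd measurable_fst.fst)
  have e : (fun q : ℝ × Plane => duhamel F q.1 q.2) = fun q => ∫ s : ℝ,
      {p : (ℝ × Plane) × ℝ | p.2 ∈ Ioo 0 p.1.1}.indicator
        (fun p => convGrad (p.1.1 - p.2) (F p.2) p.1.2) (q, s) := by
    funext q
    rw [duhamel, ← integral_indicator measurableSet_Ioo]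
    rfl
  rw [e]
  exact (h.integral_prod_right' (ν := volume)).measurable

lemma enorm_duhamel_le (F : ℝ → Plane → Plane) (t : ℝ) (x : Plane) :
    ‖duhamel F t x‖ₑ ≤ ∫⁻ s in Ioo 0 t, ‖convGrad (t - s) (F s) x‖ₑ :=
  enorm_integral_le_lintegral_enorm _

lemma lintegral_weight_duhamel_le {F : ℝ → Plane → Plane} (hF : Measurable (Function.uncurry F))
    (t : ℝ) {w : Plane → ℝ≥0∞} (hw : Measurable w) :
    ∫⁻ x, w x * ‖duhamel F t x‖ₑ
      ≤ ∫⁻ s in Ioo 0 t, ∫⁻ x, w x * ‖convGrad (t - s) (F s) x‖ₑ := by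
  have hm := measurable_convGrad_slice hF t
  calc _ ≤ ∫⁻ x, ∫⁻ s in Ioo 0 t, w x * ‖convGrad (t - s) (F s) x‖ₑ := by
        refine lintegral_mono fun x => ?_
        have hms : Measurable fun s => ‖convGrad (t - s) (F s) x‖ₑ :=
          (hm.comp (measurable_prodMk_left (x := x))).enorm
        rw [lintegral_const_mul _ hms]
        gcongr
        exact enorm_duhamel_le F t x
    _ = _ := lintegral_lintegral_swap (Measurable.aemeasurable
        ((hw.comp measurable_fst).mul hm.enorm))

/-- Minkowski's integral inequality. It follows from the L¹ to L^p lemma for the kernel divided by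
c(s), whose sections then have norm at most one; the normalization needs c(s) to be neither zero nor
infinite. -/
lemma lintegral_duhamel_rpow_le {F : ℝ → Plane → Plane} (hF : Measurable (Function.uncurry F))
    {t p : ℝ} (hp : 1 ≤ p) {c : ℝ → ℝ≥0∞} (hc : Measurable c)
    (hc0 : ∀ s ∈ Ioo 0 t, c s ≠ 0 ∧ c s ≠ ∞)
    (hb : ∀ s ∈ Ioo 0 t, ∫⁻ x, ‖convGrad (t - s) (F s) x‖ₑ ^ p ≤ c s ^ p) :
    ∫⁻ x, ‖duhamel F t x‖ₑ ^ p ≤ (∫⁻ s in Ioo 0 t, c s) ^ p := by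
  have hp0 : 0 < p := by linarith
  have hm := measurable_convGrad_slice hF t
  have h := lintegral_rpow_lintegral_mul_le (μ := (volume : Measure Plane))
    (ν := volume.restrict (Ioo 0 t)) (K := fun x s => ‖convGrad (t - s) (F s) x‖ₑ * (c s)⁻¹)
    (hm.enorm.mul (hc.comp measurable_snd).inv) hc.aemeasurable hp (B := 1) ?_
  · rw [one_mul] at h
    refine le_trans (lintegral_mono fun x => ?_) h
    refine ENNReal.rpow_le_rpow ((enorm_duhamel_le F t x).trans (le_of_eq ?_)) hp0.le
    refine setLIntegral_congr_fun measurableSet_Ioo fun s hs => ?_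
    rw [mul_assoc, ENNReal.inv_mul_cancel (hc0 s hs).1 (hc0 s hs).2, mul_one]
  · refine (ae_restrict_mem measurableSet_Ioo).mono fun s hs => ?_
    have hms : Measurable fun x => ‖convGrad (t - s) (F s) x‖ₑ ^ p :=
      ((hm.comp measurable_prodMk_right).enorm).pow_const p
    calc ∫⁻ x, (‖convGrad (t - s) (F s) x‖ₑ * (c s)⁻¹) ^ p
        = (∫⁻ x, ‖convGrad (t - s) (F s) x‖ₑ ^ p) * ((c s)⁻¹) ^ p := by
          simp_rw [ENNReal.mul_rpow_of_nonneg _ _ hp0.le]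
          rw [lintegral_mul_const _ hms]
      _ ≤ c s ^ p * ((c s)⁻¹) ^ p := by gcongr; exact hb s hs
      _ = 1 := by
          rw [← ENNReal.mul_rpow_of_nonneg _ _ hp0.le, ENNReal.mul_inv_cancel (hc0 s hs).1 (hc0 s hs).2,
            ENNReal.one_rpow]

/-- The singularity (t-s)^{-1/2} is integrable in time, so for almost every x the Duhamel integral
converges absolutely. This is what makes it additive in the flux. -/
lemma ae_integrable_convGrad {F : ℝ → Plane → Plane} (hF : Measurable (Function.uncurry F))
    {t : ℝ} (ht : 0 < t) {M : ℝ≥0∞} (hM : M ≠ ∞) (hb : ∀ s ∈ Ioo 0 t, ∫⁻ y, ‖F s y‖ₑ ≤ M) :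
    ∀ᵐ x, IntegrableOn (fun s => convGrad (t - s) (F s) x) (Ioo 0 t) := by
  have hm := measurable_convGrad_slice hF t
  have hmF : ∀ s, Measurable (F s) := fun s => hF.comp measurable_prodMk_left
  have hfin : ∫⁻ x, ∫⁻ s in Ioo 0 t, ‖convGrad (t - s) (F s) x‖ₑ < ∞ := by
    rw [lintegral_lintegral_swap hm.enorm.aemeasurable]
    calc _ ≤ ∫⁻ s in Ioo 0 t, ENNReal.ofReal 4128 * ENNReal.ofReal ((t - s) ^ (-(1 / 2) : ℝ)) * M := by
          refine setLIntegral_mono' measurableSet_Ioo fun s hs => ?_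
          have hts : 0 < t - s := by linarith [hs.2]
          rw [← ENNReal.ofReal_mul (by norm_num)]
          refine (lintegral_convGrad_le hts (hmF s).aestronglyMeasurable).trans ?_
          gcongr
          exact hb s hs
      _ = ENNReal.ofReal 4128 * (∫⁻ s in Ioo 0 t, ENNReal.ofReal ((t - s) ^ (-(1 / 2) : ℝ))) * M := by
          rw [lintegral_mul_const' _ _ hM, lintegral_const_mul' _ _ ENNReal.ofReal_ne_top]
      _ < ∞ := by
          refine ENNReal.mul_lt_top (ENNReal.mul_lt_top ENNReal.ofReal_lt_top ?_) hM.lt_top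
          exact (lintegral_sub_rpow_Ioo_le (by norm_num) ht).trans_lt ENNReal.ofReal_lt_top
  filter_upwards [ae_lt_top hm.enorm.lintegral_prod_right' hfin.ne] with x hx
  exact ⟨(hm.comp measurable_prodMk_left).aestronglyMeasurable, hx⟩

lemma duhamel_sub_ae {F G : ℝ → Plane → Plane} (hF : Measurable (Function.uncurry F))
    (hG : Measurable (Function.uncurry G)) {t : ℝ} (ht : 0 < t) {M : ℝ≥0∞} (hM : M ≠ ∞)
    (hFb : ∀ s ∈ Ioo 0 t, ∫⁻ y, ‖F s y‖ₑ ≤ M) (hGb : ∀ s ∈ Ioo 0 t, ∫⁻ y, ‖G s y‖ₑ ≤ M) :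
    ∀ᵐ x, duhamel F t x - duhamel G t x = duhamel (fun s y => F s y - G s y) t x := by
  filter_upwards [ae_integrable_convGrad hF ht hM hFb, ae_integrable_convGrad hG ht hM hGb]
    with x hx hx'
  rw [duhamel, duhamel, duhamel, ← integral_sub hx hx']
  refine setIntegral_congr_fun measurableSet_Ioo fun s hs => ?_
  have hts : 0 < t - s := by linarith [hs.2]
  have iF : Integrable (F s) := ⟨(hF.comp measurable_prodMk_left).aestronglyMeasurable,
    (hFb s hs).trans_lt hM.lt_top⟩
  have iG : Integrable (G s) := ⟨(hG.comp measurable_prodMk_left).aestronglyMeasurable,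
    (hGb s hs).trans_lt hM.lt_top⟩
  exact (convGrad_sub hts iF iG x).symm

end VCHE
end


noncomputable section

namespace VCHE

/-! ### Bounds for the flux -/

/-- `K` bounds the velocity kernel, uniformly and in the mean against Gaussians. -/
structure VelBound (α K : ℝ) : Prop where
  one_le : 1 ≤ K
  sup : ∀ x, velMajorant α x ≤ ENNReal.ofReal K
  gauss : ∀ τ : ℝ, 0 < τ → ∀ z : Plane,
    ∫⁻ x, velMajorant α (x - z) * ENNReal.ofReal (heatKernel τ x)
      ≤ ENNReal.ofReal (K * τ ^ (-(1 / 2) : ℝ))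
  gauss_rpow : ∀ τ : ℝ, 0 < τ → ∀ z : Plane,
    ∫⁻ x, velMajorant α (x - z) ^ (4 / 3 : ℝ) * ENNReal.ofReal (heatKernel τ x)
      ≤ ENNReal.ofReal (K * τ ^ (-(2 / 3) : ℝ))

lemma exists_velBound {α : ℝ} (hα : 0 < α) : ∃ K, VelBound α K := by
  obtain ⟨C, hC, h⟩ := lintegral_velMajorant_rpow_mul_heatKernel_le le_rfl one_lt_two
  obtain ⟨C', hC', h'⟩ := lintegral_velMajorant_rpow_mul_heatKernel_le
    (by norm_num : (1 : ℝ) ≤ 4 / 3) (by norm_num)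
  have hs := ENNReal.toReal_nonneg (a := velSup α)
  refine ⟨1 + (velSup α).toReal + C + C', by linarith, fun x => ?_, fun τ hτ z => ?_,
    fun τ hτ z => ?_⟩
  · refine (velMajorant_le α x).trans ?_
    rw [← ENNReal.ofReal_toReal (velSup_lt_top hα).ne]
    exact ENNReal.ofReal_le_ofReal (by simp; linarith)
  · have := h α hα τ hτ z
    simp only [ENNReal.rpow_one] at this
    refine this.trans (ENNReal.ofReal_le_ofReal ?_)
    gcongr
    linarith
  · refine (h' α hα τ hτ z).trans (ENNReal.ofReal_le_ofReal ?_)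
    rw [show -((4 / 3 : ℝ) / 2) = -(2 / 3) by norm_num]
    gcongr
    linarith

variable {α K : ℝ}

/-- In contrast to the uniform bound on the kernel, the Gaussian averages give a velocity that
decays as the vorticity spreads. -/
lemma enorm_velocity_le_of_gaussian (hK : VelBound α K) {g : Plane → ℝ} {m τ : ℝ}
    (hm : 0 ≤ m) (hτ : 0 < τ) (hg : ∀ x, ‖g x‖ₑ ≤ ENNReal.ofReal (m * heatKernel τ x)) (x : Plane) :
    ‖velocity α g x‖ₑ ≤ ENNReal.ofReal (m * K * τ ^ (-(1 / 2) : ℝ)) := by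
  calc ‖velocity α g x‖ₑ ≤ ∫⁻ z, ENNReal.ofReal m *
        (velMajorant α (z - x) * ENNReal.ofReal (heatKernel τ z)) := by
        refine (enorm_velocity_le α g x).trans (lintegral_mono fun z => ?_)
        rw [← neg_sub z x, velMajorant_neg, mul_left_comm, ← ENNReal.ofReal_mul hm, mul_comm]
        gcongr
        exact hg z
    _ ≤ _ := by
        rw [lintegral_const_mul' _ _ ENNReal.ofReal_ne_top, mul_assoc, ENNReal.ofReal_mul hm]
        gcongr
        exact hK.gauss τ hτ x

lemma enorm_velocity_le_of_sup (hK : VelBound α K) (f : Plane → ℝ) (x : Plane) :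
    ‖velocity α f x‖ₑ ≤ ENNReal.ofReal K * ∫⁻ z, ‖f z‖ₑ := by
  refine (enorm_velocity_le α f x).trans ?_
  rw [← lintegral_const_mul' _ _ ENNReal.ofReal_ne_top]
  refine lintegral_mono fun z => ?_
  rw [mul_comm]
  gcongr
  exact hK.sup _

lemma lintegral_weight_flux_le {f g : Plane → ℝ} {V : ℝ} (hf : ∀ x, ‖velocity α f x‖ₑ ≤ ENNReal.ofReal V)
    (w : Plane → ℝ≥0∞) :
    ∫⁻ x, w x * ‖flux α f g x‖ₑ ≤ ENNReal.ofReal V * ∫⁻ x, w x * ‖g x‖ₑ := by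
  rw [← lintegral_const_mul' _ _ ENNReal.ofReal_ne_top]
  refine lintegral_mono fun x => ?_
  rw [flux, enorm_smul, ← mul_assoc, mul_comm (ENNReal.ofReal V)]
  gcongr
  exact hf x

/-- Tonelli's theorem lets the Gaussian vorticity g average the velocity kernel, so the decay
τ^{-1/2} is obtained although q is known only in L¹. -/
lemma lintegral_weight_flux_le_of_gaussian (hα : 0 < α) (hK : VelBound α K) {q g : Plane → ℝ}
    (hq : Measurable q) {w : Plane → ℝ≥0∞} {m τ : ℝ} (hm : 0 ≤ m) (hτ : 0 < τ)
    (hg : ∀ x, w x * ‖g x‖ₑ ≤ ENNReal.ofReal (m * heatKernel τ x)) :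
    ∫⁻ x, w x * ‖flux α q g x‖ₑ ≤ ENNReal.ofReal (m * K * τ ^ (-(1 / 2) : ℝ)) * ∫⁻ x, ‖q x‖ₑ := by
  have hk := measurable_velMajorant hα
  have hh := (continuous_heatKernel τ).measurable
  calc ∫⁻ x, w x * ‖flux α q g x‖ₑ
      ≤ ∫⁻ x, ∫⁻ z, ‖q z‖ₑ * (ENNReal.ofReal m *
          (velMajorant α (x - z) * ENNReal.ofReal (heatKernel τ x))) := by
        refine lintegral_mono fun x => ?_
        rw [flux, enorm_smul, ← mul_assoc]
        calc w x * ‖g x‖ₑ * ‖velocity α q x‖ₑ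
            ≤ ENNReal.ofReal (m * heatKernel τ x) * ∫⁻ z, ‖q z‖ₑ * velMajorant α (x - z) :=
              mul_le_mul' (hg x) (enorm_velocity_le α q x)
          _ = _ := by
              rw [← lintegral_const_mul' _ _ ENNReal.ofReal_ne_top]
              refine lintegral_congr fun z => ?_
              rw [ENNReal.ofReal_mul hm]; ring
    _ = ∫⁻ z, ∫⁻ x, ‖q z‖ₑ * (ENNReal.ofReal m *
          (velMajorant α (x - z) * ENNReal.ofReal (heatKernel τ x))) := by
        refine lintegral_lintegral_swap (Measurable.aemeasurable ?_)
        have : Measurable fun p : Plane × Plane => velMajorant α (p.1 - p.2) :=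
          hk.comp (measurable_fst.sub measurable_snd)
        simp only [Function.uncurry_def]
        fun_prop
    _ ≤ ∫⁻ z, ENNReal.ofReal (m * K * τ ^ (-(1 / 2) : ℝ)) * ‖q z‖ₑ := by
        refine lintegral_mono fun z => ?_
        rw [lintegral_const_mul' _ _ enorm_ne_top, lintegral_const_mul' _ _ ENNReal.ofReal_ne_top,
          mul_comm, mul_assoc m, ENNReal.ofReal_mul hm]
        gcongr
        exact hK.gauss τ hτ z
    _ = _ := lintegral_const_mul' _ _ ENNReal.ofReal_ne_top

/-- Size of a remainder at the time scale `S`. -/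
structure RemBound (μ S N : ℝ) (q : Plane → ℝ) : Prop where
  mass : ∫⁻ x, ‖q x‖ₑ ≤ ENNReal.ofReal (N * S ^ (-μ))
  moment : ∫⁻ x, ENNReal.ofReal (‖x‖ ^ μ) * ‖q x‖ₑ ≤ ENNReal.ofReal (N * S ^ (-(μ / 2)))

/-- Size of a flux at the time scale `S`. -/
structure FluxBound (μ S M : ℝ) (F : Plane → Plane) : Prop where
  mass : ∫⁻ x, ‖F x‖ₑ ≤ ENNReal.ofReal (M * S ^ (-(1 / 2) - μ))
  moment : ∫⁻ x, ENNReal.ofReal (‖x‖ ^ μ) * ‖F x‖ₑ ≤ ENNReal.ofReal (M * S ^ (-((1 + μ) / 2)))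

/-- `|g|` is at most `m` times the Gaussian of variance `4S`. -/
def GaussBound (S m : ℝ) (g : Plane → ℝ) : Prop := ∀ x, |g x| ≤ m * heatKernel (4 * S) x

variable {μ S : ℝ}

lemma FluxBound.mono {M M' : ℝ} {F : Plane → Plane} (hS : 0 ≤ S) (h : FluxBound μ S M F) (hM : M ≤ M') :
    FluxBound μ S M' F :=
  ⟨h.mass.trans (by gcongr), h.moment.trans (by gcongr)⟩

lemma RemBound.mono {M M' : ℝ} {F : Plane → ℝ} (hS : 0 ≤ S) (h : RemBound μ S M F) (hM : M ≤ M') :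
    RemBound μ S M' F :=
  ⟨h.mass.trans (by gcongr), h.moment.trans (by gcongr)⟩

lemma FluxBound.of_enorm_le {M M' : ℝ} {F G H : Plane → Plane} (hS : 0 ≤ S) (hM : 0 ≤ M)
    (hM' : 0 ≤ M') (hGm : AEMeasurable G)
    (hG : FluxBound μ S M G) (hH : FluxBound μ S M' H) (h : ∀ x, ‖F x‖ₑ ≤ ‖G x‖ₑ + ‖H x‖ₑ) :
    FluxBound μ S (M + M') F := by
  constructor
  · calc _ ≤ ∫⁻ x, (‖G x‖ₑ + ‖H x‖ₑ) := lintegral_mono h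
      _ ≤ _ := by
        rw [lintegral_add_left' hGm.enorm, add_mul, ENNReal.ofReal_add (by positivity) (by positivity)]
        exact add_le_add hG.mass hH.mass
  · calc _ ≤ ∫⁻ x, (ENNReal.ofReal (‖x‖ ^ μ) * ‖G x‖ₑ + ENNReal.ofReal (‖x‖ ^ μ) * ‖H x‖ₑ) := by
          refine lintegral_mono fun x => ?_
          rw [← mul_add]
          gcongr
          exact h x
      _ ≤ _ := by
        rw [lintegral_add_left' (by fun_prop), add_mul,
          ENNReal.ofReal_add (by positivity) (by positivity)]
        exact add_le_add hG.moment hH.moment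

lemma RemBound.of_enorm_le {M M' : ℝ} {F G H : Plane → ℝ} (hS : 0 ≤ S) (hM : 0 ≤ M)
    (hM' : 0 ≤ M') (hGm : AEMeasurable G)
    (hG : RemBound μ S M G) (hH : RemBound μ S M' H) (h : ∀ᵐ x, ‖F x‖ₑ ≤ ‖G x‖ₑ + ‖H x‖ₑ) :
    RemBound μ S (M + M') F := by
  constructor
  · calc _ ≤ ∫⁻ x, (‖G x‖ₑ + ‖H x‖ₑ) := lintegral_mono_ae h
      _ ≤ _ := by
        rw [lintegral_add_left' hGm.enorm, add_mul, ENNReal.ofReal_add (by positivity) (by positivity)]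
        exact add_le_add hG.mass hH.mass
  · calc _ ≤ ∫⁻ x, (ENNReal.ofReal (‖x‖ ^ μ) * ‖G x‖ₑ + ENNReal.ofReal (‖x‖ ^ μ) * ‖H x‖ₑ) := by
          refine lintegral_mono_ae (h.mono fun x hx => ?_)
          rw [← mul_add]
          gcongr
      _ ≤ _ := by
        rw [lintegral_add_left' (by fun_prop), add_mul,
          ENNReal.ofReal_add (by positivity) (by positivity)]
        exact add_le_add hG.moment hH.moment

lemma GaussBound.enorm_le {m : ℝ} {g : Plane → ℝ} (h : GaussBound S m g) (x : Plane) :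
    ‖g x‖ₑ ≤ ENNReal.ofReal (m * heatKernel (4 * S) x) := by
  rw [← ofReal_norm, Real.norm_eq_abs]
  exact ENNReal.ofReal_le_ofReal (h x)

lemma GaussBound.weight_le {m : ℝ} (hm : 0 ≤ m) {g : Plane → ℝ} (h : GaussBound S m g) (hS : 0 < S)
    (hμ : 0 ≤ μ) (hμ1 : μ ≤ 1) (x : Plane) :
    ENNReal.ofReal (‖x‖ ^ μ) * ‖g x‖ₑ
      ≤ ENNReal.ofReal (m * (4128 * S ^ (μ / 2)) * heatKernel (2 * (4 * S)) x) := by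
  rw [← ofReal_norm, Real.norm_eq_abs, ← ENNReal.ofReal_mul (by positivity)]
  apply ENNReal.ofReal_le_ofReal
  have h4 : (4 : ℝ) ^ (μ / 2) ≤ 2 := by
    rw [show (4 : ℝ) = 2 ^ (2 : ℝ) by norm_num, ← Real.rpow_mul (by norm_num)]
    calc (2 : ℝ) ^ (2 * (μ / 2)) ≤ 2 ^ (1 : ℝ) :=
          Real.rpow_le_rpow_of_exponent_le (by norm_num) (by linarith)
      _ = 2 := Real.rpow_one 2
  have hk := heatKernel_nonneg (by positivity : 0 ≤ 2 * (4 * S)) x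
  calc ‖x‖ ^ μ * |g x| ≤ ‖x‖ ^ μ * (m * heatKernel (4 * S) x) := by gcongr; exact h x
    _ = m * (‖x‖ ^ μ * heatKernel (4 * S) x) := by ring
    _ ≤ m * (2064 * (4 * S) ^ (μ / 2) * heatKernel (2 * (4 * S)) x) := by
        gcongr m * ?_
        exact rpow_norm_mul_heatKernel_le (by linarith : 0 < 4 * S) hμ (by linarith) x
    _ ≤ m * (2064 * (2 * S ^ (μ / 2)) * heatKernel (2 * (4 * S)) x) := by
        rw [Real.mul_rpow (by norm_num) hS.le]
        gcongr
    _ = _ := by ring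

lemma rpow_neg_half_le {c : ℝ} (hc : 1 ≤ c) (hS : 0 < S) :
    (c * S) ^ (-(1 / 2) : ℝ) ≤ S ^ (-(1 / 2) : ℝ) :=
  Real.rpow_le_rpow_of_nonpos hS (by nlinarith) (by norm_num)

/-- The Gaussian average of the kernel gives S^{-1/2} and the mass of the remainder S^{-μ}. The
weight, carried by the Gaussian factor, costs S^{μ/2}. -/
lemma fluxBound_of_gaussian_right (hα : 0 < α) (hK : VelBound α K) (hμ : 0 ≤ μ) (hμ1 : μ ≤ 1)
    (hS : 0 < S) {q g : Plane → ℝ} {m N : ℝ} (hm : 0 ≤ m) (hN : 0 ≤ N) (hqm : Measurable q)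
    (hq : RemBound μ S N q) (hg : GaussBound S m g) :
    FluxBound μ S (4128 * K * (m * N)) (flux α q g) := by
  have hK0 : 0 ≤ K := by linarith [hK.one_le]
  constructor
  · have h := lintegral_weight_flux_le_of_gaussian hα hK hqm hm (by positivity : 0 < 4 * S)
      (w := fun _ => 1) (g := g) (fun x => by rw [one_mul]; exact hg.enorm_le x)
    simp only [one_mul] at h
    refine h.trans ((mul_le_mul_right hq.mass _).trans ?_)
    rw [← ENNReal.ofReal_mul (by positivity)]
    apply ENNReal.ofReal_le_ofReal
    calc m * K * (4 * S) ^ (-(1 / 2) : ℝ) * (N * S ^ (-μ))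
        ≤ m * K * S ^ (-(1 / 2) : ℝ) * (N * S ^ (-μ)) := by
          gcongr ?_ * ?_ * _
          exact rpow_neg_half_le (c := 4) (by norm_num) hS
      _ = 1 * K * (m * N) * S ^ (-(1 / 2) - μ : ℝ) := by
          rw [sub_eq_add_neg, Real.rpow_add hS]; ring
      _ ≤ _ := by gcongr; norm_num
  · have h := lintegral_weight_flux_le_of_gaussian hα hK hqm (by positivity)
      (by positivity : 0 < 2 * (4 * S)) (w := fun x => ENNReal.ofReal (‖x‖ ^ μ)) (g := g)
      (hg.weight_le hm hS hμ hμ1)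
    refine h.trans ((mul_le_mul_right hq.mass _).trans ?_)
    rw [← ENNReal.ofReal_mul (by positivity)]
    apply ENNReal.ofReal_le_ofReal
    calc m * (4128 * S ^ (μ / 2)) * K * (2 * (4 * S)) ^ (-(1 / 2) : ℝ) * (N * S ^ (-μ))
        ≤ m * (4128 * S ^ (μ / 2)) * K * S ^ (-(1 / 2) : ℝ) * (N * S ^ (-μ)) := by
          gcongr ?_ * ?_ * _
          rw [← mul_assoc]
          exact rpow_neg_half_le (by norm_num) hS
      _ = _ := by
          rw [show -((1 + μ) / 2) = μ / 2 + (-(1 / 2) + -μ) by ring, Real.rpow_add hS,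
            Real.rpow_add hS]
          ring

lemma fluxBound_of_velocity_le {f q : Plane → ℝ} {V N M : ℝ} (hV : 0 ≤ V) 
    (hf : ∀ x, ‖velocity α f x‖ₑ ≤ ENNReal.ofReal V) (hq : RemBound μ S N q) (hS : 0 < S)
    (hM : V * N ≤ M * S ^ (-(1 / 2) : ℝ)) :
    FluxBound μ S M (flux α f q) := by
  constructor
  · have h := lintegral_weight_flux_le hf (g := q) fun _ => 1
    simp only [one_mul] at h
    refine h.trans ((mul_le_mul_right hq.mass _).trans ?_)
    rw [← ENNReal.ofReal_mul hV]
    apply ENNReal.ofReal_le_ofReal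
    rw [← mul_assoc, sub_eq_add_neg, Real.rpow_add hS, ← mul_assoc]
    gcongr
  · refine (lintegral_weight_flux_le hf _).trans ((mul_le_mul_right hq.moment _).trans ?_)
    rw [← ENNReal.ofReal_mul hV]
    apply ENNReal.ofReal_le_ofReal
    rw [← mul_assoc, show -((1 + μ) / 2) = -(1 / 2) + -(μ / 2) by ring, Real.rpow_add hS, ← mul_assoc]
    gcongr

lemma fluxBound_of_gaussian_left (hK : VelBound α K) (hS : 0 < S) {q g : Plane → ℝ} {m N : ℝ}
    (hm : 0 ≤ m) (hN : 0 ≤ N) (hq : RemBound μ S N q) (hg : GaussBound S m g) :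
    FluxBound μ S (4128 * K * (m * N)) (flux α g q) := by
  have hK0 : 0 ≤ K := by linarith [hK.one_le]
  refine fluxBound_of_velocity_le (by positivity)
    (enorm_velocity_le_of_gaussian hK hm (by positivity : 0 < 4 * S) hg.enorm_le) hq hS ?_
  calc m * K * (4 * S) ^ (-(1 / 2) : ℝ) * N ≤ m * K * S ^ (-(1 / 2) : ℝ) * N := by
        gcongr ?_ * ?_ * _
        exact rpow_neg_half_le (c := 4) (by norm_num) hS
    _ = 1 * K * (m * N) * S ^ (-(1 / 2) : ℝ) := by ring
    _ ≤ _ := by gcongr; norm_num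

/-- Only the boundedness of the kernel is available: the velocity is of order S^{-μ}, and S^{-μ} ≤
S^{-1/2} because μ ≥ 1/2 and S ≥ 1. -/
lemma fluxBound_of_remBound (hK : VelBound α K) (hμ : 1 / 2 ≤ μ) (hS : 1 ≤ S) {q q' : Plane → ℝ}
    {N N' : ℝ} (hN : 0 ≤ N) (hN' : 0 ≤ N') (hq : RemBound μ S N q) (hq' : RemBound μ S N' q') :
    FluxBound μ S (4128 * K * (N * N')) (flux α q q') := by
  have hK0 : 0 ≤ K := by linarith [hK.one_le]
  have hS0 : 0 < S := by linarith
  refine fluxBound_of_velocity_le (V := K * (N * S ^ (-μ))) (by positivity) (fun x => ?_) hq' hS0 ?_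
  · refine (enorm_velocity_le_of_sup hK q x).trans ?_
    rw [ENNReal.ofReal_mul hK0]
    gcongr
    exact hq.mass
  · calc K * (N * S ^ (-μ)) * N' = 1 * K * (N * N') * S ^ (-μ) := by ring
      _ ≤ 4128 * K * (N * N') * S ^ (-(1 / 2) : ℝ) := by
        gcongr
        norm_num

end VCHE
end


/-! ### The Duhamel integral of a mean-free flux -/

noncomputable section

namespace VCHE

variable {μ S : ℝ}

lemma FluxBound.integrable {M : ℝ} {F : Plane → Plane} (h : FluxBound μ S M F) (hF : Measurable F) :
    Integrable F :=
  ⟨hF.aestronglyMeasurable, h.mass.trans_lt ENNReal.ofReal_lt_top⟩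

lemma RemBound.integrable {M : ℝ} {q : Plane → ℝ} (h : RemBound μ S M q) (hq : Measurable q) :
    Integrable q :=
  ⟨hq.aestronglyMeasurable, h.mass.trans_lt ENNReal.ofReal_lt_top⟩

/-- The Duhamel term of a mean-free flux is a remainder. -/
lemma exists_remBound_duhamel (hμ : 0 < μ) (hμ1 : μ < 1) :
    ∃ C : ℝ, 0 ≤ C ∧ ∀ F : ℝ → Plane → Plane, Measurable (Function.uncurry F) → ∀ M : ℝ, 0 ≤ M →
      (∀ s, 0 < s → FluxBound μ (1 + s) M (F s)) → (∀ s, 0 < s → ∫ y, F s y = 0) →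
      ∀ t, 0 < t → RemBound μ (1 + t) (C * M) (duhamel F t) := by
  -- For the mass, zero mean and the |x|^μ moment give the kernel power (1+μ)/2, equal to the decay
  -- rate of the flux moment. One bound serves at both ends of the time interval, and it is
  -- integrable at both because μ < 1.
  obtain ⟨C₁, hC₁, h₁⟩ := lintegral_time_le (a := (1 + μ) / 2) (a' := (1 + μ) / 2) (b := (1 + μ) / 2)
    (e := (1 + μ) / 2) (by linarith) (by linarith) (by linarith) (by linarith) (by linarith) rfl
  obtain ⟨C₂, hC₂, h₂⟩ := lintegral_time_le (a := 1 / 2) (a' := 1 / 2) (b := (1 + μ) / 2)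
    (e := (1 + μ) / 2) (by linarith) (by linarith) (by linarith) (by linarith) (by linarith) rfl
  refine ⟨8256 * C₁ + 5 * 2064 * 4128 * C₂, by positivity, fun F hF M hM hFb hF0 t ht => ⟨?_, ?_⟩⟩
  · have hw := lintegral_weight_duhamel_le hF t (w := fun _ => 1) measurable_const
    simp only [one_mul] at hw
    have hb : ∀ s ∈ Ioo 0 t, ∫⁻ x, ‖convGrad (t - s) (F s) x‖ₑ
        ≤ ENNReal.ofReal (8256 * M * ((t - s) ^ (-((1 + μ) / 2)) * (1 + s) ^ (-((1 + μ) / 2)))) := by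
      intro s hs
      have hts : 0 < t - s := by linarith [hs.2]
      have hF' := hFb s hs.1
      have h := lintegral_convGrad_rpow_le_of_mean_zero hts hμ.le hμ1.le le_rfl
        (hF'.integrable (hF.comp measurable_prodMk_left)) (hF0 s hs.1)
      simp only [ENNReal.rpow_one] at h
      refine h.trans ((mul_le_mul_right hF'.moment _).trans ?_)
      rw [← ENNReal.ofReal_mul (by positivity)]
      apply le_of_eq
      congr 1
      rw [show -(1 / 2) - μ / 2 + (1 / 1 - 1) = -((1 + μ) / 2) by ring]
      ring
    refine hw.trans ((h₁ t ht _ (by positivity) _ hb hb).trans (ENNReal.ofReal_le_ofReal ?_))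
    rw [show 1 - (1 + μ) / 2 - (1 + μ) / 2 = -μ by ring]
    have : 0 ≤ 1 + t := by linarith
    refine mul_le_mul_of_nonneg_right ?_ (by positivity)
    linarith [mul_nonneg hC₂ hM]
  · refine (lintegral_weight_duhamel_le hF t (w := fun x => ENNReal.ofReal (‖x‖ ^ μ))
      (by fun_prop)).trans ?_
    have hb : ∀ s ∈ Ioo 0 t, ∫⁻ x, ENNReal.ofReal (‖x‖ ^ μ) * ‖convGrad (t - s) (F s) x‖ₑ
        ≤ ENNReal.ofReal (5 * 2064 * 4128 * M * ((t - s) ^ (-(1 / 2) : ℝ) * (1 + s) ^ (-((1 + μ) / 2)))) := by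
      intro s hs
      have hts : 0 < t - s := by linarith [hs.2]
      have hF' := hFb s hs.1
      refine (lintegral_weight_convGrad_le hts hμ hμ1.le
        (hF'.integrable (hF.comp measurable_prodMk_left)) (hF0 s hs.1)).trans
        ((mul_le_mul_right hF'.moment _).trans ?_)
      rw [← ENNReal.ofReal_mul (by positivity)]
      apply le_of_eq
      congr 1
      ring
    refine (h₂ t ht _ (by positivity) _ hb hb).trans (ENNReal.ofReal_le_ofReal ?_)
    rw [show 1 - 1 / 2 - (1 + μ) / 2 = -(μ / 2) by ring]
    have : 0 ≤ 1 + t := by linarith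
    refine mul_le_mul_of_nonneg_right ?_ (by positivity)
    linarith [mul_nonneg hC₁ hM]

/-! ### A pair of vortices -/

/-- A pair of Oseen vortices, centred at `0` and at `-e`. -/
def vortexPair (c₀ c₁ : ℝ) (e : Plane) (t : ℝ) (x : Plane) : ℝ :=
  c₀ * heatKernel (1 + t) x + c₁ * heatKernel (1 + t) (x + e)

lemma heatKernel_le_of_two_mul {τ : ℝ} (hτ : 0 < τ) (x : Plane) :
    heatKernel τ x ≤ 2 * heatKernel (2 * τ) x := by
  rw [heatKernel_eq_two_mul hτ]
  have := heatKernel_nonneg (by positivity : 0 ≤ 2 * τ) x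
  exact mul_le_of_le_one_right (by positivity) (Real.exp_le_one_iff.2 (neg_nonpos.2 (by positivity)))

lemma gaussBound_vortexPair {c₀ c₁ r t : ℝ} {e : Plane} (h₀ : |c₀| ≤ r) (h₁ : |c₁| ≤ r)
    (he : ‖e‖ ≤ 1) (ht : 0 ≤ t) : GaussBound (1 + t) (12 * r) (vortexPair c₀ c₁ e t) := by
  intro x
  have hT : 0 < 1 + t := by linarith
  have hr : 0 ≤ r := (abs_nonneg _).trans h₀
  have k1 := heatKernel_nonneg hT.le x
  have k2 := heatKernel_nonneg hT.le (x + e)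
  have g1 := heatKernel_le_of_two_mul hT x
  have g2 := heatKernel_le_of_two_mul (by positivity : 0 < 2 * (1 + t)) x
  have g3 := heatKernel_add_le hT (e := e) (by nlinarith [norm_nonneg e]) x
  rw [show 2 * (2 * (1 + t)) = 4 * (1 + t) by ring] at g2
  calc |vortexPair c₀ c₁ e t x| ≤ |c₀| * heatKernel (1 + t) x + |c₁| * heatKernel (1 + t) (x + e) := by
        refine (abs_add_le _ _).trans (le_of_eq ?_)
        rw [abs_mul, abs_mul, abs_of_nonneg k1, abs_of_nonneg k2]
    _ ≤ r * (4 * heatKernel (4 * (1 + t)) x) + r * (8 * heatKernel (4 * (1 + t)) x) := by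
        gcongr ?_ * ?_ + ?_ * ?_ <;> linarith
    _ = _ := by ring

/-- A first-order increment over a distance |e| ≤ 1 ≤ √(1+t) gains (1+t)^{-1/2} over a single
vortex. The constant is 2064·(4 + 2), from the shifted and the centred Gaussian. -/
lemma gaussBound_vortexDiff {t : ℝ} {e : Plane} (he : ‖e‖ ≤ 1) (ht : 0 ≤ t) :
    GaussBound (1 + t) (12384 * (1 + t) ^ (-(1 / 2) : ℝ))
      (fun x => heatKernel (1 + t) (x + e) - heatKernel (1 + t) x) := by
  intro x
  have hT : 0 < 1 + t := by linarith
  have hsq : 1 ≤ √(1 + t) := Real.one_le_sqrt.2 (by linarith)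
  have g2 := heatKernel_le_of_two_mul (by positivity : 0 < 2 * (1 + t)) x
  have g3 := heatKernel_add_le (by positivity : 0 < 2 * (1 + t)) (e := e)
    (by nlinarith [norm_nonneg e]) x
  rw [show 2 * (2 * (1 + t)) = 4 * (1 + t) by ring] at g2 g3
  have h := abs_heatKernel_sub_le hT x (-e) (by
    rw [norm_neg, div_le_one (by positivity)]; linarith)
  rw [sub_neg_eq_add, norm_neg] at h
  have k2 := heatKernel_nonneg (by positivity : 0 ≤ 2 * (1 + t)) (x + e)
  have k1 := heatKernel_nonneg (by positivity : 0 ≤ 2 * (1 + t)) x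
  have hd : ‖e‖ / √(1 + t) ≤ (1 + t) ^ (-(1 / 2) : ℝ) := by
    rw [← inv_sqrt_eq_rpow hT, div_eq_mul_inv]
    exact mul_le_of_le_one_left (by positivity) he
  refine h.trans ?_
  calc _ ≤ 2064 * (1 + t) ^ (-(1 / 2) : ℝ) * (4 * heatKernel (4 * (1 + t)) x
        + 2 * heatKernel (4 * (1 + t)) x) := by
        gcongr 2064 * ?_ * (?_ + ?_)
    _ = _ := by ring

/-- A Gaussian-bounded function is a remainder. -/
lemma GaussBound.remBound {m N : ℝ} {g : Plane → ℝ} (h : GaussBound S m g) (hm : 0 ≤ m) (hS : 0 < S)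
    (hμ : 0 ≤ μ) (hμ1 : μ ≤ 1) (hN : m * 4128 * S ^ μ ≤ N) : RemBound μ S N g := by
  constructor
  · calc ∫⁻ x, ‖g x‖ₑ ≤ ∫⁻ x, ENNReal.ofReal m * ENNReal.ofReal (heatKernel (4 * S) x) :=
          lintegral_mono fun x => by rw [← ENNReal.ofReal_mul hm]; exact h.enorm_le x
      _ = ENNReal.ofReal m := by
          rw [lintegral_const_mul' _ _ ENNReal.ofReal_ne_top, lintegral_heatKernel (by positivity), mul_one]
      _ ≤ _ := by
          apply ENNReal.ofReal_le_ofReal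
          calc m ≤ m * 4128 := by linarith
            _ = m * 4128 * S ^ μ * S ^ (-μ) := by
              rw [mul_assoc, ← Real.rpow_add hS, add_neg_cancel, Real.rpow_zero, mul_one]
            _ ≤ _ := by gcongr
  · calc _ ≤ ∫⁻ x, ENNReal.ofReal (m * (4128 * S ^ (μ / 2))) * ENNReal.ofReal (heatKernel (2 * (4 * S)) x) :=
          lintegral_mono fun x => by
            rw [← ENNReal.ofReal_mul (by positivity)]; exact h.weight_le hm hS hμ hμ1 x
      _ = ENNReal.ofReal (m * (4128 * S ^ (μ / 2))) := by
          rw [lintegral_const_mul' _ _ ENNReal.ofReal_ne_top, lintegral_heatKernel (by positivity), mul_one]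
      _ ≤ _ := by
          apply ENNReal.ofReal_le_ofReal
          calc m * (4128 * S ^ (μ / 2)) = m * 4128 * S ^ μ * S ^ (-(μ / 2)) := by
                rw [mul_assoc (m * 4128), ← Real.rpow_add hS, mul_assoc]; ring_nf
            _ ≤ _ := by gcongr

lemma GaussBound.integrable {m : ℝ} {g : Plane → ℝ} (h : GaussBound S m g) (hS : 0 < S)
    (hg : Measurable g) : Integrable g :=
  ((integrable_heatKernel (by positivity : 0 < 4 * S)).const_mul m).mono' hg.aestronglyMeasurable
    (.of_forall h)

lemma measurable_vortexPair (c₀ c₁ : ℝ) (e : Plane) :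
    Measurable (Function.uncurry (vortexPair c₀ c₁ e)) := by
  have h1 : Measurable (fun q : ℝ × Plane => heatKernel (1 + q.1) q.2) :=
    measurable_heatKernel_uncurry.comp (by fun_prop : Measurable fun q : ℝ × Plane => (1 + q.1, q.2))
  have h2 : Measurable (fun q : ℝ × Plane => heatKernel (1 + q.1) (q.2 + e)) :=
    measurable_heatKernel_uncurry.comp (by fun_prop : Measurable fun q : ℝ × Plane => (1 + q.1, q.2 + e))
  exact (h1.const_mul c₀).add (h2.const_mul c₁)

/-- The difference of the two normalized vortices. -/
def vortexDiff (e : Plane) (t : ℝ) (x : Plane) : ℝ :=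
  heatKernel (1 + t) (x + e) - heatKernel (1 + t) x

lemma measurable_vortexDiff (e : Plane) : Measurable (Function.uncurry (vortexDiff e)) := by
  have h : vortexDiff e = vortexPair (-1) 1 e := by
    funext t x; simp only [vortexDiff, vortexPair]; ring
  rw [h]; exact measurable_vortexPair _ _ _

/-- The semigroup law: the pair is transported exactly by the heat flow and thus drops out of the
linear part of the equation for the remainder. -/
lemma heatConv_vortexPair {c₀ c₁ t : ℝ} {e : Plane} (ht : 0 < t) (x : Plane) :
    heatConv t (vortexPair c₀ c₁ e 0) x = vortexPair c₀ c₁ e t x := by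
  have i1 := integrable_heatKernel_mul ht (integrable_heatKernel one_pos) x
  have i2 := integrable_heatKernel_mul ht (integrable_heatKernel_shift one_pos e) x
  have h1 := integral_heatKernel_mul ht one_pos x
  have h2 := integral_heatKernel_mul_shift ht one_pos x e
  simp only [heatConv, vortexPair, add_zero]
  calc _ = ∫ y, (c₀ * (heatKernel t (x - y) * heatKernel 1 y)
        + c₁ * (heatKernel t (x - y) * heatKernel 1 (y + e))) := by
        congr 1 with y : 1; ring
    _ = _ := by
        rw [integral_add (i1.const_mul c₀) (i2.const_mul c₁), integral_const_mul, integral_const_mul,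
          h1, h2, add_comm t 1]

end VCHE
end


noncomputable section

namespace VCHE

variable {α K μ S : ℝ}

/-! ### A fixed point theorem -/

lemma RemBound.congr_enorm {N : ℝ} {q q' : Plane → ℝ} (h : RemBound μ S N q)
    (he : ∀ᵐ x, ‖q' x‖ₑ ≤ ‖q x‖ₑ) : RemBound μ S N q' :=
  ⟨(lintegral_mono_ae he).trans h.mass,
    (lintegral_mono_ae (he.mono fun x hx => by gcongr)).trans h.moment⟩

lemma remBound_zero {N : ℝ} : RemBound μ S N (fun _ => 0) := by
  constructor <;> simp

lemma tsum_ofReal_half_pow_le {c : ℝ} (hc : 0 ≤ c) (n : ℕ) :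
    ∑' k : ℕ, ENNReal.ofReal (c / 2 / 2 ^ (n + k)) ≤ ENNReal.ofReal (c / 2 ^ n) := by
  have hs : HasSum (fun k : ℕ => c / 2 ^ n / 2 / 2 ^ k) (c / 2 ^ n) := hasSum_geometric_two' _
  have e : (fun k : ℕ => c / 2 / 2 ^ (n + k)) = fun k : ℕ => c / 2 ^ n / 2 / 2 ^ k := by
    funext k; rw [pow_add]; field_simp
  rw [← ENNReal.ofReal_tsum_of_nonneg (fun k => by positivity) (by rw [e]; exact hs.summable), e,
    hs.tsum_eq]

/-- Picard iteration from A in the remainder norm. The first step has size R/2 and each further step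
is half as large, so all iterates stay within R of A, and summability of the steps gives convergence
almost everywhere at each time. -/
lemma exists_fixedPoint {R : ℝ} (hR : 0 ≤ R) {A : ℝ → Plane → ℝ}
    {Γ : (ℝ → Plane → ℝ) → ℝ → Plane → ℝ} (hA : Measurable (Function.uncurry A))
    (hΓ : ∀ v, Measurable (Function.uncurry v) → Measurable (Function.uncurry (Γ v)))
    (hmap : ∀ v, Measurable (Function.uncurry v) →
      (∀ t, 0 ≤ t → RemBound μ (1 + t) R fun x => v t x - A t x) →
      ∀ t, 0 ≤ t → RemBound μ (1 + t) (R / 2) fun x => Γ v t x - A t x)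
    (hcontr : ∀ v v', Measurable (Function.uncurry v) → Measurable (Function.uncurry v') →
      (∀ t, 0 ≤ t → RemBound μ (1 + t) R fun x => v t x - A t x) →
      (∀ t, 0 ≤ t → RemBound μ (1 + t) R fun x => v' t x - A t x) → ∀ N, 0 ≤ N →
      (∀ t, 0 ≤ t → RemBound μ (1 + t) N fun x => v t x - v' t x) →
      ∀ t, 0 ≤ t → RemBound μ (1 + t) (N / 2) fun x => Γ v t x - Γ v' t x) :
    ∃ v, Measurable (Function.uncurry v) ∧
      (∀ t, 0 ≤ t → RemBound μ (1 + t) R fun x => v t x - A t x) ∧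
      ∀ t, 0 ≤ t → v t =ᵐ[volume] Γ v t := by
  let V : ℕ → ℝ → Plane → ℝ := fun n => Γ^[n] A
  have hV : ∀ n, V (n + 1) = Γ (V n) := fun n => Function.iterate_succ_apply' Γ n A
  have hVm : ∀ n, Measurable (Function.uncurry (V n)) := by
    intro n
    induction n with
    | zero => exact hA
    | succ n ih => rw [hV]; exact hΓ _ ih
  have hVA : ∀ n, ∀ t, 0 ≤ t → RemBound μ (1 + t) R fun x => V n t x - A t x := by
    intro n
    induction n with
    | zero =>
      intro t ht
      simpa [V] using remBound_zero (μ := μ) (S := 1 + t) (N := R)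
    | succ n ih =>
      intro t ht
      rw [hV]
      exact (hmap _ (hVm n) ih t ht).mono (by linarith) (by linarith)
  have hd : ∀ n, ∀ t, 0 ≤ t → RemBound μ (1 + t) (R / 2 / 2 ^ n) fun x => V (n + 1) t x - V n t x := by
    intro n
    induction n with
    | zero =>
      intro t ht
      simpa [V] using hmap _ hA (hVA 0) t ht
    | succ n ih =>
      intro t ht
      rw [hV, hV n, pow_succ, ← div_div, ← hV n]
      rw [hV n]
      have := hcontr _ _ (hVm (n + 1)) (hVm n) (hVA (n + 1)) (hVA n) _ (by positivity) ih t ht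
      rwa [hV n] at this
  -- A pointwise limit, with a default value where the iterates diverge; this keeps v jointly
  -- measurable in time and space.
  let v : ℝ → Plane → ℝ := fun t x => Filter.atTop.limUnder fun n => V n t x
  have hvm : Measurable (Function.uncurry v) := by
    have : StronglyMeasurable (fun q : ℝ × Plane => Filter.atTop.limUnder fun n => V n q.1 q.2) :=
      StronglyMeasurable.limUnder fun n => (hVm n).stronglyMeasurable
    exact this.measurable
  have hms : ∀ n t, Measurable fun x => ‖V (n + 1) t x - V n t x‖ₑ := fun n t =>
    (((hVm (n + 1)).comp measurable_prodMk_left).sub ((hVm n).comp measurable_prodMk_left)).enorm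
  have hsum : ∀ n t, 0 ≤ t → ∀ w : Plane → ℝ≥0∞, Measurable w → ∀ c, 0 ≤ c →
      (∀ k, ∫⁻ x, w x * ‖V (k + 1) t x - V k t x‖ₑ ≤ ENNReal.ofReal (R / 2 / 2 ^ k * c)) →
      ∫⁻ x, w x * ∑' k, ‖V (n + k + 1) t x - V (n + k) t x‖ₑ ≤ ENNReal.ofReal (R / 2 ^ n * c) := by
    intro n t ht w hw c hc h
    simp_rw [← ENNReal.tsum_mul_left]
    rw [lintegral_tsum fun k => by have := hms (n + k) t; fun_prop]
    calc _ ≤ ∑' k, ENNReal.ofReal (R / 2 / 2 ^ (n + k)) * ENNReal.ofReal c := by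
          refine ENNReal.tsum_le_tsum fun k => (h (n + k)).trans (le_of_eq ?_)
          rw [ENNReal.ofReal_mul (by positivity)]
      _ ≤ _ := by
          rw [ENNReal.tsum_mul_right, ENNReal.ofReal_mul (by positivity)]
          gcongr
          exact tsum_ofReal_half_pow_le hR n
  have hmass : ∀ n t, 0 ≤ t → ∫⁻ x, ∑' k, ‖V (n + k + 1) t x - V (n + k) t x‖ₑ
      ≤ ENNReal.ofReal (R / 2 ^ n * (1 + t) ^ (-μ)) := by
    intro n t ht
    have := hsum n t ht (fun _ => 1) measurable_const ((1 + t) ^ (-μ)) (by positivity) fun k => by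
      simp only [one_mul]; exact (hd k t ht).mass
    simpa only [one_mul] using this
  have htend : ∀ t, 0 ≤ t → ∀ᵐ x, Filter.Tendsto (fun n => V n t x) Filter.atTop (nhds (v t x)) := by
    intro t ht
    have hfin := (hmass 0 t ht).trans_lt ENNReal.ofReal_lt_top
    simp only [zero_add] at hfin
    filter_upwards [ae_lt_top (Measurable.tsum fun k => hms k t) hfin.ne] with x hx
    have hc : CauchySeq fun n => V n t x :=
      cauchySeq_of_edist_le_of_tsum_ne_top (fun n => ‖V (n + 1) t x - V n t x‖ₑ)
        (fun n => by rw [edist_comm, edist_eq_enorm_sub]) hx.ne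
    exact hc.tendsto_limUnder
  have hv : ∀ n t, 0 ≤ t → RemBound μ (1 + t) (R / 2 ^ n) fun x => v t x - V n t x := by
    intro n t ht
    have hle : ∀ᵐ x, ‖v t x - V n t x‖ₑ ≤ ∑' k, ‖V (n + k + 1) t x - V (n + k) t x‖ₑ := by
      filter_upwards [htend t ht] with x hx
      have := edist_le_tsum_of_edist_le_of_tendsto (fun n => ‖V (n + 1) t x - V n t x‖ₑ)
        (fun n => by rw [edist_comm, edist_eq_enorm_sub]) hx n
      rwa [edist_comm, edist_eq_enorm_sub] at this
    refine ⟨(lintegral_mono_ae hle).trans (hmass n t ht), ?_⟩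
    refine (lintegral_mono_ae (hle.mono fun x hx => ?_)).trans
      (hsum n t ht (fun x => ENNReal.ofReal (‖x‖ ^ μ)) (by fun_prop) _ (by positivity)
        fun k => (hd k t ht).moment)
    gcongr
  have hvA : ∀ t, 0 ≤ t → RemBound μ (1 + t) R fun x => v t x - A t x := by
    intro t ht
    simpa [V] using hv 0 t ht
  refine ⟨v, hvm, hvA, fun t ht => ?_⟩
  -- Both v and Γ v are within R/2^{n+1} of the iterate of index n+1, the first by convergence and
  -- the second by contraction.
  have hle : ∀ n : ℕ, ∫⁻ x, ‖v t x - Γ v t x‖ₑ ≤ ENNReal.ofReal (R * (1 + t) ^ (-μ) / 2 ^ n) := by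
    intro n
    have h1 := hv (n + 1) t ht
    have h2 := hcontr _ _ hvm (hVm n) hvA (hVA n) _ (by positivity) (hv n) t ht
    rw [← hV] at h2
    have hm1 : Measurable fun x => v t x - V (n + 1) t x :=
      (hvm.comp measurable_prodMk_left).sub ((hVm (n + 1)).comp measurable_prodMk_left)
    have h3 := RemBound.of_enorm_le (F := fun x => v t x - Γ v t x) (by linarith) (by positivity)
      (by positivity) hm1.aemeasurable h1 h2 (.of_forall fun x => by
        rw [show v t x - Γ v t x = (v t x - V (n + 1) t x) + -(Γ v t x - V (n + 1) t x) by ring]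
        exact (enorm_add_le _ _).trans (by rw [enorm_neg]))
    refine h3.mass.trans (le_of_eq ?_)
    congr 1
    rw [pow_succ]
    field_simp
    ring
  have h0 : ∫⁻ x, ‖v t x - Γ v t x‖ₑ = 0 := by
    have hlim : Filter.Tendsto (fun n : ℕ => ENNReal.ofReal (R * (1 + t) ^ (-μ) / 2 ^ n))
        Filter.atTop (nhds 0) := by
      rw [← ENNReal.ofReal_zero]
      refine (ENNReal.continuous_ofReal.tendsto 0).comp ?_
      have := (tendsto_pow_atTop_nhds_zero_of_lt_one (r := (1 / 2 : ℝ)) (by norm_num)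
        (by norm_num)).const_mul (R * (1 + t) ^ (-μ))
      rw [mul_zero] at this
      refine this.congr fun n => ?_
      rw [one_div, inv_pow, div_eq_mul_inv]
    exact le_antisymm (ge_of_tendsto' hlim hle) bot_le
  have hm : Measurable fun x => v t x - Γ v t x :=
    (hvm.comp measurable_prodMk_left).sub ((hΓ _ hvm).comp measurable_prodMk_left)
  rw [lintegral_eq_zero_iff hm.enorm] at h0
  filter_upwards [h0] with x hx
  simpa [sub_eq_zero] using hx

end VCHE
end


noncomputable section

namespace VCHE

variable {α K μ S : ℝ}

/-! ### The integral equation -/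

lemma measurable_flux (hα : 0 < α) {f g : Plane → ℝ} (hf : Integrable f) (hg : Measurable g) :
    Measurable (flux α f g) :=
  hg.smul (stronglyMeasurable_velocity hα hf).measurable

lemma measurable_flux_uncurry (hα : 0 < α) {v v' : ℝ → Plane → ℝ}
    (hv : Measurable (Function.uncurry v)) (hv' : Measurable (Function.uncurry v')) :
    Measurable (Function.uncurry fun s => flux α (v s) (v' s)) :=
  hv'.smul (stronglyMeasurable_velocity_uncurry hα hv).measurable

lemma lintegral_flux_le (hK : VelBound α K) {f : Plane → ℝ} (hf : Integrable f)
    (g : Plane → ℝ) :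
    ∫⁻ y, ‖flux α f g y‖ₑ ≤ ENNReal.ofReal K * (∫⁻ z, ‖f z‖ₑ) * ∫⁻ z, ‖g z‖ₑ := by
  have h : ∫⁻ z, ‖f z‖ₑ ≠ ∞ := hf.2.ne
  rw [← lintegral_const_mul' _ _ (ENNReal.mul_ne_top ENNReal.ofReal_ne_top h)]
  refine lintegral_mono fun y => ?_
  rw [flux, enorm_smul, mul_comm]
  gcongr
  exact enorm_velocity_le_of_sup hK f y

lemma FluxBound.add {M M' : ℝ} {F G : Plane → Plane} (hS : 0 ≤ S) (hM : 0 ≤ M) (hM' : 0 ≤ M')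
    (hFm : Measurable F) (hF : FluxBound μ S M F) (hG : FluxBound μ S M' G) :
    FluxBound μ S (M + M') (fun y => F y + G y) :=
  hF.of_enorm_le hS hM hM' hFm.aemeasurable hG fun _ => enorm_add_le _ _

lemma integrable_of_integrable_sub {f g : Plane → ℝ} (h : Integrable fun x => f x - g x)
    (hg : Integrable g) : Integrable f :=
  (h.add hg).congr (.of_forall fun x => by simp)

/-- The difference of the self-fluxes splits into four interactions of v - v' with the Gaussian A or
with a remainder, each covered by one of the three flux estimates. -/
lemma fluxBound_sub (hα : 0 < α) (hK : VelBound α K) (hμ : 1 / 2 ≤ μ) (hμ1 : μ ≤ 1) (hS : 1 ≤ S)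
    {A v v' : Plane → ℝ} (hAm : Measurable A) (hvm : Measurable v) (hvm' : Measurable v')
    {m R N : ℝ} (hm : 0 ≤ m) (hR : 0 ≤ R) (hN : 0 ≤ N) (hA : GaussBound S m A)
    (hv : RemBound μ S R fun x => v x - A x) (hv' : RemBound μ S R fun x => v' x - A x)
    (hd : RemBound μ S N fun x => v x - v' x) :
    FluxBound μ S (4128 * K * (2 * (m + R) * N)) (fun y => flux α v v y - flux α v' v' y) := by
  have hK0 : 0 ≤ K := by linarith [hK.one_le]
  have hS0 : 0 < S := by linarith
  have iA := hA.integrable hS0 hAm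
  have iq := hv.integrable (hvm.sub hAm)
  have iq' := hv'.integrable (hvm'.sub hAm)
  have id' := hd.integrable (hvm.sub hvm')
  have iv : Integrable v := integrable_of_integrable_sub iq iA
  have iv' : Integrable v' := integrable_of_integrable_sub iq' iA
  have e : (fun y => flux α v v y - flux α v' v' y) = fun y =>
      (flux α (fun z => v z - v' z) A y + flux α (fun z => v z - v' z) (fun z => v z - A z) y)
      + (flux α A (fun z => v z - v' z) y + flux α (fun z => v' z - A z) (fun z => v z - v' z) y) := by
    funext y
    rw [flux_sub_flux hα iv iv']
    congr 1
    · simp only [flux]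
      rw [← add_smul]; congr 1; ring
    · simp only [flux]
      rw [← smul_add, velocity_sub hα iv' iA]; congr 1; abel
  rw [e]
  have b1 := fluxBound_of_gaussian_right hα hK (by linarith) hμ1 hS0 hm hN (hvm.sub hvm') hd hA
  have b2 := fluxBound_of_remBound hK hμ hS hN hR hd hv
  have b3 := fluxBound_of_gaussian_left hK hS0 hm hN hd hA
  have b4 := fluxBound_of_remBound hK hμ hS hR hN hv' hd
  have m1 := measurable_flux hα id' hAm
  have m2 := measurable_flux hα id' (hvm.sub hAm)
  have m3 := measurable_flux hα iA (hvm.sub hvm')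
  refine (((b1.add hS0.le (by positivity) (by positivity) m1 b2).add hS0.le (by positivity)
    (by positivity) (m1.add m2)
    (b3.add hS0.le (by positivity) (by positivity) m3 b4))).mono hS0.le (le_of_eq (by ring))

/-- The right-hand side of the integral equation, extended by the initial data to `t ≤ 0`. -/
def mildMap (α : ℝ) (v₀ : Plane → ℝ) (v : ℝ → Plane → ℝ) (t : ℝ) (x : Plane) : ℝ :=
  if t ≤ 0 then v₀ x else heatConv t v₀ x - duhamel (fun s => flux α (v s) (v s)) t x

lemma measurable_heatConv {v₀ : Plane → ℝ} (hv₀ : Measurable v₀) :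
    Measurable (fun q : ℝ × Plane => heatConv q.1 v₀ q.2) := by
  have h : Measurable (fun p : (ℝ × Plane) × Plane => heatKernel p.1.1 (p.1.2 - p.2) * v₀ p.2) := by
    have h2 : Measurable (fun p : (ℝ × Plane) × Plane => heatKernel p.1.1 (p.1.2 - p.2)) :=
      measurable_heatKernel_uncurry.comp
        (by fun_prop : Measurable fun p : (ℝ × Plane) × Plane => (p.1.1, p.1.2 - p.2))
    fun_prop
  exact (h.stronglyMeasurable.integral_prod_right').measurable

lemma measurable_mildMap (hα : 0 < α) {v₀ : Plane → ℝ} (hv₀ : Measurable v₀) {v : ℝ → Plane → ℝ}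
    (hv : Measurable (Function.uncurry v)) : Measurable (Function.uncurry (mildMap α v₀ v)) :=
  Measurable.ite (measurableSet_le measurable_fst measurable_const) (hv₀.comp measurable_snd)
    ((measurable_heatConv hv₀).sub (measurable_duhamel (measurable_flux_uncurry hα hv hv)))

/-- The flux of the vortex pair, corrected so that it does not contribute to the equation. -/
def pairFlux (α c₀ c₁ : ℝ) (e : Plane) (s : ℝ) (y : Plane) : Plane :=
  flux α (vortexPair c₀ c₁ e s) (vortexPair c₀ c₁ e s) y
    + (c₀ * c₁) • flux α (vortexDiff e s) (vortexDiff e s) y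

lemma duhamel_pairFlux (hα : 0 < α) (c₀ c₁ : ℝ) (e : Plane) (t : ℝ) (x : Plane) :
    duhamel (pairFlux α c₀ c₁ e) t x = 0 := by
  rw [duhamel]
  refine setIntegral_eq_zero_of_forall_eq_zero fun s hs => ?_
  exact convGrad_flux_pair hα (by linarith [hs.2]) (by linarith [hs.1] : 0 < 1 + s) c₀ c₁ e x

lemma measurable_pairFlux (hα : 0 < α) (c₀ c₁ : ℝ) (e : Plane) :
    Measurable (Function.uncurry (pairFlux α c₀ c₁ e)) :=
  (measurable_flux_uncurry hα (measurable_vortexPair c₀ c₁ e) (measurable_vortexPair c₀ c₁ e)).add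
    ((measurable_flux_uncurry hα (measurable_vortexDiff e) (measurable_vortexDiff e)).const_smul
      (c₀ * c₁))

/-- One factor is used as a Gaussian of size S^{-1/2}, the other as a remainder of size S^{μ-1/2}.
The product S^{μ-1} is at most one since μ ≤ 1. -/
lemma fluxBound_vortexDiff (hK : VelBound α K) (hμ : 0 ≤ μ) (hμ1 : μ ≤ 1) {s : ℝ}
    (hs : 0 ≤ s) {e : Plane} (he : ‖e‖ ≤ 1) :
    FluxBound μ (1 + s) (4128 * K * (12384 ^ 2 * 4128)) (flux α (vortexDiff e s) (vortexDiff e s)) := by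
  have hK0 : 0 ≤ K := by linarith [hK.one_le]
  have hS : 0 < 1 + s := by linarith
  have hg := gaussBound_vortexDiff he hs
  have hr := hg.remBound (by positivity) hS hμ hμ1 le_rfl
  refine (fluxBound_of_gaussian_left hK hS (by positivity) (by positivity) hr hg).mono hS.le ?_
  have h1 : (1 + s) ^ (-(1 / 2) : ℝ) * ((1 + s) ^ (-(1 / 2) : ℝ) * (1 + s) ^ μ) ≤ 1 := by
    rw [← Real.rpow_add hS, ← Real.rpow_add hS]
    exact Real.rpow_le_one_of_one_le_of_nonpos (by linarith) (by linarith)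
  calc _ = 4128 * K * (12384 ^ 2 * 4128) * ((1 + s) ^ (-(1 / 2) : ℝ) * ((1 + s) ^ (-(1 / 2) : ℝ) * (1 + s) ^ μ)) := by
        ring
    _ ≤ _ := mul_le_of_le_one_right (by positivity) h1

/-- The part of the flux that drives the remainder. -/
def remFlux (α c₀ c₁ : ℝ) (e : Plane) (v : ℝ → Plane → ℝ) (s : ℝ) (y : Plane) : Plane :=
  flux α (v s) (v s) y - pairFlux α c₀ c₁ e s y

lemma measurable_remFlux (hα : 0 < α) (c₀ c₁ : ℝ) (e : Plane) {v : ℝ → Plane → ℝ}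
    (hv : Measurable (Function.uncurry v)) : Measurable (Function.uncurry (remFlux α c₀ c₁ e v)) :=
  (measurable_flux_uncurry hα hv hv).sub (measurable_pairFlux hα c₀ c₁ e)

lemma FluxBound.const_smul {M : ℝ} {F : Plane → Plane} (h : FluxBound μ S M F) (c : ℝ) :
    FluxBound μ S (|c| * M) (fun y => c • F y) := by
  constructor
  · simp_rw [enorm_smul]
    rw [lintegral_const_mul' _ _ enorm_ne_top, mul_assoc, ENNReal.ofReal_mul (abs_nonneg c),
      Real.enorm_eq_ofReal_abs]
    gcongr
    exact h.mass
  · simp_rw [enorm_smul, mul_left_comm]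
    rw [lintegral_const_mul' _ _ enorm_ne_top, mul_assoc, ENNReal.ofReal_mul (abs_nonneg c),
      Real.enorm_eq_ofReal_abs]
    gcongr
    exact h.moment

/-- After `pairFlux` is subtracted, only interactions involving the remainder and a multiple c₀c₁ of
the self-flux of the vortex difference are left. The bound is quadratic in r and R, which is what
lets the iteration close for small data. -/
lemma fluxBound_remFlux (hα : 0 < α) (hK : VelBound α K) (hμ : 1 / 2 ≤ μ) (hμ1 : μ ≤ 1)
    {c₀ c₁ r R s : ℝ} {e : Plane} (h₀ : |c₀| ≤ r) (h₁ : |c₁| ≤ r) (he : ‖e‖ ≤ 1) (hs : 0 ≤ s)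
    (hR : 0 ≤ R) {v : ℝ → Plane → ℝ} (hv : Measurable (Function.uncurry v))
    (hq : RemBound μ (1 + s) R fun x => v s x - vortexPair c₀ c₁ e s x) :
    FluxBound μ (1 + s) (4128 * K * (2 * (12 * r + R) * R) + r ^ 2 * (4128 * K * (12384 ^ 2 * 4128)))
      (remFlux α c₀ c₁ e v s) := by
  have hK0 : 0 ≤ K := by linarith [hK.one_le]
  have hr : 0 ≤ r := (abs_nonneg _).trans h₀
  have hS : 0 < 1 + s := by linarith
  have hAm : Measurable (vortexPair c₀ c₁ e s) := (measurable_vortexPair c₀ c₁ e).comp measurable_prodMk_left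
  have hvm : Measurable (v s) := hv.comp measurable_prodMk_left
  have hA := gaussBound_vortexPair h₀ h₁ he hs
  -- The second vorticity is the pair itself, whose remainder is zero.
  have b1 := fluxBound_sub hα hK hμ hμ1 (by linarith : 1 ≤ 1 + s) hAm hvm hAm (by positivity) hR hR hA hq
    (by simpa using remBound_zero (μ := μ) (S := 1 + s) (N := R)) hq
  have b2 := (fluxBound_vortexDiff hK (by linarith) hμ1 hs he).const_smul (-(c₀ * c₁))
  have iA := hA.integrable hS hAm
  have iv : Integrable (v s) := integrable_of_integrable_sub (hq.integrable (hvm.sub hAm)) iA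
  have h := b1.add hS.le (by positivity) (by positivity)
    ((measurable_flux hα iv hvm).sub (measurable_flux hα iA hAm)) b2
  have e1 : remFlux α c₀ c₁ e v s = fun y => flux α (v s) (v s) y
      - flux α (vortexPair c₀ c₁ e s) (vortexPair c₀ c₁ e s) y
      + (-(c₀ * c₁)) • flux α (vortexDiff e s) (vortexDiff e s) y := by
    funext y
    simp only [remFlux, pairFlux, neg_smul]
    abel
  rw [e1]
  refine h.mono hS.le ?_
  gcongr
  rw [abs_neg, abs_mul, pow_two]
  gcongr

lemma integrable_vortexPair (c₀ c₁ : ℝ) (e : Plane) {t : ℝ} (ht : 0 ≤ t) :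
    Integrable (vortexPair c₀ c₁ e t) :=
  ((integrable_heatKernel (by linarith)).const_mul _).add
    ((integrable_heatKernel_shift (by linarith) e).const_mul _)

lemma integrable_vortexDiff (e : Plane) {t : ℝ} (ht : 0 ≤ t) : Integrable (vortexDiff e t) :=
  (integrable_heatKernel_shift (by linarith) e).sub (integrable_heatKernel (by linarith))

lemma integral_remFlux (hα : 0 < α) (c₀ c₁ : ℝ) (e : Plane) {v : ℝ → Plane → ℝ} {s : ℝ} (hs : 0 ≤ s)
    (hv : Integrable (v s)) : ∫ y, remFlux α c₀ c₁ e v s y = 0 := by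
  have iA := integrable_vortexPair c₀ c₁ e hs
  have iD := integrable_vortexDiff e hs
  have i1 := integrable_flux hα hv hv
  have i2 := integrable_flux hα iA iA
  have i3 : Integrable fun y => (c₀ * c₁) • flux α (vortexDiff e s) (vortexDiff e s) y :=
    (integrable_flux hα iD iD).smul (c₀ * c₁)
  have i4 : Integrable fun y => flux α (vortexPair c₀ c₁ e s) (vortexPair c₀ c₁ e s) y
    + (c₀ * c₁) • flux α (vortexDiff e s) (vortexDiff e s) y := i2.add i3
  simp only [remFlux, pairFlux]
  rw [integral_sub i1 i4, integral_add i2 i3, integral_smul, integral_flux_self hα hv,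
    integral_flux_self hα iA, integral_flux_self hα iD]
  simp

end VCHE
end


/-! ### Mean-free data and the contraction near a vortex pair -/

noncomputable section

namespace VCHE

variable {α K μ S : ℝ}

/-- Initial data without mass and first moments, of size `r`. -/
structure InitBound (μ r : ℝ) (f : Plane → ℝ) : Prop where
  measurable : Measurable f
  integrable_coord : ∀ i, Integrable (fun y : Plane => y i * f y)
  integral_eq : ∫ y, f y = 0
  integral_coord_eq : ∀ i, ∫ y : Plane, y i * f y = 0
  moment : ∫⁻ y, ENNReal.ofReal (1 + ‖y‖ ^ (2 * μ)) * ‖f y‖ₑ ≤ ENNReal.ofReal r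

lemma InitBound.lintegral_weight_le {r c : ℝ} {f : Plane → ℝ} (h : InitBound μ r f) (hc : 0 ≤ c)
    {w : Plane → ℝ} (hw : ∀ y, w y ≤ c * (1 + ‖y‖ ^ (2 * μ))) :
    ∫⁻ y, ENNReal.ofReal (w y) * ‖f y‖ₑ ≤ ENNReal.ofReal (c * r) := by
  calc _ ≤ ∫⁻ y, ENNReal.ofReal c * (ENNReal.ofReal (1 + ‖y‖ ^ (2 * μ)) * ‖f y‖ₑ) := by
        refine lintegral_mono fun y => ?_
        rw [← mul_assoc, ← ENNReal.ofReal_mul hc]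
        gcongr
        exact hw y
    _ ≤ _ := by
        rw [lintegral_const_mul' _ _ ENNReal.ofReal_ne_top, ENNReal.ofReal_mul hc]
        gcongr
        exact h.moment

lemma InitBound.lintegral_le {r : ℝ} {f : Plane → ℝ} (h : InitBound μ r f) :
    ∫⁻ y, ‖f y‖ₑ ≤ ENNReal.ofReal r := by
  have := h.lintegral_weight_le zero_le_one (w := fun _ => 1) fun y => by
    have : 0 ≤ ‖y‖ ^ (2 * μ) := by positivity
    linarith
  simpa using this

lemma InitBound.integrable {r : ℝ} {f : Plane → ℝ} (h : InitBound μ r f) : Integrable f :=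
  ⟨h.measurable.aestronglyMeasurable, h.lintegral_le.trans_lt ENNReal.ofReal_lt_top⟩

lemma rpow_le_one_add_rpow_two_mul {ρ : ℝ} (hρ : 0 ≤ ρ) (μ : ℝ) : ρ ^ μ ≤ 1 + ρ ^ (2 * μ) := by
  rw [mul_comm, Real.rpow_mul hρ, Real.rpow_two]
  nlinarith [sq_nonneg (ρ ^ μ - 1), sq_nonneg (ρ ^ μ)]

lemma InitBound.remBound {r : ℝ} {f : Plane → ℝ} (h : InitBound μ r f) : RemBound μ 1 r f := by
  constructor
  · simpa using h.lintegral_le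
  · simpa using h.lintegral_weight_le zero_le_one (w := fun y => ‖y‖ ^ μ) fun y => by
      rw [one_mul]; exact rpow_le_one_add_rpow_two_mul (norm_nonneg y) μ

lemma rpow_neg_le_of_one_le {t k : ℝ} (ht : 1 ≤ t) (hk : 0 ≤ k) (hk1 : k ≤ 1) :
    t ^ (-k) ≤ 2 * (1 + t) ^ (-k) := by
  calc t ^ (-k) ≤ ((1 + t) / 2) ^ (-k) :=
        Real.rpow_le_rpow_of_nonpos (by linarith) (by linarith) (by linarith)
    _ = 2 ^ k * (1 + t) ^ (-k) := by
        rw [Real.div_rpow (by linarith) (by norm_num), Real.rpow_neg (by norm_num : (0:ℝ) ≤ 2)]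
        field_simp
    _ ≤ 2 ^ (1 : ℝ) * (1 + t) ^ (-k) := by gcongr; norm_num
    _ = _ := by rw [Real.rpow_one]

lemma one_le_rpow_neg {t k : ℝ} (ht0 : 0 ≤ t) (ht : t ≤ 1) (hk1 : k ≤ 1) :
    1 ≤ 2 * (1 + t) ^ (-k) := by
  have : (1 + t) ^ k ≤ 2 := by
    calc (1 + t) ^ k ≤ (1 + t) ^ (1 : ℝ) := Real.rpow_le_rpow_of_exponent_le (by linarith) hk1
      _ ≤ 2 := by rw [Real.rpow_one]; linarith
  rw [Real.rpow_neg (by linarith), ← div_eq_mul_inv, le_div_iff₀ (by positivity)]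
  linarith

/-- For t ≥ 1 the vanishing moments give the decay. For t ≤ 1 those bounds are singular, and the
contraction property and the plain weighted bound are used instead. -/
lemma InitBound.remBound_heatConv {r t : ℝ} (hr : 0 ≤ r) {f : Plane → ℝ} (h : InitBound μ r f)
    (hμ : 1 / 2 ≤ μ) (hμ1 : μ ≤ 1) (ht : 0 < t) :
    RemBound μ (1 + t) (5 * 2064 * 8256 * 2 * r) (heatConv t f) := by
  have hw2 := h.lintegral_weight_le zero_le_one (w := fun y => ‖y‖ ^ (2 * μ)) (fun y => by linarith)
  rw [one_mul] at hw2
  have hT : 0 < 1 + t := by linarith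
  rcases le_total 1 t with ht1 | ht1
  · constructor
    · have h1 := lintegral_heatConv_rpow_le_of_moments ht hμ hμ1 le_rfl h.integrable
        h.integrable_coord h.integral_eq h.integral_coord_eq
      simp only [ENNReal.rpow_one] at h1
      refine h1.trans ((mul_le_mul_right hw2 _).trans ?_)
      rw [← ENNReal.ofReal_mul (by positivity)]
      apply ENNReal.ofReal_le_ofReal
      have := rpow_neg_le_of_one_le ht1 (by linarith) hμ1
      rw [show -μ + (1 / 1 - 1) = -μ by ring]
      calc 16512 * t ^ (-μ) * r ≤ 16512 * (2 * (1 + t) ^ (-μ)) * r := by gcongr 16512 * ?_ * r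
        _ = 33024 * r * (1 + t) ^ (-μ) := by ring
        _ ≤ _ := by gcongr; norm_num
    · refine (lintegral_weight_heatConv_le_of_moments ht hμ hμ1 h.integrable h.integrable_coord
        h.integral_eq h.integral_coord_eq).trans ((mul_le_mul_right hw2 _).trans ?_)
      rw [← ENNReal.ofReal_mul (by positivity)]
      apply ENNReal.ofReal_le_ofReal
      have := rpow_neg_le_of_one_le ht1 (by linarith : 0 ≤ μ / 2) (by linarith)
      calc 5 * 2064 * 8256 * t ^ (-(μ / 2)) * r
          ≤ 5 * 2064 * 8256 * (2 * (1 + t) ^ (-(μ / 2))) * r := by gcongr _ * ?_ * r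
        _ = _ := by ring
  · constructor
    · have h1 := lintegral_heatConv_rpow_le ht le_rfl h.measurable.aestronglyMeasurable
      simp only [ENNReal.rpow_one] at h1
      refine h1.trans (h.lintegral_le.trans (ENNReal.ofReal_le_ofReal ?_))
      have := one_le_rpow_neg ht.le ht1 hμ1
      calc r = r * 1 := by ring
        _ ≤ r * (2 * (1 + t) ^ (-μ)) := by gcongr
        _ = 2 * r * (1 + t) ^ (-μ) := by ring
        _ ≤ _ := by gcongr; norm_num
    · refine (lintegral_weight_heatConv_le ht (by linarith) hμ1
        h.measurable.aestronglyMeasurable).trans ?_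
      refine (h.lintegral_weight_le (c := 4128) (by norm_num) fun y => ?_).trans
        (ENNReal.ofReal_le_ofReal ?_)
      · have h1 := rpow_le_one_add_rpow_two_mul (norm_nonneg y) μ
        have h2 : t ^ (μ / 2) ≤ 1 := Real.rpow_le_one ht.le ht1 (by linarith)
        have h3 : 0 ≤ ‖y‖ ^ (2 * μ) := by positivity
        nlinarith
      · have := one_le_rpow_neg (k := μ / 2) ht.le ht1 (by linarith)
        calc 4128 * r = 4128 * r * 1 := by ring
          _ ≤ 4128 * r * (2 * (1 + t) ^ (-(μ / 2))) := by gcongr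
          _ = 8256 * r * (1 + t) ^ (-(μ / 2)) := by ring
          _ ≤ _ := by gcongr; norm_num

lemma FluxBound.lintegral_le {M s : ℝ} {F : Plane → Plane} (hM : 0 ≤ M) (hμ : 0 ≤ μ) (hs : 0 ≤ s)
    (h : FluxBound μ (1 + s) M F) : ∫⁻ y, ‖F y‖ₑ ≤ ENNReal.ofReal M :=
  h.mass.trans (ENNReal.ofReal_le_ofReal (mul_le_of_le_one_right hM
    (Real.rpow_le_one_of_one_le_of_nonpos (by linarith) (by linarith))))

lemma RemBound.lintegral_le {M s : ℝ} {F : Plane → ℝ} (hM : 0 ≤ M) (hμ : 0 ≤ μ) (hs : 0 ≤ s)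
    (h : RemBound μ (1 + s) M F) : ∫⁻ y, ‖F y‖ₑ ≤ ENNReal.ofReal M :=
  h.mass.trans (ENNReal.ofReal_le_ofReal (mul_le_of_le_one_right hM
    (Real.rpow_le_one_of_one_le_of_nonpos (by linarith) (by linarith))))

lemma lintegral_vortexPair_le {c₀ c₁ r s : ℝ} {e : Plane} (h₀ : |c₀| ≤ r) (h₁ : |c₁| ≤ r)
    (he : ‖e‖ ≤ 1) (hs : 0 ≤ s) : ∫⁻ y, ‖vortexPair c₀ c₁ e s y‖ₑ ≤ ENNReal.ofReal (12 * r) := by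
  have hr : 0 ≤ r := (abs_nonneg _).trans h₀
  calc _ ≤ ∫⁻ y, ENNReal.ofReal (12 * r) * ENNReal.ofReal (heatKernel (4 * (1 + s)) y) := by
        refine lintegral_mono fun y => ?_
        rw [← ENNReal.ofReal_mul (by positivity)]
        exact (gaussBound_vortexPair h₀ h₁ he hs).enorm_le y
    _ = _ := by
        rw [lintegral_const_mul' _ _ ENNReal.ofReal_ne_top, lintegral_heatKernel (by positivity), mul_one]

/-- The standing assumptions on a candidate solution near a vortex pair. -/
structure NearPair (μ R c₀ c₁ : ℝ) (e : Plane) (v : ℝ → Plane → ℝ) : Prop where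
  measurable : Measurable (Function.uncurry v)
  rem : ∀ t, 0 ≤ t → RemBound μ (1 + t) R fun x => v t x - vortexPair c₀ c₁ e t x

lemma NearPair.measurable_slice {R c₀ c₁ : ℝ} {e : Plane} {v : ℝ → Plane → ℝ}
    (h : NearPair μ R c₀ c₁ e v) (t : ℝ) : Measurable (v t) := h.measurable.comp measurable_prodMk_left

lemma measurable_vortexPair_slice (c₀ c₁ : ℝ) (e : Plane) (t : ℝ) :
    Measurable (vortexPair c₀ c₁ e t) := (measurable_vortexPair c₀ c₁ e).comp measurable_prodMk_left

lemma NearPair.integrable {R c₀ c₁ : ℝ} {e : Plane} {v : ℝ → Plane → ℝ}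
    (h : NearPair μ R c₀ c₁ e v) {t : ℝ} (ht : 0 ≤ t) : Integrable (v t) :=
  integrable_of_integrable_sub
    ((h.rem t ht).integrable ((h.measurable_slice t).sub (measurable_vortexPair_slice c₀ c₁ e t)))
    (integrable_vortexPair c₀ c₁ e ht)

lemma NearPair.lintegral_le {R r c₀ c₁ : ℝ} {e : Plane} {v : ℝ → Plane → ℝ}
    (h : NearPair μ R c₀ c₁ e v) (hμ : 0 ≤ μ) (hR : 0 ≤ R) (h₀ : |c₀| ≤ r) (h₁ : |c₁| ≤ r) (he : ‖e‖ ≤ 1)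
    {t : ℝ} (ht : 0 ≤ t) : ∫⁻ x, ‖v t x‖ₑ ≤ ENNReal.ofReal (R + 12 * r) := by
  have hr : 0 ≤ r := (abs_nonneg _).trans h₀
  have hm : Measurable fun x => v t x - vortexPair c₀ c₁ e t x :=
    (h.measurable_slice t).sub (measurable_vortexPair_slice c₀ c₁ e t)
  calc _ ≤ ∫⁻ x, (‖v t x - vortexPair c₀ c₁ e t x‖ₑ + ‖vortexPair c₀ c₁ e t x‖ₑ) := by
        refine lintegral_mono fun x => ?_
        conv_lhs => rw [← sub_add_cancel (v t x) (vortexPair c₀ c₁ e t x)]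
        exact enorm_add_le _ _
    _ ≤ _ := by
        rw [lintegral_add_left hm.enorm, ENNReal.ofReal_add hR (by positivity)]
        exact add_le_add ((h.rem t ht).lintegral_le hR hμ ht) (lintegral_vortexPair_le h₀ h₁ he ht)

lemma NearPair.lintegral_flux_le {R r c₀ c₁ : ℝ} {e : Plane} {v : ℝ → Plane → ℝ}
    (h : NearPair μ R c₀ c₁ e v) (hK : VelBound α K) (hμ : 0 ≤ μ) (hR : 0 ≤ R) (h₀ : |c₀| ≤ r)
    (h₁ : |c₁| ≤ r) (he : ‖e‖ ≤ 1) {t : ℝ} (ht : 0 ≤ t) :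
    ∫⁻ x, ‖flux α (v t) (v t) x‖ₑ
      ≤ ENNReal.ofReal K * ENNReal.ofReal (R + 12 * r) * ENNReal.ofReal (R + 12 * r) := by
  have := h.lintegral_le hμ hR h₀ h₁ he ht
  refine (VCHE.lintegral_flux_le hK (h.integrable ht) _).trans ?_
  gcongr

/-- The equation for the remainder: the pair equals its own heat flow, and `pairFlux` has zero
Duhamel integral and can be subtracted freely. The exceptional null set comes from splitting the
time integral. -/
lemma mildMap_sub_vortexPair (hα : 0 < α) (hK : VelBound α K) (hμ : 1 / 2 ≤ μ) (hμ1 : μ ≤ 1)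
    {c₀ c₁ r R t : ℝ} {e : Plane} (h₀ : |c₀| ≤ r) (h₁ : |c₁| ≤ r) (he : ‖e‖ ≤ 1) (hR : 0 ≤ R)
    {v₀ : Plane → ℝ} (hv₀ : Integrable v₀) {v : ℝ → Plane → ℝ} (hv : NearPair μ R c₀ c₁ e v)
    (ht : 0 < t) :
    ∀ᵐ x, mildMap α v₀ v t x - vortexPair c₀ c₁ e t x
      = heatConv t (fun y => v₀ y - vortexPair c₀ c₁ e 0 y) x
        - duhamel (remFlux α c₀ c₁ e v) t x := by
  have hK0 : 0 ≤ K := by linarith [hK.one_le]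
  have hr : 0 ≤ r := (abs_nonneg _).trans h₀
  have hFm := measurable_flux_uncurry hα hv.measurable hv.measurable
  have hGm := measurable_pairFlux hα c₀ c₁ e
  have hHm := measurable_remFlux hα c₀ c₁ e hv.measurable
  set B := ENNReal.ofReal K * ENNReal.ofReal (R + 12 * r) * ENNReal.ofReal (R + 12 * r)
  set M := 4128 * K * (2 * (12 * r + R) * R) + r ^ 2 * (4128 * K * (12384 ^ 2 * 4128)) with hM
  have hM0 : 0 ≤ M := by positivity
  have hFb : ∀ s ∈ Ioo 0 t, ∫⁻ y, ‖flux α (v s) (v s) y‖ₑ ≤ B := fun s hs =>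
    hv.lintegral_flux_le hK (by linarith) hR h₀ h₁ he hs.1.le
  have hGb : ∀ s ∈ Ioo 0 t, ∫⁻ y, ‖pairFlux α c₀ c₁ e s y‖ₑ ≤ B + ENNReal.ofReal M := by
    intro s hs
    have hb := (fluxBound_remFlux hα hK hμ hμ1 h₀ h₁ he hs.1.le hR hv.measurable
      (hv.rem s hs.1.le)).lintegral_le hM0 (by linarith) hs.1.le
    calc _ ≤ ∫⁻ y, (‖flux α (v s) (v s) y‖ₑ + ‖remFlux α c₀ c₁ e v s y‖ₑ) := by
          refine lintegral_mono fun y => ?_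
          have : pairFlux α c₀ c₁ e s y = flux α (v s) (v s) y - remFlux α c₀ c₁ e v s y := by
            simp [remFlux]
          rw [this]
          exact enorm_sub_le
      _ ≤ _ := by
          have hFs : Measurable (flux α (v s) (v s)) := hFm.comp (measurable_prodMk_left (x := s))
          rw [lintegral_add_left hFs.enorm]
          exact add_le_add (hFb s hs) hb
  have hBM : B + ENNReal.ofReal M ≠ ∞ := by finiteness
  filter_upwards [duhamel_sub_ae hFm hGm ht hBM (fun s hs => (hFb s hs).trans le_self_add) hGb]
    with x hx
  rw [duhamel_pairFlux hα, sub_zero] at hx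
  have e1 : heatConv t (fun y => v₀ y - vortexPair c₀ c₁ e 0 y) x
      = heatConv t v₀ x - vortexPair c₀ c₁ e t x := by
    rw [← heatConv_vortexPair ht x]
    simp only [heatConv, mul_sub]
    exact integral_sub (integrable_heatKernel_mul ht hv₀ x)
      (integrable_heatKernel_mul ht (integrable_vortexPair c₀ c₁ e le_rfl) x)
  rw [e1, mildMap, if_neg (not_le.2 ht), hx, sub_right_comm]
  rfl

lemma mildMap_sub_mildMap (hα : 0 < α) (hK : VelBound α K) (hμ : 0 ≤ μ) 
    {c₀ c₁ r R t : ℝ} {e : Plane} (h₀ : |c₀| ≤ r) (h₁ : |c₁| ≤ r) (he : ‖e‖ ≤ 1) (hR : 0 ≤ R)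
    {v₀ : Plane → ℝ} {v v' : ℝ → Plane → ℝ} (hv : NearPair μ R c₀ c₁ e v)
    (hv' : NearPair μ R c₀ c₁ e v') (ht : 0 < t) :
    ∀ᵐ x, mildMap α v₀ v t x - mildMap α v₀ v' t x
      = -duhamel (fun s y => flux α (v s) (v s) y - flux α (v' s) (v' s) y) t x := by
  filter_upwards [duhamel_sub_ae (measurable_flux_uncurry hα hv.measurable hv.measurable)
    (measurable_flux_uncurry hα hv'.measurable hv'.measurable) ht
    (by finiteness : ENNReal.ofReal K * ENNReal.ofReal (R + 12 * r) * ENNReal.ofReal (R + 12 * r) ≠ ∞)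
    (fun s hs => hv.lintegral_flux_le hK hμ hR h₀ h₁ he hs.1.le)
    (fun s hs => hv'.lintegral_flux_le hK hμ hR h₀ h₁ he hs.1.le)] with x hx
  rw [← hx, mildMap, mildMap, if_neg (not_le.2 ht), if_neg (not_le.2 ht)]
  ring

/-- Existence of a solution close to a small vortex pair. -/
theorem exists_mildMap_fixedPoint (hα : 0 < α) (hK : VelBound α K) (hμ : 1 / 2 ≤ μ) (hμ1 : μ < 1) :
    ∃ r₁ : ℝ, 0 < r₁ ∧ ∃ L : ℝ, 0 ≤ L ∧ ∀ r, 0 ≤ r → r ≤ r₁ → ∀ (c₀ c₁ : ℝ) (e : Plane) (v₀ : Plane → ℝ),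
      |c₀| ≤ r → |c₁| ≤ r → ‖e‖ ≤ 1 → Measurable v₀ → Integrable v₀ →
      InitBound μ r (fun y => v₀ y - vortexPair c₀ c₁ e 0 y) →
      ∃ v, NearPair μ (L * r) c₀ c₁ e v ∧ ∀ t, 0 ≤ t → v t =ᵐ[volume] mildMap α v₀ v t := by
  obtain ⟨Cd, hCd, hd⟩ := exists_remBound_duhamel (by linarith : 0 < μ) hμ1
  have hK0 : 0 ≤ K := by linarith [hK.one_le]
  obtain ⟨Cl, hCl⟩ : ∃ Cl : ℝ, Cl = 5 * 2064 * 8256 * 2 := ⟨_, rfl⟩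
  have hCl1 : 1 ≤ Cl := by rw [hCl]; norm_num
  obtain ⟨cD, hcD⟩ : ∃ cD : ℝ, cD = 12384 ^ 2 * 4128 := ⟨_, rfl⟩
  have hcD0 : 0 ≤ cD := by rw [hcD]; norm_num
  obtain ⟨E, hE⟩ : ∃ E : ℝ, E = Cd * (4128 * K) := ⟨_, rfl⟩
  have hE0 : 0 ≤ E := by rw [hE]; positivity
  -- With R = L r, the linear part Cl·r and a quadratic part of at most r together fit into R/2 = 2
  -- Cl·r, since Cl ≥ 1.
  obtain ⟨L, hL⟩ : ∃ L : ℝ, L = 4 * Cl := ⟨_, rfl⟩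
  have hL4 : 4 ≤ L := by linarith
  -- The Duhamel term is at most W r², and r ≤ 1/(W+1) makes this at most r. The Lipschitz constant
  -- E·2(12 + L)·r is at most W r/4 because L ≥ 4, so the map also contracts.
  set W := E * (2 * (12 + L) * L + cD) with hW
  have hW0 : 0 ≤ W := by positivity
  refine ⟨1 / (W + 1), by positivity, L, by linarith,
    fun r hr hr1 c₀ c₁ e v₀ h₀ h₁ he hv₀m hv₀ hQ => ?_⟩
  have hWr : W * r ≤ 1 := by
    rw [le_div_iff₀ (by positivity)] at hr1
    nlinarith
  have hR : 0 ≤ L * r := by positivity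
  refine Exists.imp ?_ (exists_fixedPoint (μ := μ) hR (A := vortexPair c₀ c₁ e)
    (Γ := mildMap α v₀) (measurable_vortexPair c₀ c₁ e) (fun v hv => measurable_mildMap hα hv₀m hv)
    ?_ ?_)
  · rintro v ⟨hvm, hvA, hfix⟩
    exact ⟨⟨hvm, hvA⟩, hfix⟩
  · intro v hvm hvA t ht
    have hv : NearPair μ (L * r) c₀ c₁ e v := ⟨hvm, hvA⟩
    rcases ht.eq_or_lt with rfl | ht
    · rw [add_zero]
      refine (hQ.remBound.mono (by norm_num) (by nlinarith : r ≤ L * r / 2)).congr_enorm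
        (.of_forall fun x => ?_)
      simp [mildMap]
    · have hlin := hQ.remBound_heatConv hr hμ hμ1.le ht
      have hduh := hd (remFlux α c₀ c₁ e v) (measurable_remFlux hα c₀ c₁ e hvm) _ (by positivity)
        (fun s hs => fluxBound_remFlux hα hK hμ hμ1.le h₀ h₁ he hs.le hR hvm (hvA s hs.le))
        (fun s hs => integral_remFlux hα c₀ c₁ e hs.le (hv.integrable hs.le)) t ht
      have hmeas : Measurable (heatConv t fun y => v₀ y - vortexPair c₀ c₁ e 0 y) :=
        (measurable_heatConv hQ.measurable).comp measurable_prodMk_left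
      refine (RemBound.of_enorm_le (by linarith) (by positivity) (by positivity) hmeas.aemeasurable
        hlin hduh ?_).mono (by linarith) ?_
      · filter_upwards [mildMap_sub_vortexPair hα hK hμ hμ1.le h₀ h₁ he hR hv₀ hv ht] with x hx
        rw [hx]
        exact enorm_sub_le
      · rw [← hCl, ← hcD]
        calc _ = Cl * r + W * r * r := by rw [hW, hE]; ring
          _ ≤ Cl * r + 1 * r := by gcongr
          _ ≤ L * r / 2 := by nlinarith
  · intro v v' hvm hvm' hvA hvA' N hN hd' t ht
    have hv : NearPair μ (L * r) c₀ c₁ e v := ⟨hvm, hvA⟩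
    have hv' : NearPair μ (L * r) c₀ c₁ e v' := ⟨hvm', hvA'⟩
    rcases ht.eq_or_lt with rfl | ht
    · simpa [mildMap] using remBound_zero (μ := μ) (S := 1 + 0) (N := N / 2)
    · have hFm := measurable_flux_uncurry hα hvm hvm
      have hGm := measurable_flux_uncurry hα hvm' hvm'
      have hduh := hd (fun s y => flux α (v s) (v s) y - flux α (v' s) (v' s) y) (hFm.sub hGm)
        _ (by positivity)
        (fun s hs => fluxBound_sub hα hK hμ hμ1.le (by linarith) (measurable_vortexPair_slice c₀ c₁ e s)
          (hv.measurable_slice s) (hv'.measurable_slice s) (by positivity : 0 ≤ 12 * r) hR hN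
          (gaussBound_vortexPair h₀ h₁ he hs.le) (hvA s hs.le) (hvA' s hs.le) (hd' s hs.le))
        (fun s hs => by
          have i1 := hv.integrable hs.le
          have i2 := hv'.integrable hs.le
          rw [integral_sub (integrable_flux hα i1 i1) (integrable_flux hα i2 i2),
            integral_flux_self hα i1, integral_flux_self hα i2, sub_zero]) t ht
      refine (hduh.congr_enorm ?_).mono (by linarith) ?_
      · filter_upwards [mildMap_sub_mildMap hα hK (by linarith) h₀ h₁ he hR (v₀ := v₀) hv hv' ht]
          with x hx
        rw [hx, enorm_neg]
      · have h2 : E * (2 * (12 + L)) * r ≤ 1 / 4 := by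
          have h3 : 4 * (E * (2 * (12 + L)) * r) ≤ W * r := by
            have : 0 ≤ E * r * cD := by positivity
            have h4 : 0 ≤ (L - 4) * (E * (2 * (12 + L)) * r) :=
              mul_nonneg (by linarith) (by positivity)
            rw [hW]; nlinarith
          linarith
        calc _ = E * (2 * (12 + L)) * r * N := by rw [hE]; ring
          _ ≤ 1 / 4 * N := by gcongr
          _ ≤ N / 2 := by linarith

end VCHE
end


noncomputable section

namespace VCHE

variable {α K : ℝ}

/-! ### Uniqueness -/

/-- The full integral over (0, ∞) is Γ(1/2) l^{-1/2}, and l is chosen to make it ε. The exponential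
weight plays the part of a Gronwall inequality for the singular kernel (t-s)^{-1/2}. -/
lemma exists_lintegral_exp_rpow_le {ε : ℝ} (hε : 0 < ε) :
    ∃ l : ℝ, 0 < l ∧ ∀ t : ℝ, ∫⁻ s in Ioo 0 t,
      ENNReal.ofReal ((t - s) ^ (-(1 / 2) : ℝ) * Real.exp (-(l * (t - s)))) ≤ ENNReal.ofReal ε := by
  have hG : 0 < Real.Gamma (1 / 2) := Real.Gamma_pos_of_pos (by norm_num)
  refine ⟨(Real.Gamma (1 / 2) / ε) ^ 2, by positivity, fun t => ?_⟩
  set l := (Real.Gamma (1 / 2) / ε) ^ 2 with hl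
  have hl0 : 0 < l := by positivity
  have hI := Real.integral_rpow_mul_exp_neg_mul_Ioi (a := 1 / 2) (r := l) (by norm_num) hl0
  have hval : (1 / l) ^ (1 / 2 : ℝ) * Real.Gamma (1 / 2) = ε := by
    rw [← Real.sqrt_eq_rpow, hl, Real.sqrt_div zero_le_one, Real.sqrt_one, Real.sqrt_sq (by positivity)]
    field_simp
  rw [hval] at hI
  have hint : IntegrableOn (fun τ : ℝ => τ ^ (1 / 2 - 1 : ℝ) * Real.exp (-(l * τ))) (Ioi 0) := by
    by_contra h
    rw [integral_undef h] at hI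
    exact hε.ne hI
  have hle : ∫⁻ τ in Ioi 0, ENNReal.ofReal (τ ^ (1 / 2 - 1 : ℝ) * Real.exp (-(l * τ)))
      ≤ ENNReal.ofReal ε := by
    rw [← ofReal_integral_eq_lintegral_ofReal hint, hI]
    refine (ae_restrict_mem measurableSet_Ioi).mono fun s hs => ?_
    have : 0 < s := hs
    simp only [Pi.zero_apply]
    positivity
  refine le_trans ?_ hle
  rw [← lintegral_indicator measurableSet_Ioo, ← lintegral_indicator measurableSet_Ioi,
    ← lintegral_sub_left_eq_self ((Ioi 0).indicator _) t]
  refine lintegral_mono fun s => ?_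
  by_cases h : s ∈ Ioo 0 t
  · rw [indicator_of_mem h, indicator_of_mem (show t - s ∈ Ioi 0 from sub_pos.2 h.2)]
    norm_num
  · rw [indicator_of_notMem h]
    exact bot_le

lemma enorm_lintegral_le_of_integral_abs_le {f : Plane → ℝ} (hf : Integrable f) {M : ℝ}
    (h : ∫ x, |f x| ≤ M) : ∫⁻ x, ‖f x‖ₑ ≤ ENNReal.ofReal M := by
  rw [← ofReal_integral_norm_eq_lintegral_enorm hf]
  exact ENNReal.ofReal_le_ofReal h

/-- A solution, written with a jointly measurable representative and the velocity kernel. -/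
lemma IsVorticitySolution.exists_measurable (hα : 0 < α) {v₀ : Plane → ℝ} {v : ℝ → Plane → ℝ}
    (h : IsVorticitySolution α v₀ v) :
    ∃ g : ℝ → Plane → ℝ, Measurable (Function.uncurry g) ∧
      (∃ M : ℝ, 0 ≤ M ∧ (∀ s, ∫⁻ x, ‖g s x‖ₑ ≤ ENNReal.ofReal M) ∧
        ∀ t, 0 ≤ t → ∫⁻ x, ‖v t x‖ₑ ≤ ENNReal.ofReal M) ∧
      (∀ᵐ s ∂(volume.restrict (Ici (0 : ℝ))), v s =ᵐ[volume] g s) ∧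
      ∀ t, 0 < t → ∀ᵐ x, v t x = heatConv t v₀ x - duhamel (fun s => flux α (g s) (g s)) t x := by
  obtain ⟨M, hM⟩ := h.bounded
  have hM0 : 0 ≤ M := (integral_nonneg fun x => abs_nonneg _).trans (hM 0 le_rfl)
  obtain ⟨g₁, hg₁, hvg⟩ := h.aestronglyMeasurable
  have hvg' := Measure.ae_ae_of_ae_prod hvg
  have hg₁m := hg₁.measurable
  have hlm : Measurable fun s => ∫⁻ x, ‖g₁ (s, x)‖ₑ := hg₁m.enorm.lintegral_prod_right'
  -- The representative is set to zero at the times when its mass exceeds M, a null set of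
  -- nonnegative times. The mass bound then holds at every time and not only at almost every one.
  let G : Set ℝ := {s | ∫⁻ x, ‖g₁ (s, x)‖ₑ ≤ ENNReal.ofReal M}
  have hG : MeasurableSet G := measurableSet_le hlm measurable_const
  have hvM : ∀ t, 0 ≤ t → ∫⁻ x, ‖v t x‖ₑ ≤ ENNReal.ofReal M := fun t ht =>
    enorm_lintegral_le_of_integral_abs_le (h.integrable t ht) (hM t ht)
  let g : ℝ → Plane → ℝ := fun s x => G.indicator (fun s => g₁ (s, x)) s
  have hgm : Measurable (Function.uncurry g) := by
    have : Function.uncurry g = (Prod.fst ⁻¹' G).indicator g₁ := by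
      funext q
      by_cases hq : q.1 ∈ G
      · simp [g, Function.uncurry, hq]
      · simp [g, Function.uncurry, hq]
    rw [this]
    exact hg₁m.indicator (measurable_fst hG)
  have hgb : ∀ s, ∫⁻ x, ‖g s x‖ₑ ≤ ENNReal.ofReal M := by
    intro s
    by_cases hs : s ∈ G
    · have hs' : ∫⁻ x, ‖g₁ (s, x)‖ₑ ≤ ENNReal.ofReal M := hs
      simpa only [g, indicator_of_mem hs] using hs'
    · simp [g, hs]
  have hvg2 : ∀ᵐ s ∂(volume.restrict (Ici (0 : ℝ))), v s =ᵐ[volume] g s := by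
    filter_upwards [hvg', ae_restrict_mem measurableSet_Ici] with s hs hs0
    have hsG : s ∈ G := by
      have : ∫⁻ x, ‖g₁ (s, x)‖ₑ = ∫⁻ x, ‖v s x‖ₑ :=
        lintegral_congr_ae (hs.mono fun x hx => by simp only at hx ⊢; rw [hx])
      exact this.trans_le (hvM s hs0)
    filter_upwards [hs] with x hx
    simpa [g, hsG] using hx
  refine ⟨g, hgm, ⟨M, hM0, hgb, hvM⟩, hvg2, fun t ht => ?_⟩
  obtain ⟨w, hw, hmild⟩ := h.mild
  filter_upwards [hmild t ht] with x hx
  rw [hx]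
  congr 1
  rw [duhamel]
  refine integral_congr_ae ?_
  have hsub : ∀ᵐ s ∂(volume.restrict (Ioo 0 t)), v s =ᵐ[volume] g s :=
    ae_restrict_of_ae_restrict_of_subset (fun s hs => hs.1.le) hvg2
  filter_upwards [hsub, ae_restrict_mem measurableSet_Ioo] with s hs hs0
  rw [convGrad]
  refine integral_congr_ae ?_
  filter_upwards [hs] with y hy
  rw [flux, biotSavart_eq_velocity hα (h.integrable s hs0.1.le) (hw s hs0.1.le), velocity_congr hs, hy]

lemma lintegral_flux_sub_flux_le (hα : 0 < α) (hK : VelBound α K) {f g : Plane → ℝ}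
    (hf : Measurable f) (hg : Measurable g) {M M' : ℝ} (hM : 0 ≤ M) (hM' : 0 ≤ M')
    (hfM : ∫⁻ x, ‖f x‖ₑ ≤ ENNReal.ofReal M) (hgM : ∫⁻ x, ‖g x‖ₑ ≤ ENNReal.ofReal M') :
    ∫⁻ y, ‖flux α f f y - flux α g g y‖ₑ
      ≤ ENNReal.ofReal (K * (M + M')) * ∫⁻ x, ‖f x - g x‖ₑ := by
  have hK0 : 0 ≤ K := by linarith [hK.one_le]
  have hfi : Integrable f := ⟨hf.aestronglyMeasurable, hfM.trans_lt ENNReal.ofReal_lt_top⟩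
  have hgi : Integrable g := ⟨hg.aestronglyMeasurable, hgM.trans_lt ENNReal.ofReal_lt_top⟩
  have hdi : Integrable (fun z => f z - g z) := hfi.sub hgi
  calc _ ≤ ∫⁻ y, (‖flux α (fun z => f z - g z) f y‖ₑ + ‖flux α g (fun z => f z - g z) y‖ₑ) := by
        refine lintegral_mono fun y => ?_
        rw [flux_sub_flux hα hfi hgi]
        exact enorm_add_le _ _
    _ ≤ ENNReal.ofReal K * (∫⁻ x, ‖f x - g x‖ₑ) * ENNReal.ofReal M
        + ENNReal.ofReal K * ENNReal.ofReal M' * ∫⁻ x, ‖f x - g x‖ₑ := by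
        rw [lintegral_add_left (measurable_flux hα hdi hf).enorm]
        refine add_le_add ((lintegral_flux_le hK hdi f).trans ?_) ((lintegral_flux_le hK hgi _).trans ?_)
        · gcongr
        · gcongr
    _ = _ := by
        rw [ENNReal.ofReal_mul hK0, ENNReal.ofReal_add hM hM']
        ring

/-- As the velocity kernel is bounded, the self-flux is Lipschitz on bounded sets of L¹, and the L¹
distance D of two solutions obeys D(t) ≤ c ∫ (t-s)^{-1/2} D(s) ds. Against the weight e^{lt}, with l
large, each use of this inequality halves the bound, whatever the size of the solutions. -/
theorem IsVorticitySolution.unique (hα : 0 < α) {v₀ : Plane → ℝ} {v v' : ℝ → Plane → ℝ}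
    (h : IsVorticitySolution α v₀ v) (h' : IsVorticitySolution α v₀ v') {t : ℝ} (ht : 0 ≤ t) :
    v' t =ᵐ[volume] v t := by
  obtain ⟨K, hK⟩ := exists_velBound hα
  have hK0 : 0 < K := by linarith [hK.one_le]
  obtain ⟨g, hgm, ⟨M, hM0, hgM, hvM⟩, hvg, hmild⟩ := h.exists_measurable hα
  obtain ⟨g', hgm', ⟨M', hM0', hgM', hvM'⟩, hvg', hmild'⟩ := h'.exists_measurable hα
  set c := 4128 * (K * (M + M')) with hc
  have hc0 : 0 ≤ c := by positivity
  -- This ε makes c·ε at most 1/2, which is the halving used in the induction.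
  obtain ⟨l, hl, hle⟩ := exists_lintegral_exp_rpow_le (ε := 1 / (2 * (c + 1))) (by positivity)
  have hFm := measurable_flux_uncurry hα hgm hgm
  have hGm := measurable_flux_uncurry hα hgm' hgm'
  have hslice : ∀ s, Measurable (g s) := fun s => hgm.comp measurable_prodMk_left
  have hslice' : ∀ s, Measurable (g' s) := fun s => hgm'.comp measurable_prodMk_left
  have hstep : ∀ t, 0 < t → ∫⁻ x, ‖v t x - v' t x‖ₑ ≤ ∫⁻ s in Ioo 0 t,
      ENNReal.ofReal (c * (t - s) ^ (-(1 / 2) : ℝ)) * ∫⁻ x, ‖v s x - v' s x‖ₑ := by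
    intro t ht
    have hFb : ∀ (u : ℝ → Plane → ℝ) (B : ℝ), (∀ s, Measurable (u s)) →
        (∀ s, ∫⁻ x, ‖u s x‖ₑ ≤ ENNReal.ofReal B) → ∀ s,
        ∫⁻ y, ‖flux α (u s) (u s) y‖ₑ ≤ ENNReal.ofReal K * ENNReal.ofReal B * ENNReal.ofReal B := by
      intro u B hu hB s
      have hi : Integrable (u s) := ⟨(hu s).aestronglyMeasurable, (hB s).trans_lt ENNReal.ofReal_lt_top⟩
      refine (lintegral_flux_le hK hi _).trans ?_
      gcongr <;> exact hB s
    have hsub := duhamel_sub_ae hFm hGm ht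
      (M := ENNReal.ofReal K * ENNReal.ofReal M * ENNReal.ofReal M
        + ENNReal.ofReal K * ENNReal.ofReal M' * ENNReal.ofReal M') (by finiteness)
      (fun s _ => (hFb g M hslice hgM s).trans le_self_add)
      (fun s _ => (hFb g' M' hslice' hgM' s).trans le_add_self)
    have hFG : Measurable (Function.uncurry fun s y =>
        flux α (g s) (g s) y - flux α (g' s) (g' s) y) := hFm.sub hGm
    have hw := lintegral_weight_duhamel_le hFG t (w := fun _ => 1) measurable_const
    simp only [one_mul] at hw
    calc _ = ∫⁻ x, ‖duhamel (fun s y => flux α (g s) (g s) y - flux α (g' s) (g' s) y) t x‖ₑ := by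
          refine lintegral_congr_ae ?_
          filter_upwards [hsub, hmild t ht, hmild' t ht] with x h1 h2 h3
          rw [← h1, h2, h3, ← enorm_neg]
          congr 1
          ring
      _ ≤ _ := hw
      _ ≤ _ := by
          refine lintegral_mono_ae ?_
          have e1 : ∀ᵐ s ∂(volume.restrict (Ioo 0 t)), v s =ᵐ[volume] g s :=
            ae_restrict_of_ae_restrict_of_subset (fun s hs => hs.1.le) hvg
          have e2 : ∀ᵐ s ∂(volume.restrict (Ioo 0 t)), v' s =ᵐ[volume] g' s :=
            ae_restrict_of_ae_restrict_of_subset (fun s hs => hs.1.le) hvg'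
          filter_upwards [e1, e2, ae_restrict_mem measurableSet_Ioo] with s hs hs' hst
          have hts : 0 < t - s := by linarith [hst.2]
          have hm : Measurable fun y => flux α (g s) (g s) y - flux α (g' s) (g' s) y :=
            (hFm.sub hGm).comp (measurable_prodMk_left (x := s))
          refine (lintegral_convGrad_le hts hm.aestronglyMeasurable).trans ?_
          refine (mul_le_mul_right (lintegral_flux_sub_flux_le hα hK (hslice s) (hslice' s) hM0 hM0'
            (hgM s) (hgM' s)) _).trans (le_of_eq ?_)
          rw [← mul_assoc, ← ENNReal.ofReal_mul (by positivity)]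
          congr 1
          · congr 1
            rw [hc]; ring
          · refine lintegral_congr_ae ?_
            filter_upwards [hs, hs'] with x hx hx'
            rw [hx, hx']
  have hbound : ∀ n : ℕ, ∀ t, 0 ≤ t → ∫⁻ x, ‖v t x - v' t x‖ₑ
      ≤ ENNReal.ofReal ((M + M') * Real.exp (l * t) / 2 ^ n) := by
    intro n
    induction n with
    | zero =>
      intro t ht
      calc _ ≤ ∫⁻ x, (‖v t x‖ₑ + ‖v' t x‖ₑ) := lintegral_mono fun x => enorm_sub_le
        _ ≤ ENNReal.ofReal (M + M') := by
            rw [lintegral_add_left' (h.integrable t ht).1.enorm, ENNReal.ofReal_add hM0 hM0']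
            exact add_le_add (hvM t ht) (hvM' t ht)
        _ ≤ _ := by
            apply ENNReal.ofReal_le_ofReal
            rw [pow_zero, div_one]
            exact le_mul_of_one_le_right (by positivity) (Real.one_le_exp (by positivity))
    | succ n ih =>
      intro t ht
      rcases ht.eq_or_lt with rfl | ht
      · have : ∫⁻ x, ‖v 0 x - v' 0 x‖ₑ = 0 := by
          rw [← lintegral_zero (μ := (volume : Measure Plane))]
          refine lintegral_congr_ae ?_
          filter_upwards [h.initial, h'.initial] with x hx hx'
          simp [hx, hx']
        rw [this]; exact bot_le
      · set b := (M + M') * Real.exp (l * t) / 2 ^ n with hb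
        have hb0 : 0 ≤ b := by positivity
        calc _ ≤ _ := hstep t ht
          _ ≤ ∫⁻ s in Ioo 0 t, ENNReal.ofReal (c * b) *
              ENNReal.ofReal ((t - s) ^ (-(1 / 2) : ℝ) * Real.exp (-(l * (t - s)))) := by
              refine setLIntegral_mono' measurableSet_Ioo fun s hs => ?_
              have hts : 0 < t - s := by linarith [hs.2]
              refine (mul_le_mul_right (ih s hs.1.le) _).trans (le_of_eq ?_)
              rw [← ENNReal.ofReal_mul (by positivity), ← ENNReal.ofReal_mul (by positivity)]
              congr 1
              rw [show Real.exp (l * s) = Real.exp (l * t) * Real.exp (-(l * (t - s))) by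
                rw [← Real.exp_add]; congr 1; ring, hb]
              ring
          _ ≤ ENNReal.ofReal (c * b) * ENNReal.ofReal (1 / (2 * (c + 1))) := by
              rw [lintegral_const_mul' _ _ ENNReal.ofReal_ne_top]
              gcongr
              exact hle t
          _ ≤ _ := by
              rw [← ENNReal.ofReal_mul (by positivity)]
              apply ENNReal.ofReal_le_ofReal
              rw [show (M + M') * Real.exp (l * t) / 2 ^ (n + 1) = b / 2 by
                rw [hb, pow_succ, div_div], mul_one_div, div_le_div_iff₀ (by positivity) two_pos]
              nlinarith
  have h0 : ∫⁻ x, ‖v t x - v' t x‖ₑ = 0 := by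
    have hlim : Filter.Tendsto (fun n : ℕ => ENNReal.ofReal ((M + M') * Real.exp (l * t) / 2 ^ n))
        Filter.atTop (nhds 0) := by
      rw [← ENNReal.ofReal_zero]
      refine (ENNReal.continuous_ofReal.tendsto 0).comp ?_
      have := (tendsto_pow_atTop_nhds_zero_of_lt_one (r := (1 / 2 : ℝ)) (by norm_num)
        (by norm_num)).const_mul ((M + M') * Real.exp (l * t))
      rw [mul_zero] at this
      refine this.congr fun n => ?_
      rw [one_div, inv_pow, div_eq_mul_inv]
    exact le_antisymm (ge_of_tendsto' hlim fun n => hbound n t ht) bot_le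
  have hdm : AEStronglyMeasurable (fun x => v t x - v' t x) volume :=
    (h.integrable t ht).1.sub (h'.integrable t ht).1
  rw [lintegral_eq_zero_iff' hdm.enorm] at h0
  filter_upwards [h0] with x hx
  simp only [Pi.zero_apply, enorm_eq_zero, sub_eq_zero] at hx
  exact hx.symm

end VCHE
end


noncomputable section

namespace VCHE

variable {α K μ : ℝ}

/-! ### Solutions and initial data -/

lemma NearPair.isVorticitySolution (hα : 0 < α) (hμ : 0 ≤ μ) {R c₀ c₁ r : ℝ} {e : Plane} (hR : 0 ≤ R)
    (h₀ : |c₀| ≤ r) (h₁ : |c₁| ≤ r) (he : ‖e‖ ≤ 1) {v₀ f : Plane → ℝ} (hf : v₀ =ᵐ[volume] f)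
    {v : ℝ → Plane → ℝ} (h : NearPair μ R c₀ c₁ e v)
    (hfix : ∀ t, 0 ≤ t → v t =ᵐ[volume] mildMap α f v t) : IsVorticitySolution α v₀ v where
  aestronglyMeasurable := h.measurable.aestronglyMeasurable
  integrable t ht := h.integrable ht
  bounded := by
    have hr : 0 ≤ r := (abs_nonneg _).trans h₀
    refine ⟨R + 12 * r, fun t ht => ?_⟩
    have h1 := h.lintegral_le hμ hR h₀ h₁ he ht
    rw [← ofReal_integral_norm_eq_lintegral_enorm (h.integrable ht)] at h1
    exact (ENNReal.ofReal_le_ofReal_iff (by positivity)).1 h1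
  initial := by
    filter_upwards [hfix 0 le_rfl, hf] with x hx hx'
    rw [hx, hx', mildMap, if_pos le_rfl]
  mild := by
    refine ⟨fun s => besselFilter α (v s), fun s hs =>
      isHelmholtzFilter_besselFilter hα (h.integrable hs), fun t ht => ?_⟩
    filter_upwards [hfix t ht.le] with x hx
    rw [hx, mildMap, if_neg (not_le.2 ht)]
    congr 1
    · refine integral_congr_ae ?_
      filter_upwards [hf] with y hy
      rw [hy]
    · refine setIntegral_congr_fun measurableSet_Ioo fun s hs => ?_
      simp only [convGrad, flux]
      congr 1 with y : 1
      rw [biotSavart_eq_velocity hα (h.integrable hs.1.le)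
        (isHelmholtzFilter_besselFilter hα (h.integrable hs.1.le))]

/-- Cauchy-Schwarz against the weight of `L²(3)`. -/
lemma exists_lintegral_moment_le (hμ0 : 0 ≤ μ) (hμ : μ < 1) :
    ∃ C : ℝ, 0 ≤ C ∧ ∀ (f : Plane → ℝ) (r : ℝ), Measurable f →
      weightedNorm 3 f ≤ ENNReal.ofReal r →
      ∫⁻ y, ENNReal.ofReal (1 + ‖y‖ ^ (2 * μ)) * ‖f y‖ₑ ≤ ENNReal.ofReal (C * r) := by
  have hfin : Module.finrank ℝ Plane = 2 := by simp [Plane]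
  -- This is the square of the weight (1+|x|²)^{-(3-2μ)/2} left over once (1+|x|²)^{3/2} has been
  -- given to f. It is integrable on the plane because 6 - 4μ > 2, that is μ < 1.
  have hint : Integrable (fun x : Plane => (1 + ‖x‖ ^ 2) ^ (-(6 - 4 * μ) / 2)) :=
    integrable_rpow_neg_one_add_norm_sq (by rw [hfin]; push_cast; linarith)
  set I := ∫⁻ x : Plane, ENNReal.ofReal ((1 + ‖x‖ ^ 2) ^ (-(6 - 4 * μ) / 2)) with hI
  have hI' : I ≠ ∞ := by
    rw [hI, ← ofReal_integral_eq_lintegral_ofReal hint (.of_forall fun x => by positivity)]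
    exact ENNReal.ofReal_ne_top
  have hIr : I ^ (1 / 2 : ℝ) ≠ ∞ := ENNReal.rpow_ne_top_of_nonneg (by norm_num) hI'
  refine ⟨2 * (I ^ (1 / 2 : ℝ)).toReal, by positivity, fun f r hf hr => ?_⟩
  have hpt : ∀ y : Plane, ENNReal.ofReal (1 + ‖y‖ ^ (2 * μ)) * ‖f y‖ₑ
      ≤ ENNReal.ofReal 2 * (ENNReal.ofReal ((1 + ‖y‖ ^ 2) ^ (-(3 - 2 * μ) / 2))
        * ‖√(1 + ‖y‖ ^ 2) ^ 3 * f y‖ₑ) := by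
    intro y
    have h1 : 0 < 1 + ‖y‖ ^ 2 := by positivity
    rw [enorm_mul, ← mul_assoc, ← mul_assoc, Real.enorm_eq_ofReal_abs (√(1 + ‖y‖ ^ 2) ^ 3),
      abs_of_nonneg (by positivity), ← ENNReal.ofReal_mul (by norm_num),
      ← ENNReal.ofReal_mul (by positivity)]
    gcongr
    have e1 : √(1 + ‖y‖ ^ 2) ^ 3 = (1 + ‖y‖ ^ 2) ^ (3 / 2 : ℝ) := by
      rw [Real.sqrt_eq_rpow, ← Real.rpow_natCast, ← Real.rpow_mul h1.le]; norm_num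
    rw [e1, mul_assoc, ← Real.rpow_add h1, show -(3 - 2 * μ) / 2 + 3 / 2 = μ by ring,
      Real.rpow_mul (norm_nonneg y), Real.rpow_two]
    have g1 : 1 ≤ (1 + ‖y‖ ^ 2) ^ μ := Real.one_le_rpow (by nlinarith [sq_nonneg ‖y‖]) hμ0
    have g2 : (‖y‖ ^ 2) ^ μ ≤ (1 + ‖y‖ ^ 2) ^ μ := by gcongr; linarith
    linarith
  calc _ ≤ _ := lintegral_mono hpt
    _ = ENNReal.ofReal 2 * ∫⁻ y : Plane, ENNReal.ofReal ((1 + ‖y‖ ^ 2) ^ (-(3 - 2 * μ) / 2))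
        * ‖√(1 + ‖y‖ ^ 2) ^ 3 * f y‖ₑ := lintegral_const_mul' _ _ ENNReal.ofReal_ne_top
    _ ≤ ENNReal.ofReal 2 * (I ^ (1 / 2 : ℝ) * weightedNorm 3 f) := by
        gcongr
        refine (ENNReal.lintegral_mul_le_Lp_mul_Lq volume Real.HolderConjugate.two_two
          (Measurable.aemeasurable (by fun_prop)) (Measurable.aemeasurable (by fun_prop))).trans ?_
        apply le_of_eq
        congr 1
        · rw [hI]
          congr 1
          refine lintegral_congr fun x => ?_
          rw [ENNReal.rpow_two, ← ENNReal.ofReal_pow (by positivity), ← Real.rpow_natCast, ← Real.rpow_mul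
            (by positivity)]
          congr 2
          push_cast; ring
        · rw [weightedNorm, eLpNorm_eq_lintegral_rpow_enorm_toReal (by norm_num) (by norm_num)]
          simp
    _ ≤ _ := by
        rw [mul_assoc, ENNReal.ofReal_mul (by norm_num), ENNReal.ofReal_mul ENNReal.toReal_nonneg,
          ENNReal.ofReal_toReal hIr]
        gcongr

lemma lintegral_sq_le_of_weightedNorm_le {f : Plane → ℝ} {r : ℝ}
    (h : weightedNorm 3 f ≤ ENNReal.ofReal r) :
    ∫⁻ x, ‖f x‖ₑ ^ (2 : ℝ) ≤ ENNReal.ofReal r ^ (2 : ℝ) := by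
  rw [weightedNorm, eLpNorm_eq_lintegral_rpow_enorm_toReal (by norm_num) (by norm_num)] at h
  simp only [ENNReal.toReal_ofNat] at h
  have h2 := ENNReal.rpow_le_rpow h (by norm_num : (0 : ℝ) ≤ 2)
  rw [← ENNReal.rpow_mul, one_div, inv_mul_cancel₀ two_ne_zero, ENNReal.rpow_one] at h2
  refine le_trans (lintegral_mono fun x => ENNReal.rpow_le_rpow ?_ (by norm_num)) h2
  rw [← ofReal_norm, ← ofReal_norm, norm_mul]
  apply ENNReal.ofReal_le_ofReal
  refine le_mul_of_one_le_left (norm_nonneg _) ?_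
  rw [Real.norm_of_nonneg (by positivity)]
  exact one_le_pow₀ (Real.one_le_sqrt.2 (by nlinarith [sq_nonneg ‖x‖]))

/-- Minkowski's inequality for powers. -/
lemma lintegral_add_rpow_le {p : ℝ} (hp : 1 ≤ p) {f g : Plane → ℝ≥0∞} (hf : AEMeasurable f)
    (hg : AEMeasurable g) {c d : ℝ≥0∞} (hc : ∫⁻ x, f x ^ p ≤ c ^ p) (hd : ∫⁻ x, g x ^ p ≤ d ^ p) :
    ∫⁻ x, (f x + g x) ^ p ≤ (c + d) ^ p := by
  have hp0 : 0 < p := by linarith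
  have h := ENNReal.lintegral_Lp_add_le hf hg hp
  have h2 : (∫⁻ x, (f x + g x) ^ p) ^ (1 / p) ≤ c + d := by
    refine h.trans (add_le_add ?_ ?_)
    · rw [one_div]; exact ENNReal.rpow_inv_le_iff hp0 |>.2 hc
    · rw [one_div]; exact ENNReal.rpow_inv_le_iff hp0 |>.2 hd
  rw [one_div] at h2
  exact (ENNReal.rpow_inv_le_iff hp0).1 h2

lemma GaussBound.lintegral_rpow_le {S m p : ℝ} {g : Plane → ℝ} (h : GaussBound S m g) (hm : 0 ≤ m)
    (hS : 0 < S) (hp : 1 ≤ p) :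
    ∫⁻ x, ‖g x‖ₑ ^ p ≤ ENNReal.ofReal (m * S ^ (-1 + 1 / p)) ^ p := by
  have hp0 : 0 < p := by linarith
  calc _ ≤ ∫⁻ x, ENNReal.ofReal m ^ p * ENNReal.ofReal (heatKernel (4 * S) (x - 0)) ^ p := by
        refine lintegral_mono fun x => ?_
        rw [← ENNReal.mul_rpow_of_nonneg _ _ hp0.le, ← ENNReal.ofReal_mul hm, sub_zero]
        exact ENNReal.rpow_le_rpow (h.enorm_le x) hp0.le
    _ ≤ ENNReal.ofReal m ^ p * ENNReal.ofReal ((4 * S) ^ (1 - p)) := by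
        rw [lintegral_const_mul' _ _ (ENNReal.rpow_ne_top_of_nonneg hp0.le ENNReal.ofReal_ne_top)]
        gcongr
        exact lintegral_heatKernel_rpow_le (by positivity) hp 0
    _ ≤ _ := by
        rw [ENNReal.ofReal_mul hm, ENNReal.mul_rpow_of_nonneg _ _ hp0.le]
        gcongr
        rw [ENNReal.ofReal_rpow_of_nonneg (by positivity) hp0.le]
        apply ENNReal.ofReal_le_ofReal
        rw [← Real.rpow_mul hS.le, show (-1 + 1 / p) * p = 1 - p by field_simp; ring]
        exact Real.rpow_le_rpow_of_nonpos hS (by linarith) (by linarith)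

/-- With a the mass and b the vector of negated first moments, the choice is c₁ = |b|, e = b/|b|, c₀
= a - |b|. A vortex of strength c₁ centred at -e has first moments -c₁e = -b, so the pair matches
the data while e stays in the unit ball. -/
lemma exists_vortexPair_of_weightedNorm_le (hμ : 1 / 2 ≤ μ) (hμ1 : μ < 1) :
    ∃ C : ℝ, 0 < C ∧ ∀ (f : Plane → ℝ) (r : ℝ), 0 ≤ r → Measurable f →
      weightedNorm 3 f ≤ ENNReal.ofReal r →
      ∃ (c₀ c₁ : ℝ) (e : Plane), |c₀| ≤ C * r ∧ |c₁| ≤ C * r ∧ ‖e‖ ≤ 1 ∧ c₀ + c₁ = ∫ y, f y ∧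
        (∀ i, c₁ * e i = -∫ y : Plane, y i * f y) ∧ Integrable f ∧
        InitBound μ (C * r) (fun y => f y - vortexPair c₀ c₁ e 0 y) ∧
        ∫⁻ y, ‖f y - vortexPair c₀ c₁ e 0 y‖ₑ ^ (2 : ℝ) ≤ ENNReal.ofReal (C * r) ^ (2 : ℝ) := by
  obtain ⟨C, hC, hmom⟩ := exists_lintegral_moment_le (by linarith : 0 ≤ μ) hμ1
  refine ⟨1 + C + 3 * C * (12 * 8257), by positivity, fun f r hr hf hw => ?_⟩
  have hm := hmom f r hf hw
  have hCr : 0 ≤ C * r := by positivity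
  have hmass : ∫⁻ y, ‖f y‖ₑ ≤ ENNReal.ofReal (C * r) := by
    refine le_trans (lintegral_mono fun y => ?_) hm
    refine le_mul_of_one_le_left bot_le ?_
    rw [← ENNReal.ofReal_one]
    exact ENNReal.ofReal_le_ofReal (by have : 0 ≤ ‖y‖ ^ (2 * μ) := by positivity
                                       linarith)
  have hi : Integrable f := ⟨hf.aestronglyMeasurable, hmass.trans_lt ENNReal.ofReal_lt_top⟩
  have hci : ∀ i, ∫⁻ y : Plane, ‖y i * f y‖ₑ ≤ ENNReal.ofReal (C * r) := by
    intro i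
    refine le_trans (lintegral_mono fun y => ?_) hm
    rw [enorm_mul, ← ofReal_norm]
    gcongr
    refine (PiLp.norm_apply_le y i).trans ?_
    rcases le_total ‖y‖ 1 with h1 | h1
    · have : 0 ≤ ‖y‖ ^ (2 * μ) := by positivity
      linarith
    · have : ‖y‖ ^ (1 : ℝ) ≤ ‖y‖ ^ (2 * μ) := Real.rpow_le_rpow_of_exponent_le h1 (by linarith)
      rw [Real.rpow_one] at this
      linarith
  have hii : ∀ i, Integrable (fun y : Plane => y i * f y) := fun i =>
    ⟨(Measurable.mul (by fun_prop) hf).aestronglyMeasurable, (hci i).trans_lt ENNReal.ofReal_lt_top⟩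
  have habs : ∀ g : Plane → ℝ, ∫⁻ y, ‖g y‖ₑ ≤ ENNReal.ofReal (C * r) → |∫ y, g y| ≤ C * r := by
    intro g hg
    have := (enorm_integral_le_lintegral_enorm g).trans hg
    rw [← ofReal_norm, ENNReal.ofReal_le_ofReal_iff hCr] at this
    exact this
  set a := ∫ y, f y with ha
  set b : Plane := WithLp.toLp 2 fun i => -∫ y : Plane, y i * f y with hb
  have hbi : ∀ i, b i = -∫ y : Plane, y i * f y := fun i => rfl
  have hbn : ‖b‖ ≤ 2 * (C * r) := by
    rw [EuclideanSpace.norm_eq]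
    refine Real.sqrt_le_iff.2 ⟨by positivity, ?_⟩
    have h0 := habs _ (hci 0)
    have h1 := habs _ (hci 1)
    rw [Fin.sum_univ_two, hbi, hbi, norm_neg, norm_neg, Real.norm_eq_abs, Real.norm_eq_abs]
    nlinarith [abs_nonneg (∫ y : Plane, y 0 * f y), abs_nonneg (∫ y : Plane, y 1 * f y)]
  -- For b = 0 the inverse is 0 by convention, so e = 0 and the identity persists.
  have hce : ∀ i, ‖b‖ * (‖b‖⁻¹ • b) i = b i := by
    intro i
    rcases eq_or_ne ‖b‖ 0 with h | h
    · have : b = 0 := norm_eq_zero.1 h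
      simp [this]
    · simp [h]
  have he : ‖‖b‖⁻¹ • b‖ ≤ 1 := by
    rw [norm_smul, norm_inv, norm_norm]
    exact inv_mul_le_one
  set e := ‖b‖⁻¹ • b with hedef
  have hc0 : |a - ‖b‖| ≤ 3 * (C * r) := by
    have h1 := habs f hmass
    have h2 : |a - ‖b‖| ≤ |a| + |‖b‖| := abs_sub _ _
    rw [abs_norm] at h2
    linarith
  have hc1 : |‖b‖| ≤ 3 * (C * r) := by rw [abs_norm]; linarith
  have hA := gaussBound_vortexPair hc0 hc1 he le_rfl
  rw [add_zero] at hA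
  have hAm := measurable_vortexPair_slice (a - ‖b‖) ‖b‖ e 0
  have hQm : Measurable fun y => f y - vortexPair (a - ‖b‖) ‖b‖ e 0 y := hf.sub hAm
  have hCle : 3 * (C * r) ≤ (1 + C + 3 * C * (12 * 8257)) * r := by nlinarith
  have ik := integrable_heatKernel one_pos
  have iks := integrable_heatKernel_shift one_pos e
  have icA : ∀ i, Integrable fun y : Plane => y i * vortexPair (a - ‖b‖) ‖b‖ e 0 y := by
    intro i
    refine (((integrable_coord_mul_heatKernel one_pos i).const_mul (a - ‖b‖)).add
      ((integrable_coord_mul_heatKernel_shift one_pos e i).const_mul ‖b‖)).congr (.of_forall fun y => ?_)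
    simp only [vortexPair, add_zero, Pi.add_apply]
    ring
  refine ⟨a - ‖b‖, ‖b‖, e, hc0.trans hCle, hc1.trans hCle, he, by ring, fun i => by rw [hce, hbi], hi,
    ⟨hQm, fun i => ?_, ?_, fun i => ?_, ?_⟩, ?_⟩
  · simp_rw [mul_sub]
    exact (hii i).sub (icA i)
  · rw [integral_sub hi (integrable_vortexPair _ _ e le_rfl)]
    simp only [vortexPair, add_zero]
    rw [integral_add (ik.const_mul _) (iks.const_mul _), integral_const_mul, integral_const_mul,
      integral_heatKernel one_pos, integral_heatKernel_shift one_pos]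
    ring
  · simp_rw [mul_sub]
    rw [integral_sub (hii i) (icA i)]
    have : ∫ y : Plane, y i * vortexPair (a - ‖b‖) ‖b‖ e 0 y = -b i := by
      have e1 : (fun y : Plane => y i * vortexPair (a - ‖b‖) ‖b‖ e 0 y) = fun y =>
          (a - ‖b‖) * (y i * heatKernel 1 y) + ‖b‖ * (y i * heatKernel 1 (y + e)) := by
        funext y; simp only [vortexPair, add_zero]; ring
      rw [e1, integral_add ((integrable_coord_mul_heatKernel one_pos i).const_mul _)
        ((integrable_coord_mul_heatKernel_shift one_pos e i).const_mul _), integral_const_mul,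
        integral_const_mul, integral_coord_mul_heatKernel, integral_coord_mul_heatKernel_shift one_pos,
        ← hce i]
      ring
    rw [this, hbi]
    ring
  · calc _ ≤ ∫⁻ y, (ENNReal.ofReal (1 + ‖y‖ ^ (2 * μ)) * ‖f y‖ₑ
          + ENNReal.ofReal (12 * (3 * (C * r))) * (ENNReal.ofReal (heatKernel 4 y)
            + ENNReal.ofReal 8256 * ENNReal.ofReal (heatKernel (2 * 4) y))) := by
          refine lintegral_mono fun y => ?_
          calc _ ≤ ENNReal.ofReal (1 + ‖y‖ ^ (2 * μ)) *
                (‖f y‖ₑ + ‖vortexPair (a - ‖b‖) ‖b‖ e 0 y‖ₑ) := by gcongr; exact enorm_sub_le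
            _ ≤ _ := by
              rw [mul_add]
              refine add_le_add le_rfl ?_
              have k1 := heatKernel_nonneg (by norm_num : (0 : ℝ) ≤ 4) y
              have k2 := heatKernel_nonneg (by norm_num : (0 : ℝ) ≤ 2 * 4) y
              rw [← ENNReal.ofReal_mul (by norm_num), ← ENNReal.ofReal_add k1 (by positivity),
                ← ENNReal.ofReal_mul (by positivity), ← ofReal_norm, ← ENNReal.ofReal_mul (by positivity)]
              apply ENNReal.ofReal_le_ofReal
              have g1 := rpow_norm_mul_heatKernel_le (k := 2 * μ) four_pos (by linarith) (by linarith) y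
              have g2 : (4 : ℝ) ^ (2 * μ / 2) ≤ 4 := by
                calc (4 : ℝ) ^ (2 * μ / 2) ≤ 4 ^ (1 : ℝ) :=
                      Real.rpow_le_rpow_of_exponent_le (by norm_num) (by linarith)
                  _ = 4 := Real.rpow_one 4
              have g3 : ‖y‖ ^ (2 * μ) * heatKernel 4 y ≤ 8256 * heatKernel (2 * 4) y := by
                refine g1.trans ?_
                gcongr ?_ * _
                linarith
              calc _ ≤ (1 + ‖y‖ ^ (2 * μ)) * (12 * (3 * (C * r)) * heatKernel (4 * 1) y) := by
                    gcongr; exact hA y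
                _ = 12 * (3 * (C * r)) * (heatKernel 4 y + ‖y‖ ^ (2 * μ) * heatKernel 4 y) := by
                    rw [mul_one]; ring
                _ ≤ _ := by gcongr 12 * (3 * (C * r)) * (_ + ?_)
      _ ≤ ENNReal.ofReal (C * r) + ENNReal.ofReal (12 * (3 * (C * r))) * (1 + ENNReal.ofReal 8256 * 1) := by
          have hk := continuous_heatKernel 4
          rw [lintegral_add_left (by fun_prop), lintegral_const_mul' _ _ ENNReal.ofReal_ne_top,
            lintegral_add_left (by fun_prop), lintegral_const_mul' _ _ ENNReal.ofReal_ne_top,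
            lintegral_heatKernel (by norm_num), lintegral_heatKernel (by norm_num)]
          gcongr
      _ ≤ _ := by
          rw [mul_one, ← ENNReal.ofReal_one, ← ENNReal.ofReal_add zero_le_one (by norm_num),
            ← ENNReal.ofReal_mul (by positivity), ← ENNReal.ofReal_add hCr (by positivity)]
          apply ENNReal.ofReal_le_ofReal
          nlinarith
  · refine (lintegral_mono fun y => ENNReal.rpow_le_rpow enorm_sub_le (by norm_num)).trans
      ((lintegral_add_rpow_le (by norm_num) hf.enorm.aemeasurable hAm.enorm.aemeasurable
        (lintegral_sq_le_of_weightedNorm_le hw)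
        (hA.lintegral_rpow_le (by positivity) one_pos (by norm_num))).trans ?_)
    refine ENNReal.rpow_le_rpow ?_ (by norm_num)
    rw [Real.one_rpow, ← ENNReal.ofReal_add hr (by positivity)]
    apply ENNReal.ofReal_le_ofReal
    nlinarith

end VCHE
end


noncomputable section

namespace VCHE

variable {α K μ S : ℝ}

/-! ### Decay in `L^p` -/

/-- Hölder's inequality with weights 2-p and p-1. The powers of S match since (2-p)(-μ) +
2(p-1)(-1/2-μ) = p(-1-μ+1/p). -/
lemma lintegral_rpow_le_of_interpolation {p N : ℝ} (hp : 1 ≤ p) (hp2 : p ≤ 2) (hS : 0 < S) (hN : 0 ≤ N)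
    {f : Plane → ℝ} (hf : AEStronglyMeasurable f volume)
    (h1 : ∫⁻ x, ‖f x‖ₑ ≤ ENNReal.ofReal (N * S ^ (-μ)))
    (h2 : ∫⁻ x, ‖f x‖ₑ ^ (2 : ℝ) ≤ ENNReal.ofReal (N * S ^ (-1 - μ + 1 / 2)) ^ (2 : ℝ)) :
    ∫⁻ x, ‖f x‖ₑ ^ p ≤ ENNReal.ofReal (N * S ^ (-1 - μ + 1 / p)) ^ p := by
  have hp0 : 0 < p := by linarith
  have h := ENNReal.lintegral_mul_norm_pow_le (μ := (volume : Measure Plane)) hf.enorm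
    (hf.enorm.pow_const (2 : ℝ)) (p := 2 - p) (q := p - 1) (by linarith) (by linarith) (by ring)
  calc ∫⁻ x, ‖f x‖ₑ ^ p = ∫⁻ x, ‖f x‖ₑ ^ (2 - p) * (‖f x‖ₑ ^ (2 : ℝ)) ^ (p - 1) := by
        refine lintegral_congr fun x => ?_
        rw [← ENNReal.rpow_mul, ← ENNReal.rpow_add_of_nonneg _ _ (by linarith) (by linarith)]
        congr 1; ring
    _ ≤ _ := h
    _ ≤ ENNReal.ofReal (N * S ^ (-μ)) ^ (2 - p)
        * (ENNReal.ofReal (N * S ^ (-1 - μ + 1 / 2)) ^ (2 : ℝ)) ^ (p - 1) := by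
        exact mul_le_mul' (ENNReal.rpow_le_rpow h1 (by linarith)) (ENNReal.rpow_le_rpow h2 (by linarith))
    _ = _ := by
        rw [← ENNReal.rpow_mul, ENNReal.ofReal_rpow_of_nonneg (by positivity) (by linarith),
          ENNReal.ofReal_rpow_of_nonneg (by positivity) (by linarith),
          ENNReal.ofReal_rpow_of_nonneg (by positivity) (by linarith),
          ← ENNReal.ofReal_mul (by positivity)]
        congr 1
        rw [Real.mul_rpow hN (by positivity), Real.mul_rpow hN (by positivity),
          Real.mul_rpow hN (by positivity), ← Real.rpow_mul hS.le, ← Real.rpow_mul hS.le,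
          ← Real.rpow_mul hS.le, mul_mul_mul_comm, ← Real.rpow_add hS,
          ← Real.rpow_add_of_nonneg hN (by linarith) (by linarith)]
        congr 2
        · ring
        · field_simp; ring

lemma rpow_neg_le_four_mul {t k : ℝ} (ht : 1 ≤ t) (hk : 0 ≤ k) (hk2 : k ≤ 2) :
    t ^ (-k) ≤ 4 * (1 + t) ^ (-k) := by
  have h := rpow_neg_le_of_one_le ht (by linarith : 0 ≤ k / 2) (by linarith)
  have ht0 : 0 < t := by linarith
  have hT : 0 < 1 + t := by linarith
  calc t ^ (-k) = t ^ (-(k / 2)) * t ^ (-(k / 2)) := by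
        rw [← Real.rpow_add ht0]; congr 1; ring
    _ ≤ 2 * (1 + t) ^ (-(k / 2)) * (2 * (1 + t) ^ (-(k / 2))) := by gcongr
    _ = 4 * ((1 + t) ^ (-(k / 2)) * (1 + t) ^ (-(k / 2))) := by ring
    _ = _ := by rw [← Real.rpow_add hT]; congr 2; ring

lemma one_le_four_mul_rpow_neg {t k : ℝ} (ht0 : 0 ≤ t) (ht : t ≤ 1) (hk2 : k ≤ 2) :
    1 ≤ 4 * (1 + t) ^ (-k) := by
  have h := one_le_rpow_neg (k := k / 2) ht0 ht (by linarith)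
  have hT : 0 < 1 + t := by linarith
  calc (1 : ℝ) ≤ 2 * (1 + t) ^ (-(k / 2)) * (2 * (1 + t) ^ (-(k / 2))) := one_le_mul_of_one_le_of_one_le h h
    _ = 4 * ((1 + t) ^ (-(k / 2)) * (1 + t) ^ (-(k / 2))) := by ring
    _ = _ := by rw [← Real.rpow_add hT]; congr 2; ring

lemma InitBound.lintegral_rpow_le {r p : ℝ} (hr : 0 ≤ r) (hp : 1 ≤ p) (hp2 : p ≤ 2) {f : Plane → ℝ}
    (h : InitBound μ r f) (h2 : ∫⁻ x, ‖f x‖ₑ ^ (2 : ℝ) ≤ ENNReal.ofReal r ^ (2 : ℝ)) :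
    ∫⁻ x, ‖f x‖ₑ ^ p ≤ ENNReal.ofReal r ^ p := by
  have := lintegral_rpow_le_of_interpolation (μ := μ) hp hp2 one_pos hr
    h.measurable.aestronglyMeasurable (by simpa using h.lintegral_le) (by simpa using h2)
  simpa using this

lemma InitBound.lintegral_heatConv_rpow_le {r p t : ℝ} (hr : 0 ≤ r) (hp : 1 ≤ p) (hp2 : p ≤ 2)
    (hμ : 1 / 2 ≤ μ) (hμ1 : μ ≤ 1) {f : Plane → ℝ} (h : InitBound μ r f)
    (h2 : ∫⁻ x, ‖f x‖ₑ ^ (2 : ℝ) ≤ ENNReal.ofReal r ^ (2 : ℝ)) (ht : 0 < t) :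
    ∫⁻ x, ‖heatConv t f x‖ₑ ^ p ≤ ENNReal.ofReal (66048 * r * (1 + t) ^ (-1 - μ + 1 / p)) ^ p := by
  have hp0 : 0 < p := by linarith
  have hp1 : 1 / p ≤ 1 := by rw [div_le_one hp0]; exact hp
  have hp3 : 0 < 1 / p := by positivity
  have hT : 0 < 1 + t := by linarith
  have e : -1 - μ + 1 / p = -(1 + μ - 1 / p) := by ring
  rcases le_total 1 t with ht1 | ht1
  · have hw2 := h.lintegral_weight_le zero_le_one (w := fun y => ‖y‖ ^ (2 * μ)) (fun y => by linarith)
    rw [one_mul] at hw2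
    refine (lintegral_heatConv_rpow_le_of_moments ht hμ hμ1 hp h.integrable
      h.integrable_coord h.integral_eq h.integral_coord_eq).trans (ENNReal.rpow_le_rpow ?_ hp0.le)
    refine (mul_le_mul_right hw2 _).trans ?_
    rw [← ENNReal.ofReal_mul (by positivity)]
    apply ENNReal.ofReal_le_ofReal
    have := rpow_neg_le_four_mul ht1 (by linarith : 0 ≤ 1 + μ - 1 / p) (by linarith)
    rw [show -μ + (1 / p - 1) = -(1 + μ - 1 / p) by ring, e]
    calc 16512 * t ^ (-(1 + μ - 1 / p)) * r
        ≤ 16512 * (4 * (1 + t) ^ (-(1 + μ - 1 / p))) * r := by gcongr 16512 * ?_ * r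
      _ = _ := by ring
  · refine (VCHE.lintegral_heatConv_rpow_le ht hp h.measurable.aestronglyMeasurable).trans
      ((h.lintegral_rpow_le hr hp hp2 h2).trans (ENNReal.rpow_le_rpow ?_ hp0.le))
    apply ENNReal.ofReal_le_ofReal
    have := one_le_four_mul_rpow_neg (k := 1 + μ - 1 / p) ht.le ht1 (by linarith)
    rw [e]
    calc r = r * 1 := by ring
      _ ≤ r * (4 * (1 + t) ^ (-(1 + μ - 1 / p))) := by gcongr
      _ = 4 * r * (1 + t) ^ (-(1 + μ - 1 / p)) := by ring
      _ ≤ _ := by gcongr; norm_num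

/-- Minkowski's integral inequality, applied to the minimum of the two bounds and followed by the
time-integral estimate. M is taken positive so that this minimum never vanishes. -/
lemma exists_lintegral_duhamel_rpow_le {a a' b e p : ℝ} (ha : a < 1) (hb0 : 0 ≤ b) (hb : b < 1)
    (ha' : 0 ≤ a') (he : 0 ≤ e) (hsum : a + e = a' + b) (hp : 1 ≤ p) :
    ∃ C : ℝ, 0 ≤ C ∧ ∀ F : ℝ → Plane → Plane, Measurable (Function.uncurry F) → ∀ M : ℝ, 0 < M →
      ∀ t, 0 < t →
      (∀ s ∈ Ioo 0 t, ∫⁻ x, ‖convGrad (t - s) (F s) x‖ₑ ^ p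
        ≤ ENNReal.ofReal (M * ((t - s) ^ (-a) * (1 + s) ^ (-e))) ^ p) →
      (∀ s ∈ Ioo 0 t, ∫⁻ x, ‖convGrad (t - s) (F s) x‖ₑ ^ p
        ≤ ENNReal.ofReal (M * ((t - s) ^ (-a') * (1 + s) ^ (-b))) ^ p) →
      ∫⁻ x, ‖duhamel F t x‖ₑ ^ p ≤ ENNReal.ofReal (M * C * (1 + t) ^ (1 - a - e)) ^ p := by
  obtain ⟨C, hC, h⟩ := lintegral_time_le ha hb0 hb ha' he hsum
  refine ⟨C, hC, fun F hF M hM t ht h1 h2 => ?_⟩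
  have hp0 : 0 < p := by linarith
  let c : ℝ → ℝ≥0∞ := fun s => min (ENNReal.ofReal (M * ((t - s) ^ (-a) * (1 + s) ^ (-e))))
    (ENNReal.ofReal (M * ((t - s) ^ (-a') * (1 + s) ^ (-b))))
  refine (lintegral_duhamel_rpow_le hF hp (c := c) (by fun_prop) (fun s hs => ⟨?_, ?_⟩)
    fun s hs => ?_).trans (ENNReal.rpow_le_rpow (h t ht M hM.le c (fun s _ => min_le_left _ _)
      fun s _ => min_le_right _ _) hp0.le)
  · have hs0 := hs.1
    have hts : 0 < t - s := by linarith [hs.2]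
    exact (lt_min (ENNReal.ofReal_pos.2 (by positivity)) (ENNReal.ofReal_pos.2 (by positivity))).ne'
  · exact ((min_le_left _ _).trans_lt ENNReal.ofReal_lt_top).ne
  · rcases min_choice (ENNReal.ofReal (M * ((t - s) ^ (-a) * (1 + s) ^ (-e))))
      (ENNReal.ofReal (M * ((t - s) ^ (-a') * (1 + s) ^ (-b)))) with hc | hc
    · simp only [c, hc]; exact h1 s hs
    · simp only [c, hc]; exact h2 s hs

/-- One third of a power of the Gaussian is estimated by its supremum, giving S^{-1/3}. The
remaining power averages the 4/3 power of the kernel, locally integrable as 4/3 < 2, and gives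
S^{-2/3}; the product is (S^{-3/4})^{4/3}. -/
lemma lintegral_flux_rpow_le_of_gaussian (hα : 0 < α) (hK : VelBound α K) (hS : 0 < S) {q g : Plane → ℝ}
    (hq : Measurable q) {m : ℝ} (hm : 0 ≤ m) (hg : GaussBound S m g) :
    ∫⁻ x, ‖flux α q g x‖ₑ ^ (4 / 3 : ℝ)
      ≤ (ENNReal.ofReal (m * K * S ^ (-(3 / 4) : ℝ)) * ∫⁻ x, ‖q x‖ₑ) ^ (4 / 3 : ℝ) := by
  have hK1 := hK.one_le
  have h43 : (0 : ℝ) ≤ 4 / 3 := by norm_num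
  have hk := measurable_velMajorant hα
  have hh := (continuous_heatKernel (4 * S)).measurable
  have hS4 : 0 < 4 * S := by positivity
  let k : Plane → Plane → ℝ≥0∞ := fun x z =>
    ENNReal.ofReal (m * heatKernel (4 * S) x) * velMajorant α (x - z)
  have hkm : Measurable (Function.uncurry k) := by
    have : Measurable fun p : Plane × Plane => velMajorant α (p.1 - p.2) :=
      hk.comp (measurable_fst.sub measurable_snd)
    simp only [k, Function.uncurry_def]
    fun_prop
  have hB : ∀ z, ∫⁻ x, k x z ^ (4 / 3 : ℝ) ≤ ENNReal.ofReal (m * K * S ^ (-(3 / 4) : ℝ)) ^ (4 / 3 : ℝ) := by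
    intro z
    calc _ ≤ ∫⁻ x, ENNReal.ofReal (m ^ (4 / 3 : ℝ) * (4 * S) ^ (-(1 / 3) : ℝ)) *
          (velMajorant α (x - z) ^ (4 / 3 : ℝ) * ENNReal.ofReal (heatKernel (4 * S) x)) := by
          refine lintegral_mono fun x => ?_
          have hk0 := heatKernel_nonneg hS4.le x
          simp only [k]
          rw [ENNReal.mul_rpow_of_nonneg _ _ h43, ENNReal.ofReal_rpow_of_nonneg (by positivity) h43,
            mul_left_comm, mul_comm, ← ENNReal.ofReal_mul (by positivity)]
          gcongr _ * ENNReal.ofReal ?_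
          rw [Real.mul_rpow hm hk0, mul_assoc]
          gcongr
          have e1 : heatKernel (4 * S) x ^ (4 / 3 : ℝ)
              = heatKernel (4 * S) x ^ (1 / 3 : ℝ) * heatKernel (4 * S) x := by
            conv_rhs => rw [← Real.rpow_one (heatKernel (4 * S) x), ← Real.rpow_mul hk0]
            rw [← Real.rpow_add_of_nonneg hk0 (by norm_num) (by norm_num)]
            norm_num
          rw [e1]
          gcongr ?_ * _
          calc heatKernel (4 * S) x ^ (1 / 3 : ℝ) ≤ ((4 * S)⁻¹) ^ (1 / 3 : ℝ) := by
                gcongr; exact heatKernel_le_inv hS4 x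
            _ = _ := by rw [Real.inv_rpow hS4.le, Real.rpow_neg hS4.le]
      _ ≤ ENNReal.ofReal (m ^ (4 / 3 : ℝ) * (4 * S) ^ (-(1 / 3) : ℝ)) *
          ENNReal.ofReal (K * (4 * S) ^ (-(2 / 3) : ℝ)) := by
          rw [lintegral_const_mul' _ _ ENNReal.ofReal_ne_top]
          gcongr
          exact hK.gauss_rpow _ hS4 z
      _ ≤ _ := by
          rw [← ENNReal.ofReal_mul (by positivity), ENNReal.ofReal_rpow_of_nonneg (by positivity) h43]
          apply ENNReal.ofReal_le_ofReal
          calc m ^ (4 / 3 : ℝ) * (4 * S) ^ (-(1 / 3) : ℝ) * (K * (4 * S) ^ (-(2 / 3) : ℝ))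
              = m ^ (4 / 3 : ℝ) * K * ((4 * S) ^ (-(1 / 3) : ℝ) * (4 * S) ^ (-(2 / 3) : ℝ)) := by ring
            _ = m ^ (4 / 3 : ℝ) * K * (4 * S) ^ (-1 : ℝ) := by rw [← Real.rpow_add hS4]; norm_num
            _ ≤ m ^ (4 / 3 : ℝ) * K ^ (4 / 3 : ℝ) * S ^ (-1 : ℝ) := by
                have g1 : K ≤ K ^ (4 / 3 : ℝ) := by
                  conv_lhs => rw [← Real.rpow_one K]
                  exact Real.rpow_le_rpow_of_exponent_le hK1 (by norm_num)
                have g2 : (4 * S) ^ (-1 : ℝ) ≤ S ^ (-1 : ℝ) :=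
                  Real.rpow_le_rpow_of_nonpos hS (by linarith) (by norm_num)
                gcongr _ * ?_ * ?_
            _ = _ := by
                rw [Real.mul_rpow (by positivity) (by positivity), Real.mul_rpow hm (by linarith),
                  ← Real.rpow_mul hS.le]
                norm_num
  calc _ ≤ ∫⁻ x, (∫⁻ z, k x z * ‖q z‖ₑ) ^ (4 / 3 : ℝ) := by
        refine lintegral_mono fun x => ENNReal.rpow_le_rpow ?_ h43
        rw [flux, enorm_smul]
        refine (mul_le_mul' (hg.enorm_le x) (enorm_velocity_le α q x)).trans (le_of_eq ?_)
        rw [← lintegral_const_mul' _ _ ENNReal.ofReal_ne_top]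
        refine lintegral_congr fun z => ?_
        simp only [k]; ring
    _ ≤ _ := lintegral_rpow_lintegral_mul_le hkm hq.enorm.aemeasurable (by norm_num)
        (.of_forall hB)
    _ = _ := by rw [ENNReal.mul_rpow_of_nonneg _ _ h43]

lemma lintegral_flux_rpow_le_of_velocity {f g : Plane → ℝ} {V N p : ℝ} (hV : 0 ≤ V) (hp : 1 ≤ p)
    (hf : ∀ x, ‖velocity α f x‖ₑ ≤ ENNReal.ofReal V) (hg : ∫⁻ x, ‖g x‖ₑ ^ p ≤ ENNReal.ofReal N ^ p) :
    ∫⁻ x, ‖flux α f g x‖ₑ ^ p ≤ ENNReal.ofReal (V * N) ^ p := by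
  have hp0 : 0 < p := by linarith
  calc _ ≤ ∫⁻ x, ENNReal.ofReal V ^ p * ‖g x‖ₑ ^ p := by
        refine lintegral_mono fun x => ?_
        rw [← ENNReal.mul_rpow_of_nonneg _ _ hp0.le, flux, enorm_smul, mul_comm]
        exact ENNReal.rpow_le_rpow (mul_le_mul_left (hf x) _) hp0.le
    _ ≤ _ := by
        rw [lintegral_const_mul' _ _ (ENNReal.rpow_ne_top_of_nonneg hp0.le ENNReal.ofReal_ne_top),
          ENNReal.ofReal_mul hV, ENNReal.mul_rpow_of_nonneg _ _ hp0.le]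
        gcongr

end VCHE
end


/-! ### The remainder in L^{4/3} and L² -/

noncomputable section

namespace VCHE

variable {α K μ S : ℝ}

/-- The decomposition used for the mass and moment of the flux, now measured in L^{4/3}. Every piece
is bounded by (1+s)^{-(3/4+μ)}, a quarter power better than the L¹ norm. -/
lemma lintegral_remFlux_rpow_le (hα : 0 < α) (hK : VelBound α K) (hμ : 1 / 2 ≤ μ) (hμ1 : μ ≤ 1)
    {c₀ c₁ P N s : ℝ} {e : Plane} (h₀ : |c₀| ≤ P) (h₁ : |c₁| ≤ P) (he : ‖e‖ ≤ 1) (hs : 0 ≤ s)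
    (hN : 0 ≤ N) {v : ℝ → Plane → ℝ} (hv : NearPair μ P c₀ c₁ e v)
    (hq : ∫⁻ x, ‖v s x - vortexPair c₀ c₁ e s x‖ₑ ^ (4 / 3 : ℝ)
      ≤ ENNReal.ofReal (N * (1 + s) ^ (-1 - μ + 1 / (4 / 3))) ^ (4 / 3 : ℝ)) :
    ∫⁻ x, ‖remFlux α c₀ c₁ e v s x‖ₑ ^ (4 / 3 : ℝ)
      ≤ ENNReal.ofReal ((12 * P * K * P + K * P * N + (12 * P * K * N + P ^ 2 * (12384 ^ 2 * K)))
        * (1 + s) ^ (-(3 / 4 + μ))) ^ (4 / 3 : ℝ) := by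
  have hK0 : 0 ≤ K := by linarith [hK.one_le]
  have hP : 0 ≤ P := (abs_nonneg _).trans h₀
  have hS : 0 < 1 + s := by linarith
  have hS1 : 1 ≤ 1 + s := by linarith
  have h43 : (0 : ℝ) ≤ 4 / 3 := by norm_num
  have h43' : (1 : ℝ) ≤ 4 / 3 := by norm_num
  set A := vortexPair c₀ c₁ e s with hAdef
  set q : Plane → ℝ := fun x => v s x - A x with hqdef
  have hAm : Measurable A := measurable_vortexPair_slice c₀ c₁ e s
  have hvm := hv.measurable_slice s
  have hqm : Measurable q := hvm.sub hAm
  have hA := gaussBound_vortexPair h₀ h₁ he hs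
  have hD := gaussBound_vortexDiff he hs
  have hrem := hv.rem s hs
  have iA := hA.integrable hS hAm
  have iv := hv.integrable hs
  have iq : Integrable q := iv.sub iA
  have iD := integrable_vortexDiff e hs
  have hDm : Measurable (vortexDiff e s) := (measurable_vortexDiff e).comp measurable_prodMk_left
  have half : (4 * (1 + s)) ^ (-(1 / 2) : ℝ) ≤ (1 + s) ^ (-(1 / 2) : ℝ) :=
    rpow_neg_half_le (by norm_num) hS
  have r1 : (1 + s) ^ (-(3 / 4) : ℝ) * (1 + s) ^ (-μ) = (1 + s) ^ (-(3 / 4 + μ)) := by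
    rw [← Real.rpow_add hS]; congr 1; ring
  have r2 : (1 + s) ^ (-(1 / 2) : ℝ) * (1 + s) ^ (-1 - μ + 1 / (4 / 3)) = (1 + s) ^ (-(3 / 4 + μ)) := by
    rw [← Real.rpow_add hS]; congr 1; ring
  have b1 : ∫⁻ x, ‖flux α q A x‖ₑ ^ (4 / 3 : ℝ)
      ≤ ENNReal.ofReal (12 * P * K * P * (1 + s) ^ (-(3 / 4 + μ))) ^ (4 / 3 : ℝ) := by
    refine (lintegral_flux_rpow_le_of_gaussian hα hK hS hqm (by positivity) hA).trans
      (ENNReal.rpow_le_rpow ((mul_le_mul_right hrem.mass _).trans (le_of_eq ?_)) h43)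
    rw [← ENNReal.ofReal_mul (by positivity), ← r1]
    congr 1; ring
  have b2 : ∫⁻ x, ‖flux α q q x‖ₑ ^ (4 / 3 : ℝ)
      ≤ ENNReal.ofReal (K * P * N * (1 + s) ^ (-(3 / 4 + μ))) ^ (4 / 3 : ℝ) := by
    refine (lintegral_flux_rpow_le_of_velocity (V := K * (P * (1 + s) ^ (-μ))) (by positivity) h43'
      (fun x => ?_) hq).trans (ENNReal.rpow_le_rpow (ENNReal.ofReal_le_ofReal ?_) h43)
    · refine (enorm_velocity_le_of_sup hK q x).trans ?_
      rw [ENNReal.ofReal_mul hK0]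
      gcongr
      exact hrem.mass
    · rw [← r2]
      calc _ = K * P * N * ((1 + s) ^ (-μ) * (1 + s) ^ (-1 - μ + 1 / (4 / 3))) := by ring
        _ ≤ _ := by
          gcongr
  have b3 : ∫⁻ x, ‖flux α A q x‖ₑ ^ (4 / 3 : ℝ)
      ≤ ENNReal.ofReal (12 * P * K * N * (1 + s) ^ (-(3 / 4 + μ))) ^ (4 / 3 : ℝ) := by
    refine (lintegral_flux_rpow_le_of_velocity (by positivity) h43'
      (enorm_velocity_le_of_gaussian hK (by positivity) (by positivity : 0 < 4 * (1 + s)) hA.enorm_le)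
      hq).trans (ENNReal.rpow_le_rpow (ENNReal.ofReal_le_ofReal ?_) h43)
    rw [← r2]
    calc _ = 12 * P * K * N * ((4 * (1 + s)) ^ (-(1 / 2) : ℝ) * (1 + s) ^ (-1 - μ + 1 / (4 / 3))) := by
          ring
      _ ≤ _ := by gcongr 12 * P * K * N * (?_ * _)
  have b4 : ∫⁻ x, ‖flux α (vortexDiff e s) (vortexDiff e s) x‖ₑ ^ (4 / 3 : ℝ)
      ≤ ENNReal.ofReal (12384 ^ 2 * K * (1 + s) ^ (-(3 / 4 + μ))) ^ (4 / 3 : ℝ) := by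
    refine (lintegral_flux_rpow_le_of_velocity (by positivity) h43'
      (enorm_velocity_le_of_gaussian hK (by positivity) (by positivity : 0 < 4 * (1 + s)) hD.enorm_le)
      (hD.lintegral_rpow_le (by positivity) hS h43')).trans
      (ENNReal.rpow_le_rpow (ENNReal.ofReal_le_ofReal ?_) h43)
    -- Two half powers come from the two Gaussian bounds on the difference, one from its velocity,
    -- and a quarter from its L^{4/3} norm. The total -7/4 is at most -(3/4+μ) because μ ≤ 1.
    have r3 : (1 + s) ^ (-(1 / 2) : ℝ) * ((1 + s) ^ (-(1 / 2) : ℝ) * ((1 + s) ^ (-(1 / 2) : ℝ)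
        * (1 + s) ^ (-1 + 1 / (4 / 3) : ℝ))) ≤ (1 + s) ^ (-(3 / 4 + μ)) := by
      rw [← Real.rpow_add hS, ← Real.rpow_add hS, ← Real.rpow_add hS]
      exact Real.rpow_le_rpow_of_exponent_le hS1 (by linarith)
    calc _ = 12384 ^ 2 * K * ((1 + s) ^ (-(1 / 2) : ℝ) * ((4 * (1 + s)) ^ (-(1 / 2) : ℝ)
        * ((1 + s) ^ (-(1 / 2) : ℝ) * (1 + s) ^ (-1 + 1 / (4 / 3) : ℝ)))) := by ring
      _ ≤ 12384 ^ 2 * K * ((1 + s) ^ (-(1 / 2) : ℝ) * ((1 + s) ^ (-(1 / 2) : ℝ)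
        * ((1 + s) ^ (-(1 / 2) : ℝ) * (1 + s) ^ (-1 + 1 / (4 / 3) : ℝ)))) := by
          gcongr 12384 ^ 2 * K * (_ * (?_ * _))
      _ ≤ _ := by gcongr 12384 ^ 2 * K * ?_
  have b4' : ∫⁻ x, ‖(-(c₀ * c₁)) • flux α (vortexDiff e s) (vortexDiff e s) x‖ₑ ^ (4 / 3 : ℝ)
      ≤ ENNReal.ofReal (P ^ 2 * (12384 ^ 2 * K) * (1 + s) ^ (-(3 / 4 + μ))) ^ (4 / 3 : ℝ) := by
    have hcc : ‖-(c₀ * c₁)‖ₑ ≤ ENNReal.ofReal (P ^ 2) := by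
      rw [Real.enorm_eq_ofReal_abs, abs_neg, abs_mul, pow_two]
      exact ENNReal.ofReal_le_ofReal (by gcongr)
    calc _ ≤ ∫⁻ x, ENNReal.ofReal (P ^ 2) ^ (4 / 3 : ℝ) *
          ‖flux α (vortexDiff e s) (vortexDiff e s) x‖ₑ ^ (4 / 3 : ℝ) := by
          refine lintegral_mono fun x => ?_
          rw [← ENNReal.mul_rpow_of_nonneg _ _ h43, enorm_smul]
          exact ENNReal.rpow_le_rpow (mul_le_mul_left hcc _) h43
      _ ≤ _ := by
          rw [lintegral_const_mul' _ _ (ENNReal.rpow_ne_top_of_nonneg h43 ENNReal.ofReal_ne_top),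
            mul_assoc, ENNReal.ofReal_mul (by positivity), ENNReal.mul_rpow_of_nonneg _ _ h43]
          gcongr
  have m1 := (measurable_flux hα iq hAm).enorm
  have m2 := (measurable_flux hα iq hqm).enorm
  have m3 := (measurable_flux hα iA hqm).enorm
  have m4 : Measurable fun x => ‖(-(c₀ * c₁)) • flux α (vortexDiff e s) (vortexDiff e s) x‖ₑ :=
    ((measurable_flux hα iD hDm).const_smul (-(c₀ * c₁))).enorm
  refine le_trans (lintegral_mono fun x => ENNReal.rpow_le_rpow ?_ h43)
    ((lintegral_add_rpow_le h43' (m1.add m2).aemeasurable (m3.add m4).aemeasurable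
      (lintegral_add_rpow_le h43' m1.aemeasurable m2.aemeasurable b1 b2)
      (lintegral_add_rpow_le h43' m3.aemeasurable m4.aemeasurable b3 b4')).trans (le_of_eq ?_))
  · have e1 : remFlux α c₀ c₁ e v s x = (flux α q A x + flux α q q x)
        + (flux α A q x + (-(c₀ * c₁)) • flux α (vortexDiff e s) (vortexDiff e s) x) := by
      have hd := flux_sub_flux hα iv iA x
      have e2 : flux α q (v s) x = flux α q A x + flux α q q x := by
        simp only [flux, ← add_smul, hqdef]
        congr 1; ring
      simp only [remFlux, pairFlux, neg_smul, ← e2]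
      rw [← sub_sub, hd]
      abel
    rw [e1]
    exact (enorm_add_le _ _).trans (add_le_add (enorm_add_le _ _) (enorm_add_le _ _))
  · congr 1
    rw [← ENNReal.ofReal_add (by positivity) (by positivity),
      ← ENNReal.ofReal_add (by positivity) (by positivity),
      ← ENNReal.ofReal_add (by positivity) (by positivity)]
    congr 1; ring

/-- The linear part of the remainder equation already has the right decay for every p in [1,2], so
only the Duhamel term has to be estimated anew for each exponent. -/
lemma lintegral_rem_rpow_le (hα : 0 < α) (hK : VelBound α K) (hμ : 1 / 2 ≤ μ) (hμ1 : μ ≤ 1)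
    {c₀ c₁ P p D : ℝ} {e : Plane} (h₀ : |c₀| ≤ P) (h₁ : |c₁| ≤ P) (he : ‖e‖ ≤ 1) (hp : 1 ≤ p)
    (hp2 : p ≤ 2) (hD : 0 ≤ D) {f : Plane → ℝ} (hfi : Integrable f)
    (hf : InitBound μ P (fun y => f y - vortexPair c₀ c₁ e 0 y))
    (hf2 : ∫⁻ y, ‖f y - vortexPair c₀ c₁ e 0 y‖ₑ ^ (2 : ℝ) ≤ ENNReal.ofReal P ^ (2 : ℝ))
    {v : ℝ → Plane → ℝ} (hv : NearPair μ P c₀ c₁ e v)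
    (hfix : ∀ t, 0 ≤ t → v t =ᵐ[volume] mildMap α f v t)
    (hduh : ∀ t, 0 < t → ∫⁻ x, ‖duhamel (remFlux α c₀ c₁ e v) t x‖ₑ ^ p
      ≤ ENNReal.ofReal (D * (1 + t) ^ (-1 - μ + 1 / p)) ^ p) {t : ℝ} (ht : 0 ≤ t) :
    ∫⁻ x, ‖v t x - vortexPair c₀ c₁ e t x‖ₑ ^ p
      ≤ ENNReal.ofReal ((66048 * P + D) * (1 + t) ^ (-1 - μ + 1 / p)) ^ p := by
  have hP : 0 ≤ P := (abs_nonneg _).trans h₀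
  have hp0 : 0 < p := by linarith
  rcases ht.eq_or_lt with rfl | ht
  · calc _ = ∫⁻ y, ‖f y - vortexPair c₀ c₁ e 0 y‖ₑ ^ p := by
          refine lintegral_congr_ae ?_
          filter_upwards [hfix 0 le_rfl] with x hx
          rw [hx, mildMap, if_pos le_rfl]
      _ ≤ ENNReal.ofReal P ^ p := hf.lintegral_rpow_le hP hp hp2 hf2
      _ ≤ _ := by
          refine ENNReal.rpow_le_rpow (ENNReal.ofReal_le_ofReal ?_) hp0.le
          rw [add_zero, Real.one_rpow, mul_one]
          linarith
  · have m1 : Measurable (heatConv t fun y => f y - vortexPair c₀ c₁ e 0 y) :=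
      (measurable_heatConv hf.measurable).comp measurable_prodMk_left
    have m2 : Measurable (duhamel (remFlux α c₀ c₁ e v) t) :=
      (measurable_duhamel (measurable_remFlux hα c₀ c₁ e hv.measurable)).comp measurable_prodMk_left
    calc _ ≤ ∫⁻ x, (‖heatConv t (fun y => f y - vortexPair c₀ c₁ e 0 y) x‖ₑ
          + ‖duhamel (remFlux α c₀ c₁ e v) t x‖ₑ) ^ p := by
          refine lintegral_mono_ae ?_
          filter_upwards [hfix t ht.le, mildMap_sub_vortexPair hα hK hμ hμ1 h₀ h₁ he hP hfi hv ht]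
            with x hx hx'
          rw [hx, hx']
          exact ENNReal.rpow_le_rpow enorm_sub_le hp0.le
      _ ≤ _ := lintegral_add_rpow_le hp m1.enorm.aemeasurable m2.enorm.aemeasurable
          (hf.lintegral_heatConv_rpow_le hP hp hp2 hμ hμ1 hf2 ht) (hduh t ht)
      _ = _ := by
          rw [← ENNReal.ofReal_add (by positivity) (by positivity), add_mul]

/-- Decay of the remainder in `L²`. -/
theorem exists_lintegral_sq_rem_le (hα : 0 < α) (hK : VelBound α K) (hμ : 1 / 2 ≤ μ) (hμ1 : μ < 1)
    {P : ℝ} (hP : 0 < P) :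
    ∃ C : ℝ, 0 ≤ C ∧ ∀ (c₀ c₁ : ℝ) (e : Plane) (f : Plane → ℝ) (v : ℝ → Plane → ℝ),
      |c₀| ≤ P → |c₁| ≤ P → ‖e‖ ≤ 1 → Integrable f →
      InitBound μ P (fun y => f y - vortexPair c₀ c₁ e 0 y) →
      ∫⁻ y, ‖f y - vortexPair c₀ c₁ e 0 y‖ₑ ^ (2 : ℝ) ≤ ENNReal.ofReal P ^ (2 : ℝ) →
      NearPair μ P c₀ c₁ e v → (∀ t, 0 ≤ t → v t =ᵐ[volume] mildMap α f v t) → ∀ t, 0 ≤ t →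
      ∫⁻ x, ‖v t x - vortexPair c₀ c₁ e t x‖ₑ ^ (2 : ℝ)
        ≤ ENNReal.ofReal (C * (1 + t) ^ (-1 - μ + 1 / 2)) ^ (2 : ℝ) := by
  have hK0 : 0 < K := by linarith [hK.one_le]
  -- Near s = t the flux is measured in L¹, with kernel power 3/4; near s = 0 its zero mean and
  -- moment are used, with kernel power 3/4 + μ/2.
  obtain ⟨C₁, hC₁, hd₁⟩ := exists_lintegral_duhamel_rpow_le (a := 3 / 4) (a' := 3 / 4 + μ / 2)
    (b := (1 + μ) / 2) (e := 1 / 2 + μ) (p := 4 / 3) (by norm_num) (by linarith) (by linarith)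
    (by linarith) (by linarith) (by ring) (by norm_num)
  -- Near s = t the flux is measured in L^{4/3}, where the kernel power to L² is again 3/4; starting
  -- from L¹ it would be 1, which is not integrable.
  obtain ⟨C₂, hC₂, hd₂⟩ := exists_lintegral_duhamel_rpow_le (a := 3 / 4) (a' := 1 + μ / 2)
    (b := (1 + μ) / 2) (e := 3 / 4 + μ) (p := 2) (by norm_num) (by linarith) (by linarith)
    (by linarith) (by linarith) (by ring) (by norm_num)
  set M := 4128 * K * (2 * (12 * P + P) * P) + P ^ 2 * (4128 * K * (12384 ^ 2 * 4128)) with hM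
  have hM0 : 0 < M := by positivity
  set N := 66048 * P + 8256 * M * C₁ with hN
  have hN0 : 0 ≤ N := by positivity
  set Z := 12 * P * K * P + K * P * N + (12 * P * K * N + P ^ 2 * (12384 ^ 2 * K)) with hZ
  have hZ0 : 0 ≤ Z := by positivity
  refine ⟨66048 * P + 8256 * (M + Z) * C₂, by positivity,
    fun c₀ c₁ e f v h₀ h₁ he hfi hf hf2 hv hfix t ht => ?_⟩
  have hFm := measurable_remFlux hα c₀ c₁ e hv.measurable
  have hFb : ∀ s, 0 < s → FluxBound μ (1 + s) M (remFlux α c₀ c₁ e v s) := fun s hs =>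
    fluxBound_remFlux hα hK hμ hμ1.le h₀ h₁ he hs.le hP.le hv.measurable (hv.rem s hs.le)
  have hFs : ∀ s, Measurable (remFlux α c₀ c₁ e v s) := fun s => hFm.comp measurable_prodMk_left
  have hF0 : ∀ s, 0 < s → ∫ y, remFlux α c₀ c₁ e v s y = 0 := fun s hs =>
    integral_remFlux hα c₀ c₁ e hs.le (hv.integrable hs.le)
  have hq43 : ∀ t, 0 ≤ t → ∫⁻ x, ‖v t x - vortexPair c₀ c₁ e t x‖ₑ ^ (4 / 3 : ℝ)
      ≤ ENNReal.ofReal (N * (1 + t) ^ (-1 - μ + 1 / (4 / 3))) ^ (4 / 3 : ℝ) := by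
    intro t ht
    refine lintegral_rem_rpow_le hα hK hμ hμ1.le h₀ h₁ he (by norm_num) (by norm_num) (by positivity)
      hfi hf hf2 hv hfix (fun t ht => ?_) ht
    have := hd₁ (remFlux α c₀ c₁ e v) hFm (8256 * M) (by positivity) t ht (fun s hs => ?_) fun s hs => ?_
    · rwa [show 1 - 3 / 4 - (1 / 2 + μ) = -1 - μ + 1 / (4 / 3) by ring] at this
    · have hts : 0 < t - s := by linarith [hs.2]
      have hS : 0 < 1 + s := by linarith [hs.1]
      refine (lintegral_convGrad_rpow_le hts (by norm_num) (hFs s).aestronglyMeasurable).trans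
        (ENNReal.rpow_le_rpow ((mul_le_mul_right (hFb s hs.1).mass _).trans ?_) (by norm_num))
      rw [← ENNReal.ofReal_mul (by positivity)]
      apply ENNReal.ofReal_le_ofReal
      rw [show (-(1 / 2) + (1 / (4 / 3) - 1) : ℝ) = -(3 / 4) by norm_num,
        show -(1 / 2) - μ = -(1 / 2 + μ) by ring]
      calc _ = 4128 * M * ((t - s) ^ (-(3 / 4) : ℝ) * (1 + s) ^ (-(1 / 2 + μ))) := by ring
        _ ≤ _ := by gcongr; norm_num
    · have hts : 0 < t - s := by linarith [hs.2]
      refine (lintegral_convGrad_rpow_le_of_mean_zero hts (by linarith) hμ1.le (by norm_num)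
        ((hFb s hs.1).integrable (hFs s)) (hF0 s hs.1)).trans
        (ENNReal.rpow_le_rpow ((mul_le_mul_right (hFb s hs.1).moment _).trans (le_of_eq ?_))
          (by norm_num))
      rw [← ENNReal.ofReal_mul (by positivity),
        show -(1 / 2) - μ / 2 + (1 / (4 / 3) - 1) = -(3 / 4 + μ / 2) by ring]
      congr 1; ring
  refine lintegral_rem_rpow_le hα hK hμ hμ1.le h₀ h₁ he (by norm_num) le_rfl (by positivity)
    hfi hf hf2 hv hfix (fun t ht => ?_) ht
  have := hd₂ (remFlux α c₀ c₁ e v) hFm (8256 * (M + Z)) (by positivity) t ht (fun s hs => ?_)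
    fun s hs => ?_
  · rwa [show 1 - 3 / 4 - (3 / 4 + μ) = -1 - μ + 1 / 2 by ring] at this
  · have hts : 0 < t - s := by linarith [hs.2]
    have hS : 0 < 1 + s := by linarith [hs.1]
    have hF43 := lintegral_remFlux_rpow_le hα hK hμ hμ1.le h₀ h₁ he hs.1.le hN0 hv (hq43 s hs.1.le)
    rw [← hZ] at hF43
    refine (lintegral_convGrad_sq_le hts (hFs s).aestronglyMeasurable).trans ?_
    calc _ ≤ ENNReal.ofReal (2064 * (t - s) ^ (-(3 / 4) : ℝ)) ^ (2 : ℝ) *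
          (ENNReal.ofReal (Z * (1 + s) ^ (-(3 / 4 + μ))) ^ (4 / 3 : ℝ)) ^ (3 / 2 : ℝ) := by
          gcongr
      _ = ENNReal.ofReal (2064 * Z * ((t - s) ^ (-(3 / 4) : ℝ) * (1 + s) ^ (-(3 / 4 + μ)))) ^ (2 : ℝ) := by
          rw [← ENNReal.rpow_mul, show (4 / 3 * (3 / 2) : ℝ) = 2 by norm_num,
            ← ENNReal.mul_rpow_of_nonneg _ _ (by norm_num), ← ENNReal.ofReal_mul (by positivity)]
          congr 2; ring
      _ ≤ _ := by
          refine ENNReal.rpow_le_rpow (ENNReal.ofReal_le_ofReal ?_) (by norm_num)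
          gcongr ?_ * _
          linarith
  · have hts : 0 < t - s := by linarith [hs.2]
    have hS : 0 < 1 + s := by linarith [hs.1]
    refine (lintegral_convGrad_rpow_le_of_mean_zero hts (by linarith) hμ1.le (by norm_num)
      ((hFb s hs.1).integrable (hFs s)) (hF0 s hs.1)).trans
      (ENNReal.rpow_le_rpow ((mul_le_mul_right (hFb s hs.1).moment _).trans ?_) (by norm_num))
    rw [← ENNReal.ofReal_mul (by positivity),
      show -(1 / 2) - μ / 2 + (1 / 2 - 1) = -(1 + μ / 2) by ring]
    apply ENNReal.ofReal_le_ofReal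
    calc _ = 8256 * M * ((t - s) ^ (-(1 + μ / 2)) * (1 + s) ^ (-((1 + μ) / 2))) := by ring
      _ ≤ _ := by gcongr ?_ * _; linarith

end VCHE
end


noncomputable section

namespace VCHE

variable {α μ S : ℝ}

/-! ### Comparison with the asymptotic profile -/

lemma GaussBound.add {m m' : ℝ} {g g' : Plane → ℝ} (h : GaussBound S m g) (h' : GaussBound S m' g') :
    GaussBound S (m + m') (fun x => g x + g' x) := fun x => by
  rw [add_mul]
  exact (abs_add_le _ _).trans (add_le_add (h x) (h' x))

lemma GaussBound.const_mul {m P c : ℝ} {g : Plane → ℝ} (h : GaussBound S m g) (hc : |c| ≤ P) :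
    GaussBound S (P * m) (fun x => c * g x) := fun x => by
  have hP : 0 ≤ P := (abs_nonneg c).trans hc
  rw [abs_mul, mul_assoc]
  exact mul_le_mul hc (h x) (abs_nonneg _) hP

lemma gaussBound_of_le (hS : 0 < S) {c : ℝ} (hc : 0 ≤ c) {q : Plane → ℝ}
    (hq : ∀ x, |q x| ≤ c * (1 + ‖x‖ / √S) ^ 4) :
    GaussBound S (4128 * c) (fun x => q x * heatKernel S x) := fun x => by
  have k := heatKernel_nonneg hS.le x
  have g := heatKernel_le_of_two_mul (by positivity : 0 < 2 * S) x
  rw [show 2 * (2 * S) = 4 * S by ring] at g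
  rw [abs_mul, abs_of_nonneg k]
  calc _ ≤ 2064 * c * heatKernel (2 * S) x := le_heatKernel_of_le hS x hc (hq x)
    _ ≤ 2064 * c * (2 * heatKernel (4 * S) x) := by gcongr
    _ = _ := by ring

lemma gaussBound_laplacian_heatKernel (hS : 0 < S) :
    GaussBound S (4128 * S⁻¹) (Laplacian.laplacian (heatKernel S)) := by
  have e : Laplacian.laplacian (heatKernel S)
      = fun x => (-(2 * S)⁻¹ * 2 + ((2 * S)⁻¹) ^ 2 * ‖x‖ ^ 2) * heatKernel S x :=
    funext (laplacian_heatKernel S)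
  rw [e]
  refine gaussBound_of_le hS (by positivity) fun x => ?_
  have hsq : √S ^ 2 = S := Real.sq_sqrt hS.le
  have hs0 : 0 < √S := Real.sqrt_pos.2 hS
  have hρ : 0 ≤ ‖x‖ / √S := by positivity
  have e1 : -(2 * S)⁻¹ * 2 + ((2 * S)⁻¹) ^ 2 * ‖x‖ ^ 2 = S⁻¹ * (-1 + (‖x‖ / √S) ^ 2 / 4) := by
    rw [div_pow, hsq]; field_simp; ring
  rw [e1, abs_mul, abs_of_pos (inv_pos.2 hS)]
  gcongr
  have h4 := le_poly_four hρ
  rw [abs_le]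
  constructor <;> nlinarith [h4.1, h4.2.2.1, sq_nonneg (‖x‖ / √S)]

/-- Three derivatives give S^{-3/2}; only S^{-1} is kept, the order of the other errors, which uses
S ≥ 1. -/
lemma gaussBound_laplacian_partialDeriv_heatKernel (hS : 1 ≤ S) (i : Fin 2) :
    GaussBound S (4128 * (2 * S⁻¹)) (Laplacian.laplacian (partialDeriv i (heatKernel S))) := by
  have hS0 : 0 < S := by linarith
  have e : Laplacian.laplacian (partialDeriv i (heatKernel S))
      = fun x => (4 * ((2 * S)⁻¹) ^ 2 * x i - ((2 * S)⁻¹) ^ 3 * ‖x‖ ^ 2 * x i) * heatKernel S x :=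
    funext (laplacian_partialDeriv_heatKernel S i)
  rw [e]
  refine gaussBound_of_le hS0 (by positivity) fun x => ?_
  have hsq : √S ^ 2 = S := Real.sq_sqrt hS0.le
  have hs0 : 0 < √S := Real.sqrt_pos.2 hS0
  have hs1 : 1 ≤ √S := Real.one_le_sqrt.2 hS
  have hρ : 0 ≤ ‖x‖ / √S := by positivity
  have hxi : |x i| ≤ ‖x‖ := PiLp.norm_apply_le x i
  have h4 := le_poly_four hρ
  calc |4 * ((2 * S)⁻¹) ^ 2 * x i - ((2 * S)⁻¹) ^ 3 * ‖x‖ ^ 2 * x i|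
      ≤ 4 * ((2 * S)⁻¹) ^ 2 * ‖x‖ + ((2 * S)⁻¹) ^ 3 * ‖x‖ ^ 2 * ‖x‖ := by
        refine (abs_sub _ _).trans ?_
        rw [abs_mul _ (x i), abs_mul _ (x i), abs_of_nonneg (by positivity : 0 ≤ 4 * ((2 * S)⁻¹) ^ 2),
          abs_of_nonneg (by positivity : 0 ≤ ((2 * S)⁻¹) ^ 3 * ‖x‖ ^ 2)]
        gcongr
    _ = S⁻¹ * (√S)⁻¹ * (‖x‖ / √S + (‖x‖ / √S) ^ 3 / 8) := by
        have : S = √S ^ 2 := hsq.symm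
        rw [div_pow]
        conv_lhs => rw [this]
        conv_rhs => rw [show S⁻¹ = (√S ^ 2)⁻¹ by rw [hsq]]
        field_simp
        ring
    _ ≤ S⁻¹ * 1 * (‖x‖ / √S + (‖x‖ / √S) ^ 3 / 8) := by
        gcongr
        exact inv_le_one_of_one_le₀ hs1
    _ ≤ S⁻¹ * 1 * (2 * (1 + ‖x‖ / √S) ^ 4) := by
        gcongr
        have : 0 ≤ (‖x‖ / √S) ^ 3 := by positivity
        linarith [h4.2.1, h4.2.2.2]
    _ = _ := by ring

/-- The second-order remainder carries (|e|/√S)² ≤ 1/S. The constant is 8256·(4 + 2), from the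
shifted and the centred Gaussian. -/
lemma gaussBound_taylor (hS : 1 ≤ S) {e : Plane} (he : ‖e‖ ≤ 1) :
    GaussBound S (49536 * S⁻¹) (fun x => heatKernel S (x + e) - heatKernel S x
      - ∑ i, e i * partialDeriv i (heatKernel S) x) := fun x => by
  have hS0 : 0 < S := by linarith
  have hsq : √S ^ 2 = S := Real.sq_sqrt hS0.le
  have h := abs_heatKernel_taylor_le hS0 x (-e)
  have e1 : inner ℝ (-e) (gradient (heatKernel S) x) = -∑ i, e i * partialDeriv i (heatKernel S) x := by
    rw [gradient_heatKernel, inner_neg_left, inner_smul_right, PiLp.inner_apply, Finset.mul_sum]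
    congr 1
    refine Finset.sum_congr rfl fun i _ => ?_
    rw [partialDeriv_heatKernel]
    simp
    ring
  rw [e1, sub_neg_eq_add, norm_neg, ← sub_eq_add_neg] at h
  have g2 := heatKernel_le_of_two_mul (by positivity : 0 < 2 * S) x
  have g3 := heatKernel_add_le (by positivity : 0 < 2 * S) (e := e)
    (by nlinarith [norm_nonneg e]) x
  rw [show 2 * (2 * S) = 4 * S by ring] at g2 g3
  have hz : (‖e‖ / √S) ^ 2 ≤ S⁻¹ := by
    rw [div_pow, hsq, div_eq_mul_inv]
    exact mul_le_of_le_one_left (by positivity) (pow_le_one₀ (norm_nonneg e) he)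
  have k1 := heatKernel_nonneg (by positivity : 0 ≤ 2 * S) (x + e)
  have k2 := heatKernel_nonneg (by positivity : 0 ≤ 2 * S) x
  refine h.trans ?_
  calc _ ≤ 8256 * (S⁻¹ * (4 * heatKernel (4 * S) x) + S⁻¹ * (2 * heatKernel (4 * S) x)) := by
        gcongr 8256 * (?_ * ?_ + ?_ * ?_)
        · exact (min_le_right _ _).trans hz
        · exact (min_le_right _ _).trans hz
    _ = _ := by ring

/-- The vortex pair against the unfiltered vortex and its derivatives. -/
lemma gaussBound_vortexPair_sub_profile {c₀ c₁ P t : ℝ} {e : Plane} (h₀ : |c₀| ≤ P) (h₁ : |c₁| ≤ P)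
    (he : ‖e‖ ≤ 1) (ht : 0 ≤ t) :
    GaussBound (1 + t) ((49536 * P + 5 * 8256 * α ^ 2 * P) * (1 + t)⁻¹) (fun x =>
      vortexPair c₀ c₁ e t x - (c₀ + c₁) * unfilter α (oseen t) x
        - ∑ i, c₁ * e i * unfilter α (partialDeriv i (oseen t)) x) := by
  have hT : 1 ≤ 1 + t := by linarith
  have hT0 : 0 < 1 + t := by linarith
  have hP : 0 ≤ P := (abs_nonneg _).trans h₀
  have ho : oseen t = heatKernel (1 + t) := rfl
  have hei : ∀ i, |c₁ * e i| ≤ P := fun i => by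
    rw [abs_mul]
    have : |e i| ≤ 1 := (PiLp.norm_apply_le e i).trans he
    calc |c₁| * |e i| ≤ P * 1 := by gcongr
      _ = P := mul_one P
  -- There are three kinds of error: the Taylor remainder of the displaced vortex, the α²Δ
  -- correction of the total vortex, and the α²Δ corrections of its two derivatives.
  have b1 := (gaussBound_taylor hT he).const_mul h₁
  have b2 := ((gaussBound_laplacian_heatKernel hT0).const_mul
    (P := 2 * P) ((abs_add_le c₀ c₁).trans (by linarith))).const_mul (P := α ^ 2)
      (abs_of_nonneg (sq_nonneg α)).le
  have b3 := fun i => ((gaussBound_laplacian_partialDeriv_heatKernel hT i).const_mul (hei i)).const_mul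
    (P := α ^ 2) (abs_of_nonneg (sq_nonneg α)).le
  have hb := ((b1.add b2).add (b3 0)).add (b3 1)
  intro x
  have h := hb x
  rw [ho]
  simp only [unfilter, vortexPair, Fin.sum_univ_two] at h ⊢
  refine le_trans (le_of_eq ?_) (h.trans ?_)
  · congr 1; ring
  · have k := heatKernel_nonneg (by positivity : 0 ≤ 4 * (1 + t)) x
    gcongr ?_ * _
    have : 0 ≤ α ^ 2 * P * (1 + t)⁻¹ := by positivity
    linarith

lemma InitBound.mono {r r' : ℝ} {f : Plane → ℝ} (h : InitBound μ r f) (hr : r ≤ r') :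
    InitBound μ r' f :=
  ⟨h.measurable, h.integrable_coord, h.integral_eq, h.integral_coord_eq,
    h.moment.trans (ENNReal.ofReal_le_ofReal hr)⟩

lemma NearPair.mono {R R' c₀ c₁ : ℝ} {e : Plane} {v : ℝ → Plane → ℝ} (h : NearPair μ R c₀ c₁ e v)
    (hR : R ≤ R') : NearPair μ R' c₀ c₁ e v :=
  ⟨h.measurable, fun t ht => (h.rem t ht).mono (by linarith) hR⟩

lemma weightedNorm_congr {f g : Plane → ℝ} (m : ℕ) (h : f =ᵐ[volume] g) :
    weightedNorm m f = weightedNorm m g :=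
  eLpNorm_congr_ae (h.mono fun x hx => by simp only [hx])

lemma eLpNorm_le_of_lintegral_rpow_le {f : Plane → ℝ} {p c : ℝ} (hp : 0 < p)
    (h : ∫⁻ x, ‖f x‖ₑ ^ p ≤ ENNReal.ofReal c ^ p) :
    eLpNorm f (ENNReal.ofReal p) volume ≤ ENNReal.ofReal c := by
  rw [eLpNorm_eq_lintegral_rpow_enorm_toReal (by simpa using hp) ENNReal.ofReal_ne_top,
    ENNReal.toReal_ofReal hp.le, one_div]
  exact (ENNReal.rpow_inv_le_iff hp).2 h

lemma measurable_laplacian_heatKernel (τ : ℝ) : Measurable (Laplacian.laplacian (heatKernel τ)) := by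
  rw [show Laplacian.laplacian (heatKernel τ) = _ from funext (laplacian_heatKernel τ)]
  have := continuous_heatKernel τ
  fun_prop

lemma measurable_partialDeriv_heatKernel (τ : ℝ) (i : Fin 2) :
    Measurable (partialDeriv i (heatKernel τ)) := by
  rw [show partialDeriv i (heatKernel τ) = _ from funext (partialDeriv_heatKernel τ i)]
  have := continuous_heatKernel τ
  fun_prop

lemma measurable_laplacian_partialDeriv_heatKernel (τ : ℝ) (i : Fin 2) :
    Measurable (Laplacian.laplacian (partialDeriv i (heatKernel τ))) := by
  rw [show Laplacian.laplacian (partialDeriv i (heatKernel τ)) = _ from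
    funext (laplacian_partialDeriv_heatKernel τ i)]
  have := continuous_heatKernel τ
  fun_prop

/-- Decay in `L^p` of the distance to the profile. -/
lemma eLpNorm_sub_profile_le {c₀ c₁ P N p t : ℝ} {e : Plane} (hμ1 : μ ≤ 1) (h₀ : |c₀| ≤ P)
    (h₁ : |c₁| ≤ P) (he : ‖e‖ ≤ 1) (hN : 0 ≤ N) (hp : 1 ≤ p) (hp2 : p ≤ 2) (ht : 0 ≤ t)
    {v : Plane → ℝ} (hv : Measurable v)
    (hv1 : ∫⁻ x, ‖v x - vortexPair c₀ c₁ e t x‖ₑ ≤ ENNReal.ofReal (N * (1 + t) ^ (-μ)))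
    (hv2 : ∫⁻ x, ‖v x - vortexPair c₀ c₁ e t x‖ₑ ^ (2 : ℝ)
      ≤ ENNReal.ofReal (N * (1 + t) ^ (-1 - μ + 1 / 2)) ^ (2 : ℝ)) :
    eLpNorm (fun x => v x - (c₀ + c₁) * unfilter α (oseen t) x
        - ∑ i, c₁ * e i * unfilter α (partialDeriv i (oseen t)) x) (ENNReal.ofReal p) volume
      ≤ ENNReal.ofReal ((N + (49536 * P + 5 * 8256 * α ^ 2 * P)) * (1 + t) ^ (-1 - μ + 1 / p)) := by
  have hp0 : 0 < p := by linarith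
  have hP : 0 ≤ P := (abs_nonneg _).trans h₀
  have hT0 : 0 < 1 + t := by linarith
  have hg := gaussBound_vortexPair_sub_profile (α := α) h₀ h₁ he ht
  have hAm := measurable_vortexPair_slice c₀ c₁ e t
  have hm1 : Measurable fun x => v x - vortexPair c₀ c₁ e t x := hv.sub hAm
  have hm2 : Measurable fun x => vortexPair c₀ c₁ e t x - (c₀ + c₁) * unfilter α (oseen t) x
        - ∑ i, c₁ * e i * unfilter α (partialDeriv i (oseen t)) x := by
    rw [show oseen t = heatKernel (1 + t) from rfl]
    have i1 := continuous_heatKernel (1 + t)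
    have i2 := measurable_laplacian_heatKernel (1 + t)
    have i3 := measurable_partialDeriv_heatKernel (1 + t)
    have i4 := measurable_laplacian_partialDeriv_heatKernel (1 + t)
    simp only [unfilter, Fin.sum_univ_two]
    have i30 := i3 0
    have i31 := i3 1
    have i40 := i4 0
    have i41 := i4 1
    fun_prop
  have b1 := lintegral_rpow_le_of_interpolation hp hp2 hT0 hN hm1.aestronglyMeasurable hv1 hv2
  have b2 := hg.lintegral_rpow_le (by positivity) hT0 hp
  refine eLpNorm_le_of_lintegral_rpow_le hp0 ?_
  refine (lintegral_mono fun x => ENNReal.rpow_le_rpow ?_ hp0.le).trans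
    ((lintegral_add_rpow_le hp hm1.enorm.aemeasurable hm2.enorm.aemeasurable b1 b2).trans
      (ENNReal.rpow_le_rpow ?_ hp0.le))
  · refine le_trans (le_of_eq ?_) (enorm_add_le _ _)
    congr 1; ring
  · rw [← ENNReal.ofReal_add (by positivity) (by positivity), add_mul N]
    apply ENNReal.ofReal_le_ofReal
    -- The profile error decays like (1+t)^{-2+1/p}, which is fast enough for every μ ≤ 1.
    have hexp : (1 + t)⁻¹ * (1 + t) ^ (-1 + 1 / p) ≤ (1 + t) ^ (-1 - μ + 1 / p) := by
      rw [← Real.rpow_neg_one, ← Real.rpow_add hT0]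
      exact Real.rpow_le_rpow_of_exponent_le (by linarith) (by linarith)
    rw [mul_assoc (49536 * P + 5 * 8256 * α ^ 2 * P)]
    gcongr

end VCHE
end

/-! ### Assembly of the theorem -/

theorem theorem3 (α : ℝ) (hα : 0 < α) (μ : ℝ) (hμ : μ ∈ Set.Ioo (1 / 2 : ℝ) 1) :
    ∃ r₀ : ℝ, 0 < r₀ ∧ ∃ C : ℝ, ∀ v₀ : VCHE.Plane → ℝ,
      VCHE.MemWeightedL2 3 v₀ → VCHE.weightedNorm 3 v₀ ≤ ENNReal.ofReal r₀ →
      ∃ v : ℝ → VCHE.Plane → ℝ,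
        VCHE.IsVorticitySolution α v₀ v ∧
        (∀ v' : ℝ → VCHE.Plane → ℝ, VCHE.IsVorticitySolution α v₀ v' →
          ∀ t : ℝ, 0 ≤ t → v' t =ᵐ[MeasureTheory.volume] v t) ∧
        ∀ p : ℝ, 1 ≤ p → p ≤ 2 → ∀ t : ℝ, 0 ≤ t →
          MeasureTheory.eLpNorm
            (fun x => v t x
              - (∫ y, v₀ y) * VCHE.unfilter α (VCHE.oseen t) x
              - ∑ i : Fin 2, (-∫ y : VCHE.Plane, y i * v₀ y) *
                  VCHE.unfilter α (VCHE.partialDeriv i (VCHE.oseen t)) x)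
            (ENNReal.ofReal p) MeasureTheory.volume
          ≤ ENNReal.ofReal (C * (1 + t) ^ (-1 - μ + 1 / p)) := by
  have hμ0 : 1 / 2 ≤ μ := hμ.1.le
  obtain ⟨K, hK⟩ := VCHE.exists_velBound hα
  obtain ⟨r₁, hr₁, L, hL, hex⟩ := VCHE.exists_mildMap_fixedPoint hα hK hμ0 hμ.2
  obtain ⟨Cv, hCv, hdata⟩ := VCHE.exists_vortexPair_of_weightedNorm_le hμ0 hμ.2
  -- A common bound for the strengths of the vortices and the mean-free data, which are of size r₁,
  -- and for the remainder, of size L r₁.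
  set P := (1 + L) * r₁ with hPdef
  have hP : 0 < P := by positivity
  obtain ⟨C₂, hC₂, hsq⟩ := VCHE.exists_lintegral_sq_rem_le hα hK hμ0 hμ.2 hP
  have hr₁P : r₁ ≤ P := by nlinarith
  have hLP : L * r₁ ≤ P := by nlinarith
  -- The matched pair and the mean-free data exceed the weighted norm by at most a factor Cv, so
  -- this radius brings them down to r₁. The constant adds the bounds for the remainder in the mass
  -- norm (P), in L² (C₂), and for the profile error.
  refine ⟨r₁ / Cv, by positivity, P + C₂ + (49536 * P + 5 * 8256 * α ^ 2 * P), fun v₀ hv₀ hnorm => ?_⟩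
  obtain ⟨f, hfs, hvf⟩ := hv₀.1
  have hf := hfs.measurable
  rw [VCHE.weightedNorm_congr 3 hvf] at hnorm
  obtain ⟨c₀, c₁, e, h₀, h₁, he, hmass, hmoment, hfi, hinit, hinit2⟩ :=
    hdata f (r₁ / Cv) (by positivity) hf hnorm
  rw [mul_div_cancel₀ _ hCv.ne'] at h₀ h₁ hinit hinit2
  obtain ⟨v, hv, hfix⟩ := hex r₁ hr₁.le le_rfl c₀ c₁ e f h₀ h₁ he hf hfi hinit
  have hsol := hv.isVorticitySolution hα (by linarith) (by positivity) h₀ h₁ he hvf hfix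
  refine ⟨v, hsol, fun v' hv' t ht => hsol.unique hα hv' ht, fun p hp hp2 t ht => ?_⟩
  have hvP := hv.mono hLP
  have hv2 := hsq c₀ c₁ e f v (h₀.trans hr₁P) (h₁.trans hr₁P) he hfi (hinit.mono hr₁P)
    (hinit2.trans (by gcongr)) hvP hfix t ht
  have hv1 := (hvP.rem t ht).mass
  have ha : ∫ y, v₀ y = c₀ + c₁ := by rw [hmass]; exact integral_congr_ae hvf
  have hb : ∀ i : Fin 2, -∫ y : VCHE.Plane, y i * v₀ y = c₁ * e i := fun i => by
    rw [hmoment i]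
    congr 1
    exact integral_congr_ae (hvf.mono fun y hy => by simp only [hy])
  simp_rw [ha, hb]
  have hT : 0 ≤ 1 + t := by linarith
  exact VCHE.eLpNorm_sub_profile_le hμ.2.le (h₀.trans hr₁P) (h₁.trans hr₁P) he (by positivity) hp hp2 ht
    (hv.measurable_slice t)
    (hv1.trans (ENNReal.ofReal_le_ofReal (by gcongr; linarith)))
    (hv2.trans (ENNReal.rpow_le_rpow (ENNReal.ofReal_le_ofReal (by gcongr; linarith)) (by norm_num)))
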